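/- Let $\Bbbk$ be a commutative ring; all rings are $\Bbbk$-algebras and $\Bbbk$ acts centrally on all modules. Let $(R,S,P,Q,\phi,\psi)$ be a Morita context: $P$ is an $(S,R)$-bimodule, $Q$ an $(R,S)$-bimodule, and $\phi\colon P\otimes_R Q\to S$, $\psi\colon Q\otimes_S P\to R$ are bimodule isomorphisms such that, writing $pq=\phi(p\otimes q)$ and $qp=\psi(q\otimes p)$, one has $(pq)p'=p(qp')$ and $(qp)q'=q(pq')$. Write $\phi^{-1}(1)=\sum_j p'_j\otimes q'_j$ and $\psi^{-1}(1)=\sum_i q_i\otimes p_i$. Let $U$ be a left Hopf algebroid over $R$, with source $s\colon R\to U$ and target $t\colon R^{o}\to U$ (with commuting images), coproduct $\Delta(u)=u_{(1)}\otimes_R u_{(2)}\in U_{\triangleleft}\otimes_R{}_{\triangleright}U$ and counit $\varepsilon$, where $r\triangleright u\triangleleft r'=s(r)t(r')u$; the left Hopf property says that $\beta(u\otimes v)=u_{(1)}\otimes u_{(2)}v$ is a bijection from $U\otimes_{R^{o}}U=(U\otimes_{\Bbbk} U)/(u\,t(r)\otimes v-u\otimes t(r)v)$ to $U_{\triangleleft}\otimes_R{}_{\triangleright}U$,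 and $u_+\otimes u_-:=\beta^{-1}(u\otimes 1)$. A right $U$-module is an $(R,R)$-bimodule by $r\blacktriangleright m\blacktriangleleft r'=m\,s(r')t(r)$. A left $U$-comodule $M$, with coaction $\Delta_M(m)=m_{(-1)}\otimes m_{(0)}\in U_{\triangleleft}\otimes_R M$, is a left $R$-module, and it is an $(R,R)$-bimodule with $mr=\varepsilon(m_{(-1)}s(r))m_{(0)}$. A right $U$-module and left $U$-comodule $M$ is called anti Yetter--Drinfel'd (aYD) if these two bimodule structures coincide and $$\Delta_M(mu)=u_-m_{(-1)}u_{+(1)}\otimes_R m_{(0)}u_{+(2)}\qquad(m\in M,\ u\in U),$$ where $u_{+(1)}\otimes u_{+(2)}\otimes u_-$ is read as $u_{(1)}\otimes u_{(2)+}\otimes u_{(2)-}$; it is stable (SaYD) if moreover $m_{(0)}m_{(-1)}=m$ for all $m$. Let $\tilde U=(P\otimes_{\Bbbk} Q^{o})\otimes_{R^{e}}U\otimes_{R^{e}}(Q\otimes_{\Bbbk} P^{o})$, and for $\tilde u=(a\otimes b^o)\otimes u\otimes(c\otimes d^o)$, $\tilde u_k=(a_k\otimes b_k^o)\otimes u_k\otimes(c_k\otimes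 d_k^o)$ put $$\tilde u_1\tilde u_2=(a_1\otimes b_1^o)\otimes u_1\,s(c_1a_2)\,t(b_2d_1)\,u_2\otimes(c_2\otimes d_2^o),\qquad \tilde\varepsilon(\tilde u)=a\,\varepsilon(u\,s(cd))\,b,$$ $$\tilde s(x)\tilde t(y)=\sum_{i,j}(xp'_j\otimes {q'_i}^o)\otimes 1\otimes(q'_j\otimes(yp'_i)^o),$$ $$\tilde\Delta(\tilde u)=\sum_{i,j}\big((a\otimes q_i^o)\otimes u_{(1)}\otimes(c\otimes {p'_j}^o)\big)\otimes_S\big((p_i\otimes b^o)\otimes u_{(2)}\otimes(q'_j\otimes d^o)\big).$$ Let $M$ be a right $U$-module and left $U$-comodule and $\tilde M=P\otimes_R M\otimes_R Q$, with $$(p\otimes m\otimes q)\,\tilde u=d\otimes\big((bp)\blacktriangleright m\blacktriangleleft(qa)\big)u\otimes c,$$ $$\Delta_{\tilde M}(p\otimes m\otimes q)=\sum_{i,j}\big((p\otimes q_i^o)\otimes m_{(-1)}\otimes(q\otimes {p'_j}^o)\big)\otimes_S(p_i\otimes m_{(0)}\otimes q'_j).$$ (The right $\tilde U$-module is formed with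 the bimodule structure of the right $U$-module $M$, the left $\tilde U$-comodule with that of the left $U$-comodule $M$; "$\tilde M$ is (S)aYD" includes that the two versions of $P\otimes_R M\otimes_R Q$ coincide, i.e. that $p\otimes m\otimes q\mapsto p\otimes m\otimes q$ is a well-defined isomorphism between them.) Then $\tilde U$ is a left Hopf algebroid over $S$, $\tilde M$ is a right $\tilde U$-module and a left $\tilde U$-comodule, and $M$ is aYD (respectively SaYD) over $U$ if and only if $\tilde M$ is aYD (respectively SaYD) over $\tilde U$. -/

import Mathlib

open scoped TensorProduct
open MulOpposite

noncomputable section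

namespace MoritaBaseChange

/-! ### Tensor products over noncommutative rings

All rings are algebras over a commutative ring `k`, and all modules have an underlying `k`-module on
which `k` acts centrally.  An action of a ring on a `k`-module is recorded by the `k`-linear
endomorphisms by which its elements act. -/

/-- The relations `m·i ⊗ n = m ⊗ i·n`, where `i` acts on `M` through `ρ i` and on `N` through `l i`. -/
def balRel {k ι M N : Type*} [CommRing k] [AddCommGroup M] [Module k M] [AddCommGroup N] [Module k N]
    (ρ : ι → Module.End k M) (l : ι → Module.End k N) : Submodule k (M ⊗[k] N) :=
  Submodule.span k {x | ∃ i m n, x = ρ i m ⊗ₜ[k] n - m ⊗ₜ[k] l i n}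

/-- The balanced tensor product `M ⊗_ι N`: if `ι` is a `k`-algebra acting on `M` from the right through
`ρ` and on `N` from the left through `l`, this is the tensor product of `M` and `N` over that ring. -/
def BalTensor {k ι M N : Type*} [CommRing k] [AddCommGroup M] [Module k M] [AddCommGroup N]
    [Module k N] (ρ : ι → Module.End k M) (l : ι → Module.End k N) : Type _ :=
  (M ⊗[k] N) ⧸ balRel ρ l

namespace BalTensor

variable {k ι M N M' N' X : Type*} [CommRing k] [AddCommGroup M] [Module k M] [AddCommGroup N]
  [Module k N] [AddCommGroup M'] [Module k M'] [AddCommGroup N'] [Module k N'] [AddCommGroup X]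
  [Module k X] (ρ : ι → Module.End k M) (l : ι → Module.End k N)

instance : AddCommGroup (BalTensor ρ l) := inferInstanceAs (AddCommGroup ((M ⊗[k] N) ⧸ balRel ρ l))

instance : Module k (BalTensor ρ l) := inferInstanceAs (Module k ((M ⊗[k] N) ⧸ balRel ρ l))

/-- The quotient map from `M ⊗[k] N`. -/
def proj : M ⊗[k] N →ₗ[k] BalTensor ρ l := (balRel ρ l).mkQ

/-- The pure tensor `m ⊗ n`. -/
def mk : M →ₗ[k] N →ₗ[k] BalTensor ρ l := (TensorProduct.mk k M N).compr₂ (proj ρ l)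

theorem proj_tmul (m : M) (n : N) : proj ρ l (m ⊗ₜ n) = mk ρ l m n := rfl

theorem mk_bal (i : ι) (m : M) (n : N) : mk ρ l (ρ i m) n = mk ρ l m (l i n) :=
  (Submodule.Quotient.eq _).2 (Submodule.subset_span ⟨i, m, n, rfl⟩)

variable {ρ l}

/-- The linear map induced by a balanced bilinear map. -/
def lift (f : M →ₗ[k] N →ₗ[k] X) (h : ∀ i m n, f (ρ i m) n = f m (l i n)) :
    BalTensor ρ l →ₗ[k] X :=
  (balRel ρ l).liftQ (TensorProduct.lift f) (Submodule.span_le.2 (by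
    rintro _ ⟨i, m, n, rfl⟩
    simp [h]))

@[simp]
theorem lift_mk (f : M →ₗ[k] N →ₗ[k] X) (h : ∀ i m n, f (ρ i m) n = f m (l i n)) (m : M) (n : N) :
    lift f h (mk ρ l m n) = f m n :=
  (Submodule.liftQ_apply _ _ _).trans (TensorProduct.lift.tmul _ _)

theorem induction {motive : BalTensor ρ l → Prop} (mk : ∀ m n, motive (mk ρ l m n))
    (zero : motive 0) (add : ∀ x y, motive x → motive y → motive (x + y)) (x : BalTensor ρ l) :
    motive x := by
  obtain ⟨y, rfl⟩ : ∃ y, proj ρ l y = x := (balRel ρ l).mkQ_surjective x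
  induction y with
  | zero => rw [map_zero]; exact zero
  | tmul m n => exact mk m n
  | add a b ha hb => rw [map_add]; exact add _ _ ha hb

theorem hom_ext {f g : BalTensor ρ l →ₗ[k] X} (h : ∀ m n, f (mk ρ l m n) = g (mk ρ l m n)) :
    f = g := by
  ext x
  induction x using induction with
  | mk m n => exact h m n
  | zero => simp
  | add a b ha hb => simp [ha, hb]

/-- Every element is a finite sum of pure tensors. -/
theorem exists_rep (x : BalTensor ρ l) :
    ∃ (n : ℕ) (a : Fin n → M) (b : Fin n → N), x = ∑ i, mk ρ l (a i) (b i) := by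
  induction x using induction with
  | mk m n => exact ⟨1, fun _ => m, fun _ => n, by simp⟩
  | zero => exact ⟨0, Fin.elim0, Fin.elim0, by simp⟩
  | add x y hx hy =>
    obtain ⟨n, a, b, rfl⟩ := hx
    obtain ⟨n', a', b', rfl⟩ := hy
    exact ⟨n + n', Fin.append a a', Fin.append b b', by simp [Fin.sum_univ_add]⟩

/-- The tensor product `f ⊗ g` of two equivariant maps. -/
def map {ρ' : ι → Module.End k M'} {l' : ι → Module.End k N'} (f : M →ₗ[k] M') (g : N →ₗ[k] N')
    (hf : ∀ i m, f (ρ i m) = ρ' i (f m)) (hg : ∀ i n, g (l i n) = l' i (g n)) :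
    BalTensor ρ l →ₗ[k] BalTensor ρ' l' :=
  lift ((mk ρ' l').compl₁₂ f g) (by intro i m n; simp [hf, hg, mk_bal])

@[simp]
theorem map_mk {ρ' : ι → Module.End k M'} {l' : ι → Module.End k N'} (f : M →ₗ[k] M')
    (g : N →ₗ[k] N') (hf : ∀ i m, f (ρ i m) = ρ' i (f m)) (hg : ∀ i n, g (l i n) = l' i (g n))
    (m : M) (n : N) : map f g hf hg (mk ρ l m n) = mk ρ' l' (f m) (g n) := by
  simp [map]

end BalTensor

/-- The relations of a threefold tensor product `A ⊗_ι X ⊗_ι B`. -/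
def triRel {k ι A X B : Type*} [CommRing k] [AddCommGroup A] [Module k A] [AddCommGroup X]
    [Module k X] [AddCommGroup B] [Module k B] (ρA : ι → Module.End k A)
    (lX ρX : ι → Module.End k X) (lB : ι → Module.End k B) : Submodule k (A ⊗[k] (X ⊗[k] B)) :=
  Submodule.span k
    ({z | ∃ i a x b, z = ρA i a ⊗ₜ[k] (x ⊗ₜ[k] b) - a ⊗ₜ[k] (lX i x ⊗ₜ[k] b)} ∪
      {z | ∃ i a x b, z = a ⊗ₜ[k] (ρX i x ⊗ₜ[k] b) - a ⊗ₜ[k] (x ⊗ₜ[k] lB i b)})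

/-- The threefold tensor product `A ⊗_ι X ⊗_ι B` of a right module `A` (action `ρA`), a bimodule `X`
(actions `lX` and `ρX`) and a left module `B` (action `lB`). -/
def TriTensor {k ι A X B : Type*} [CommRing k] [AddCommGroup A] [Module k A] [AddCommGroup X]
    [Module k X] [AddCommGroup B] [Module k B] (ρA : ι → Module.End k A)
    (lX ρX : ι → Module.End k X) (lB : ι → Module.End k B) : Type _ :=
  (A ⊗[k] (X ⊗[k] B)) ⧸ triRel ρA lX ρX lB

namespace TriTensor

variable {k ι A X B Y : Type*} [CommRing k] [AddCommGroup A] [Module k A] [AddCommGroup X]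
  [Module k X] [AddCommGroup B] [Module k B] [AddCommGroup Y] [Module k Y]
  (ρA : ι → Module.End k A) (lX ρX : ι → Module.End k X) (lB : ι → Module.End k B)

instance : AddCommGroup (TriTensor ρA lX ρX lB) :=
  inferInstanceAs (AddCommGroup ((A ⊗[k] (X ⊗[k] B)) ⧸ triRel ρA lX ρX lB))

instance : Module k (TriTensor ρA lX ρX lB) :=
  inferInstanceAs (Module k ((A ⊗[k] (X ⊗[k] B)) ⧸ triRel ρA lX ρX lB))

/-- The quotient map from `A ⊗[k] (X ⊗[k] B)`. -/
def proj : A ⊗[k] (X ⊗[k] B) →ₗ[k] TriTensor ρA lX ρX lB := (triRel ρA lX ρX lB).mkQ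

/-- The pure tensor `a ⊗ x ⊗ b`. -/
def mk : A →ₗ[k] X →ₗ[k] B →ₗ[k] TriTensor ρA lX ρX lB :=
  LinearMap.mk₂ k (fun a x => proj ρA lX ρX lB ∘ₗ TensorProduct.mk k A (X ⊗[k] B) a ∘ₗ
      TensorProduct.mk k X B x)
    (by intros; ext; simp)
    (by intros; ext; simp)
    (by intros; ext; simp [TensorProduct.tmul_add])
    (by intros; ext; simp)

theorem proj_tmul (a : A) (x : X) (b : B) :
    proj ρA lX ρX lB (a ⊗ₜ (x ⊗ₜ b)) = mk ρA lX ρX lB a x b := rfl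

theorem mk_left (i : ι) (a : A) (x : X) (b : B) :
    mk ρA lX ρX lB (ρA i a) x b = mk ρA lX ρX lB a (lX i x) b :=
  (Submodule.Quotient.eq _).2 (Submodule.subset_span (Or.inl ⟨i, a, x, b, rfl⟩))

theorem mk_right (i : ι) (a : A) (x : X) (b : B) :
    mk ρA lX ρX lB a (ρX i x) b = mk ρA lX ρX lB a x (lB i b) :=
  (Submodule.Quotient.eq _).2 (Submodule.subset_span (Or.inr ⟨i, a, x, b, rfl⟩))

variable {ρA lX ρX lB}

/-- The linear map induced by a balanced trilinear map. -/
def lift (f : A →ₗ[k] X →ₗ[k] B →ₗ[k] Y)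
    (h₁ : ∀ i a x b, f (ρA i a) x b = f a (lX i x) b)
    (h₂ : ∀ i a x b, f a (ρX i x) b = f a x (lB i b)) : TriTensor ρA lX ρX lB →ₗ[k] Y :=
  (triRel ρA lX ρX lB).liftQ (TensorProduct.lift (TensorProduct.uncurry (.id k) X B Y ∘ₗ f))
    (Submodule.span_le.2 (by
      rintro _ (⟨i, a, x, b, rfl⟩ | ⟨i, a, x, b, rfl⟩)
      · simp [h₁]
      · simp [h₂]))

@[simp]
theorem lift_mk (f : A →ₗ[k] X →ₗ[k] B →ₗ[k] Y)
    (h₁ : ∀ i a x b, f (ρA i a) x b = f a (lX i x) b)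
    (h₂ : ∀ i a x b, f a (ρX i x) b = f a x (lB i b)) (a : A) (x : X) (b : B) :
    lift f h₁ h₂ (mk ρA lX ρX lB a x b) = f a x b :=
  (Submodule.liftQ_apply _ _ _).trans (by simp)

theorem induction {motive : TriTensor ρA lX ρX lB → Prop}
    (mk : ∀ a x b, motive (mk ρA lX ρX lB a x b))
    (zero : motive 0) (add : ∀ x y, motive x → motive y → motive (x + y))
    (z : TriTensor ρA lX ρX lB) : motive z := by
  obtain ⟨y, rfl⟩ : ∃ y, proj ρA lX ρX lB y = z := (triRel ρA lX ρX lB).mkQ_surjective z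
  induction y with
  | zero => rw [map_zero]; exact zero
  | tmul a y =>
    induction y with
    | zero => rw [TensorProduct.tmul_zero, map_zero]; exact zero
    | tmul x b => exact mk a x b
    | add y z hy hz => rw [TensorProduct.tmul_add, map_add]; exact add _ _ hy hz
  | add a b ha hb => rw [map_add]; exact add _ _ ha hb

theorem hom_ext {f g : TriTensor ρA lX ρX lB →ₗ[k] Y}
    (h : ∀ a x b, f (mk ρA lX ρX lB a x b) = g (mk ρA lX ρX lB a x b)) : f = g := by
  ext z
  induction z using induction with
  | mk a x b => exact h a x b
  | zero => simp
  | add a b ha hb => simp [ha, hb]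

end TriTensor

/-! ### Left Hopf algebroids -/

/-- An `Rᵉ`-ring `U`, that is, an algebra map `η : R ⊗ Rᵒ → U`, given by its restrictions to the two
factors: the source `s` and the target `t`, whose images commute. -/
structure EnvRing (k R U : Type*) [CommRing k] [Ring R] [Algebra k R] [Ring U] [Algebra k U] where
  s : R →ₐ[k] U
  t : Rᵐᵒᵖ →ₐ[k] U
  comm : ∀ a b, s a * t b = t b * s a

namespace EnvRing

variable {k R U M : Type*} [CommRing k] [Ring R] [Algebra k R] [Ring U] [Algebra k U]
  [AddCommGroup M] [Module k M] (E : EnvRing k R U)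

/-- The left action `r ▹ u = s(r) u`. -/
def lS (r : R) : Module.End k U := LinearMap.mulLeft k (E.s r)

/-- The right action `u ◃ r = t(r) u`. -/
def lT (r : R) : Module.End k U := LinearMap.mulLeft k (E.t (op r))

/-- The right action `u ◂ r = u s(r)`. -/
def rS (r : R) : Module.End k U := LinearMap.mulRight k (E.s r)

/-- The left action `r ▸ u = u t(r)`. -/
def rT (r : R) : Module.End k U := LinearMap.mulRight k (E.t (op r))

@[simp] theorem lS_apply (r : R) (u : U) : E.lS r u = E.s r * u := rfl
@[simp] theorem lT_apply (r : R) (u : U) : E.lT r u = E.t (op r) * u := rfl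
@[simp] theorem rS_apply (r : R) (u : U) : E.rS r u = u * E.s r := rfl
@[simp] theorem rT_apply (r : R) (u : U) : E.rT r u = u * E.t (op r) := rfl

/-- `U_◃ ⊗_R M` for a left `R`-module `M` with action `l`. -/
abbrev Tens (l : R → Module.End k M) : Type _ := BalTensor E.lT l

/-- `U_◃ ⊗_R ▹U`. -/
abbrev Tens₂ : Type _ := BalTensor E.lT E.lS

/-- The pure tensor `u ⊗ m` in `U_◃ ⊗_R M`. -/
abbrev tmul (l : R → Module.End k M) : U →ₗ[k] M →ₗ[k] E.Tens l := BalTensor.mk E.lT l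

/-- The pure tensor `u ⊗ v` in `U_◃ ⊗_R ▹U`. -/
abbrev tmul₂ : U →ₗ[k] U →ₗ[k] E.Tens₂ := BalTensor.mk E.lT E.lS

/-- The left `R`-action `r ▹ (u ⊗ m) = s(r) u ⊗ m` on `U_◃ ⊗_R M`. -/
def lTens (l : R → Module.End k M) (r : R) : Module.End k (E.Tens l) :=
  BalTensor.map (E.lS r) LinearMap.id
    (fun i m => by simp only [lS_apply, lT_apply, ← mul_assoc, E.comm]) (fun _ _ => rfl)

/-- Right multiplication `u ⊗ v ↦ u x ⊗ v y` on `U_◃ ⊗_R ▹U`. -/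
def rmul (x y : U) : Module.End k E.Tens₂ :=
  BalTensor.map (LinearMap.mulRight k x) (LinearMap.mulRight k y)
    (fun i m => by simp [mul_assoc]) (fun i m => by simp [mul_assoc])

/-- `U_◃ ⊗_R (▹U_◃ ⊗_R M)`. -/
abbrev Tens₃ (l : R → Module.End k M) : Type _ := E.Tens (E.lTens l)

/-- The pure tensor `u ⊗ (v ⊗ m)`. -/
abbrev tmul₃ (l : R → Module.End k M) (u v : U) (m : M) : E.Tens₃ l :=
  E.tmul (E.lTens l) u (E.tmul l v m)

@[simp] theorem lTens_tmul (l : R → Module.End k M) (r : R) (u : U) (m : M) :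
    E.lTens l r (E.tmul l u m) = E.tmul l (E.s r * u) m :=
  BalTensor.map_mk _ _ _ _ _ _

@[simp] theorem rmul_tmul (x y u v : U) : E.rmul x y (E.tmul₂ u v) = E.tmul₂ (u * x) (v * y) :=
  BalTensor.map_mk _ _ _ _ _ _

end EnvRing

/-- The structure maps of a left bialgebroid over `R`: an `Rᵉ`-ring with a coproduct and a counit. -/
structure LeftBialgebroidData (k R U : Type*) [CommRing k] [Ring R] [Algebra k R] [Ring U]
    [Algebra k U] extends EnvRing k R U where
  comul : U →ₗ[k] BalTensor toEnvRing.lT toEnvRing.lS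
  counit : U →ₗ[k] R

namespace LeftBialgebroidData

variable {k R U M : Type*} [CommRing k] [Ring R] [Algebra k R] [Ring U] [Algebra k U]
  [AddCommGroup M] [Module k M] (H : LeftBialgebroidData k R U)

/-- The axioms of a left bialgebroid.  Identities in Sweedler notation are required for all
representations of the occurring tensors as finite sums of pure tensors. -/
structure IsLeftBialgebroid : Prop where
  /-- `r ▸ u₍₁₎ ⊗ u₍₂₎ = u₍₁₎ ⊗ u₍₂₎ ◂ r`: the coproduct takes values in `U ×_R U`. -/
  comul_takeuchi : ∀ u r, H.rmul (H.t (op r)) 1 (H.comul u) = H.rmul 1 (H.s r) (H.comul u)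
  /-- The coproduct is a map of `Rᵉ`-rings `U → U ×_R U`: compatibility with `η`. -/
  comul_st : ∀ r r', H.comul (H.s r * H.t (op r')) = H.tmul₂ (H.s r) (H.t (op r'))
  /-- The coproduct is multiplicative: `Δ(uv) = u₍₁₎v₍₁₎ ⊗ u₍₂₎v₍₂₎`. -/
  comul_mul : ∀ (u v : U) (n : ℕ) (x y : Fin n → U), H.comul v = ∑ i, H.tmul₂ (x i) (y i) →
    H.comul (u * v) = ∑ i, H.rmul (x i) (y i) (H.comul u)
  /-- Coassociativity. -/
  coassoc : ∀ (u : U) (n : ℕ) (x y : Fin n → U), H.comul u = ∑ i, H.tmul₂ (x i) (y i) →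
    ∀ (a b : Fin n → ℕ) (x' x'' : (i : Fin n) → Fin (a i) → U) (y' y'' : (i : Fin n) → Fin (b i) → U),
    (∀ i, H.comul (x i) = ∑ j, H.tmul₂ (x' i j) (x'' i j)) →
    (∀ i, H.comul (y i) = ∑ j, H.tmul₂ (y' i j) (y'' i j)) →
    ∑ i, ∑ j, H.tmul₃ H.lS (x' i j) (x'' i j) (y i) = ∑ i, ∑ j, H.tmul₃ H.lS (x i) (y' i j) (y'' i j)
  /-- Left counitality: `s(ε(u₍₁₎)) u₍₂₎ = u`. -/
  counit_left : ∀ (u : U) (n : ℕ) (x y : Fin n → U), H.comul u = ∑ i, H.tmul₂ (x i) (y i) →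
    ∑ i, H.s (H.counit (x i)) * y i = u
  /-- Right counitality: `t(ε(u₍₂₎)) u₍₁₎ = u`. -/
  counit_right : ∀ (u : U) (n : ℕ) (x y : Fin n → U), H.comul u = ∑ i, H.tmul₂ (x i) (y i) →
    ∑ i, H.t (op (H.counit (y i))) * x i = u
  /-- `ε̂(u)(r) = ε(u ◂ r)` defines a map `ε̂ : U → End_k(R)` of `Rᵉ`-rings: compatibility with `η`. -/
  counit_st : ∀ r r' a, H.counit (H.s r * H.t (op r') * H.s a) = r * a * r'
  /-- `ε̂(uv) = ε̂(u) ∘ ε̂(v)`. -/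
  counit_mul : ∀ u v a, H.counit (u * v * H.s a) = H.counit (u * H.s (H.counit (v * H.s a)))

/-- The expression `u₍₁₎ ⊗ u₍₂₎ v` of the Galois map. -/
def galois (u v : U) : H.Tens₂ := H.rmul 1 v (H.comul u)

/-- The left Hopf property: the Galois map `β : ▸U ⊗_{Rᵒ} U_◃ → U_◃ ⊗_R ▹U`,
`u ⊗ v ↦ u₍₁₎ ⊗ u₍₂₎ v`, is a bijection. -/
def IsLeftHopf : Prop :=
  ∃ β : BalTensor H.rT H.lT →ₗ[k] H.Tens₂,
    (∀ u v, β (BalTensor.mk H.rT H.lT u v) = H.galois u v) ∧ Function.Bijective β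

/-- A left Hopf algebroid is a left bialgebroid with bijective Galois map. -/
structure IsLeftHopfAlgebroid : Prop extends H.IsLeftBialgebroid where
  hopf : H.IsLeftHopf

/-- `∑ⱼ y j ⊗ z j` represents `u₊ ⊗ u₋ = β⁻¹(u ⊗ 1)`. -/
def IsTranslation (u : U) {n : ℕ} (y z : Fin n → U) : Prop :=
  ∑ j, H.galois (y j) (z j) = H.tmul₂ u 1

/-- The structure maps of a left `U`-comodule on a `k`-module `M`: a left `R`-module structure and a
coaction `M → U_◃ ⊗_R M`. -/
structure LeftComoduleData (M : Type*) [AddCommGroup M] [Module k M] where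
  lact : R →ₐ[k] Module.End k M
  coact : M →ₗ[k] BalTensor H.lT (fun r => lact r)

variable {H}

/-- The axioms of a left comodule: the coaction is left `R`-linear, coassociative and counital. -/
structure LeftComoduleData.IsLeftComodule (N : H.LeftComoduleData M) : Prop where
  coact_lact : ∀ r m, N.coact (N.lact r m) = H.lTens (fun r => N.lact r) r (N.coact m)
  coassoc : ∀ (m : M) (n : ℕ) (x : Fin n → U) (y : Fin n → M),
    N.coact m = ∑ i, H.tmul (fun r => N.lact r) (x i) (y i) →
    ∀ (a b : Fin n → ℕ) (x' x'' : (i : Fin n) → Fin (a i) → U)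
      (y' : (i : Fin n) → Fin (b i) → U) (y'' : (i : Fin n) → Fin (b i) → M),
    (∀ i, H.comul (x i) = ∑ j, H.tmul₂ (x' i j) (x'' i j)) →
    (∀ i, N.coact (y i) = ∑ j, H.tmul (fun r => N.lact r) (y' i j) (y'' i j)) →
    ∑ i, ∑ j, H.tmul₃ (fun r => N.lact r) (x' i j) (x'' i j) (y i) =
      ∑ i, ∑ j, H.tmul₃ (fun r => N.lact r) (x i) (y' i j) (y'' i j)
  counit : ∀ (m : M) (n : ℕ) (x : Fin n → U) (y : Fin n → M),
    N.coact m = ∑ i, H.tmul (fun r => N.lact r) (x i) (y i) →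
    ∑ i, N.lact (H.counit (x i)) (y i) = m

/-- Anti Yetter–Drinfel'd modules.  `act` is the right `U`-module structure, `m u = act (op u) m`. -/
structure IsAYD (act : Uᵐᵒᵖ →ₐ[k] Module.End k M) (N : H.LeftComoduleData M) : Prop where
  /-- The left `R`-actions agree: `r m = m t(r)`. -/
  left_eq : ∀ (r : R) (m : M), N.lact r m = act (op (H.t (op r))) m
  /-- The right `R`-actions agree: `ε(m₍₋₁₎ ◂ r) m₍₀₎ = m s(r)`. -/
  right_eq : ∀ (r : R) (m : M) (n : ℕ) (x : Fin n → U) (y : Fin n → M),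
    N.coact m = ∑ i, H.tmul (fun r => N.lact r) (x i) (y i) →
    ∑ i, N.lact (H.counit (x i * H.s r)) (y i) = act (op (H.s r)) m
  /-- `Δ_M(m u) = u₋ m₍₋₁₎ u₊₍₁₎ ⊗ m₍₀₎ u₊₍₂₎`.  Here `u₊₍₁₎ ⊗ u₊₍₂₎ ⊗ u₋` is taken in the form
  `u₍₁₎ ⊗ u₍₂₎₊ ⊗ u₍₂₎₋`: with `Δ(u) = ∑ᵢ x i ⊗ v i`, `(v i)₊ ⊗ (v i)₋ = ∑ⱼ y i j ⊗ z i j` and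
  `Δ_M(m) = ∑ₗ n l ⊗ e l`, the right hand side is `∑ z i j * n l * x i ⊗ (e l) (y i j)`.  (The
  right hand side is independent of these choices, but it would depend on the choice of an arbitrary
  preimage of `u₊₍₁₎ ⊗ u₊₍₂₎ ⊗ u₋` in `U ⊗[k] U ⊗[k] U`.) -/
  compat : ∀ (u : U) (m : M) (a : ℕ) (x v : Fin a → U) (b : Fin a → ℕ)
    (y z : (i : Fin a) → Fin (b i) → U) (c : ℕ) (n : Fin c → U) (e : Fin c → M),
    H.comul u = ∑ i, H.tmul₂ (x i) (v i) →
    (∀ i, H.IsTranslation (v i) (y i) (z i)) →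
    N.coact m = ∑ l, H.tmul (fun r => N.lact r) (n l) (e l) →
    N.coact (act (op u) m) =
      ∑ i, ∑ j, ∑ l, H.tmul (fun r => N.lact r) (z i j * n l * x i) (act (op (y i j)) (e l))

/-- Stable anti Yetter–Drinfel'd modules: moreover `m₍₀₎ m₍₋₁₎ = m`. -/
structure IsSAYD (act : Uᵐᵒᵖ →ₐ[k] Module.End k M) (N : H.LeftComoduleData M) : Prop
    extends IsAYD act N where
  stable : ∀ (m : M) (n : ℕ) (x : Fin n → U) (y : Fin n → M),
    N.coact m = ∑ i, H.tmul (fun r => N.lact r) (x i) (y i) →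
    ∑ i, act (op (x i)) (y i) = m

end LeftBialgebroidData

/-! ### Morita contexts -/

/-- A Morita context `(R, S, P, Q, φ, ψ)`: an `(S,R)`-bimodule `P`, an `(R,S)`-bimodule `Q`, and
bimodule isomorphisms `φ : P ⊗_R Q ≃ S`, `ψ : Q ⊗_S P ≃ R` such that `(pq)p' = p(qp')` and
`(qp)q' = q(pq')`, where `pq = φ(p ⊗ q)` and `qp = ψ(q ⊗ p)`. -/
structure MoritaContext (k R S P Q : Type*) [CommRing k] [Ring R] [Algebra k R] [Ring S]
    [Algebra k S] [AddCommGroup P] [Module k P] [Module S P] [Module Rᵐᵒᵖ P] [SMulCommClass S Rᵐᵒᵖ P]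
    [IsScalarTower k S P] [IsScalarTower k Rᵐᵒᵖ P] [AddCommGroup Q] [Module k Q] [Module R Q]
    [Module Sᵐᵒᵖ Q] [SMulCommClass R Sᵐᵒᵖ Q] [IsScalarTower k R Q] [IsScalarTower k Sᵐᵒᵖ Q] where
  φ : BalTensor (fun r : R => Algebra.lsmul k k P (op r)) (fun r : R => Algebra.lsmul k k Q r) ≃ₗ[k] S
  ψ : BalTensor (fun x : S => Algebra.lsmul k k Q (op x)) (fun x : S => Algebra.lsmul k k P x) ≃ₗ[k] R
  φ_left : ∀ (x : S) p q, φ (BalTensor.mk _ _ (x • p) q) = x * φ (BalTensor.mk _ _ p q)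
  φ_right : ∀ (x : S) p q, φ (BalTensor.mk _ _ p (op x • q)) = φ (BalTensor.mk _ _ p q) * x
  ψ_left : ∀ (r : R) q p, ψ (BalTensor.mk _ _ (r • q) p) = r * ψ (BalTensor.mk _ _ q p)
  ψ_right : ∀ (r : R) q p, ψ (BalTensor.mk _ _ q (op r • p)) = ψ (BalTensor.mk _ _ q p) * r
  assoc_P : ∀ p q p', φ (BalTensor.mk _ _ p q) • p' = op (ψ (BalTensor.mk _ _ q p')) • p
  assoc_Q : ∀ q p q', ψ (BalTensor.mk _ _ q p) • q' = op (φ (BalTensor.mk _ _ p q')) • q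


namespace MoritaContext

variable {k R S P Q U M : Type*} [CommRing k] [Ring R] [Algebra k R] [Ring S]
  [Algebra k S] [AddCommGroup P] [Module k P] [Module S P] [Module Rᵐᵒᵖ P] [SMulCommClass S Rᵐᵒᵖ P]
  [IsScalarTower k S P] [IsScalarTower k Rᵐᵒᵖ P] [AddCommGroup Q] [Module k Q] [Module R Q]
  [Module Sᵐᵒᵖ Q] [SMulCommClass R Sᵐᵒᵖ Q] [IsScalarTower k R Q] [IsScalarTower k Sᵐᵒᵖ Q]
  [Ring U] [Algebra k U] [AddCommGroup M] [Module k M]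
  (C : MoritaContext k R S P Q)

/-- `pq = φ(p ⊗ q)`. -/
def pq : P →ₗ[k] Q →ₗ[k] S := (BalTensor.mk _ _).compr₂ C.φ.toLinearMap

/-- `qp = ψ(q ⊗ p)`. -/
def qp : Q →ₗ[k] P →ₗ[k] R := (BalTensor.mk _ _).compr₂ C.ψ.toLinearMap

theorem pq_bal (p : P) (r : R) (q : Q) : C.pq (op r • p) q = C.pq p (r • q) :=
  congrArg C.φ (BalTensor.mk_bal (fun r : R => Algebra.lsmul k k P (op r))
    (fun r : R => Algebra.lsmul k k Q r) r p q)

theorem qp_bal (q : Q) (x : S) (p : P) : C.qp (op x • q) p = C.qp q (x • p) :=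
  congrArg C.ψ (BalTensor.mk_bal (fun x : S => Algebra.lsmul k k Q (op x))
    (fun x : S => Algebra.lsmul k k P x) x q p)

theorem pq_left (x : S) (p : P) (q : Q) : C.pq (x • p) q = x * C.pq p q := C.φ_left x p q
theorem pq_right (x : S) (p : P) (q : Q) : C.pq p (op x • q) = C.pq p q * x := C.φ_right x p q
theorem qp_left (r : R) (q : Q) (p : P) : C.qp (r • q) p = r * C.qp q p := C.ψ_left r q p
theorem qp_right (r : R) (q : Q) (p : P) : C.qp q (op r • p) = C.qp q p * r := C.ψ_right r q p
theorem pq_smul (p : P) (q : Q) (p' : P) : C.pq p q • p' = op (C.qp q p') • p := C.assoc_P p q p'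
theorem qp_smul (q : Q) (p : P) (q' : Q) : C.qp q p • q' = op (C.pq p q') • q := C.assoc_Q q p q'

/-- The number of terms of a chosen representation `φ⁻¹(1) = ∑ⱼ p'ⱼ ⊗ q'ⱼ`. -/
def nS : ℕ := (BalTensor.exists_rep (C.φ.symm 1)).choose
/-- The elements `p'ⱼ`. -/
def p' : Fin C.nS → P := (BalTensor.exists_rep (C.φ.symm 1)).choose_spec.choose
/-- The elements `q'ⱼ`. -/
def q' : Fin C.nS → Q := (BalTensor.exists_rep (C.φ.symm 1)).choose_spec.choose_spec.choose
/-- The number of terms of a chosen representation `ψ⁻¹(1) = ∑ᵢ qᵢ ⊗ pᵢ`. -/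
def nR : ℕ := (BalTensor.exists_rep (C.ψ.symm 1)).choose
/-- The elements `qᵢ`. -/
def q : Fin C.nR → Q := (BalTensor.exists_rep (C.ψ.symm 1)).choose_spec.choose
/-- The elements `pᵢ`. -/
def p : Fin C.nR → P := (BalTensor.exists_rep (C.ψ.symm 1)).choose_spec.choose_spec.choose

theorem sum_pq : ∑ j, C.pq (C.p' j) (C.q' j) = 1 := by
  have h := (BalTensor.exists_rep (C.φ.symm 1)).choose_spec.choose_spec.choose_spec
  rw [LinearEquiv.symm_apply_eq, map_sum] at h
  exact h.symm

theorem sum_qp : ∑ i, C.qp (C.q i) (C.p i) = 1 := by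
  have h := (BalTensor.exists_rep (C.ψ.symm 1)).choose_spec.choose_spec.choose_spec
  rw [LinearEquiv.symm_apply_eq, map_sum] at h
  exact h.symm

/-! ### The ring `Ũ = Pᵉ ⊗_{Rᵉ} U ⊗_{Rᵉ} Qᵉ`

The bimodules `Pᵉ = P ⊗ Qᵒ` and `Qᵉ = Q ⊗ Pᵒ` have `P ⊗[k] Q` and `Q ⊗[k] P` as underlying
`k`-modules.  Since `Rᵉ` is spanned by the elements `r ⊗ r'ᵒ`, it suffices to balance over these. -/

/-- The right action of `Rᵉ` on `Pᵉ`: `(a ⊗ bᵒ)(r ⊗ r'ᵒ) = ar ⊗ (r'b)ᵒ`. -/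
def rPe (_ : MoritaContext k R S P Q) (i : R × R) : Module.End k (P ⊗[k] Q) :=
  TensorProduct.map (Algebra.lsmul k k P (op i.1)) (Algebra.lsmul k k Q i.2)

/-- The left action of `Rᵉ` on `Qᵉ`: `(r ⊗ r'ᵒ)(c ⊗ dᵒ) = rc ⊗ (dr')ᵒ`. -/
def lQe (_ : MoritaContext k R S P Q) (i : R × R) : Module.End k (Q ⊗[k] P) :=
  TensorProduct.map (Algebra.lsmul k k Q i.1) (Algebra.lsmul k k P (op i.2))

@[simp] theorem rPe_tmul (r r' : R) (a : P) (b : Q) :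
    C.rPe (r, r') (a ⊗ₜ b) = (op r • a) ⊗ₜ (r' • b) := rfl

@[simp] theorem lQe_tmul (r r' : R) (c : Q) (d : P) :
    C.lQe (r, r') (c ⊗ₜ d) = (r • c) ⊗ₜ (op r' • d) := rfl

end MoritaContext

namespace EnvRing

variable {k R U : Type*} [CommRing k] [Ring R] [Algebra k R] [Ring U] [Algebra k U]
  (E : EnvRing k R U)

/-- `η(r ⊗ r'ᵒ) = s(r) t(r')`. -/
def eta (i : R × R) : U := E.s i.1 * E.t (op i.2)

/-- The left action of `Rᵉ` on `U`. -/
def lEnv (i : R × R) : Module.End k U := LinearMap.mulLeft k (E.eta i)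

/-- The right action of `Rᵉ` on `U`. -/
def rEnv (i : R × R) : Module.End k U := LinearMap.mulRight k (E.eta i)

@[simp] theorem lEnv_apply (i : R × R) (u : U) : E.lEnv i u = E.eta i * u := rfl
@[simp] theorem rEnv_apply (i : R × R) (u : U) : E.rEnv i u = u * E.eta i := rfl

theorem eta_mul (r r' x x' : R) : E.eta (r, r') * E.eta (x, x') = E.eta (r * x, x' * r') := by
  simp only [eta, map_mul, op_mul, mul_assoc]
  rw [← mul_assoc (E.t _) (E.s _), ← E.comm]
  simp only [mul_assoc]

end EnvRing

namespace MoritaContext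

variable {k R S P Q U M : Type*} [CommRing k] [Ring R] [Algebra k R] [Ring S]
  [Algebra k S] [AddCommGroup P] [Module k P] [Module S P] [Module Rᵐᵒᵖ P] [SMulCommClass S Rᵐᵒᵖ P]
  [IsScalarTower k S P] [IsScalarTower k Rᵐᵒᵖ P] [AddCommGroup Q] [Module k Q] [Module R Q]
  [Module Sᵐᵒᵖ Q] [SMulCommClass R Sᵐᵒᵖ Q] [IsScalarTower k R Q] [IsScalarTower k Sᵐᵒᵖ Q]
  [Ring U] [Algebra k U] [AddCommGroup M] [Module k M]
  (C : MoritaContext k R S P Q) (E : EnvRing k R U)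

/-- The `k`-module `Ũ = Pᵉ ⊗_{Rᵉ} U ⊗_{Rᵉ} Qᵉ`. -/
def Tilde : Type _ := TriTensor C.rPe E.lEnv E.rEnv C.lQe

instance : AddCommGroup (C.Tilde E) :=
  inferInstanceAs (AddCommGroup (TriTensor C.rPe E.lEnv E.rEnv C.lQe))

instance : Module k (C.Tilde E) := inferInstanceAs (Module k (TriTensor C.rPe E.lEnv E.rEnv C.lQe))

/-- The element `α ⊗ u ⊗ γ` of `Ũ`; in the text below mostly `(a ⊗ bᵒ) ⊗ u ⊗ (c ⊗ dᵒ)`. -/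
def tl : P ⊗[k] Q →ₗ[k] U →ₗ[k] Q ⊗[k] P →ₗ[k] C.Tilde E :=
  TriTensor.mk C.rPe E.lEnv E.rEnv C.lQe

theorem tl_left (r r' : R) (α : P ⊗[k] Q) (u : U) (γ : Q ⊗[k] P) :
    C.tl E (C.rPe (r, r') α) u γ = C.tl E α (E.eta (r, r') * u) γ :=
  TriTensor.mk_left C.rPe E.lEnv E.rEnv C.lQe (r, r') α u γ

theorem tl_right (r r' : R) (α : P ⊗[k] Q) (u : U) (γ : Q ⊗[k] P) :
    C.tl E α (u * E.eta (r, r')) γ = C.tl E α u (C.lQe (r, r') γ) :=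
  TriTensor.mk_right C.rPe E.lEnv E.rEnv C.lQe (r, r') α u γ

theorem tilde_induction {motive : C.Tilde E → Prop}
    (tl : ∀ a b u c d, motive (C.tl E (a ⊗ₜ b) u (c ⊗ₜ d))) (zero : motive 0)
    (add : ∀ x y, motive x → motive y → motive (x + y)) (x : C.Tilde E) : motive x := by
  induction x using TriTensor.induction with
  | mk α u γ =>
    change motive (C.tl E α u γ)
    induction α with
    | zero => simpa using zero
    | add a b ha hb => simpa using add _ _ ha hb
    | tmul a b =>
      induction γ with
      | zero => simpa using zero
      | add c d hc hd => simpa using add _ _ hc hd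
      | tmul c d => exact tl a b u c d
  | zero => exact zero
  | add x y hx hy => exact add x y hx hy

/-- The map `(c ⊗ dᵒ, a ⊗ bᵒ) ↦ η(ca ⊗ (bd)ᵒ) = s(ca) t(bd)`. -/
def pairU : Q ⊗[k] P →ₗ[k] P ⊗[k] Q →ₗ[k] U :=
  TensorProduct.lift (LinearMap.mk₂ k (fun c d => TensorProduct.lift
      ((LinearMap.mul k U).compl₁₂ (E.s.toLinearMap ∘ₗ C.qp c)
        (E.t.toLinearMap ∘ₗ (opLinearEquiv k).toLinearMap ∘ₗ C.qp.flip d)))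
    (by intros; ext; simp)
    (by intros; ext; simp)
    (by intros; ext; simp [mul_add])
    (by intros; ext; simp))

@[simp] theorem pairU_tmul (c : Q) (d : P) (a : P) (b : Q) :
    C.pairU E (c ⊗ₜ d) (a ⊗ₜ b) = E.eta (C.qp c a, C.qp b d) := by
  simp [pairU, EnvRing.eta]

theorem pairU_left (i : R × R) (γ : Q ⊗[k] P) (α : P ⊗[k] Q) :
    C.pairU E (C.lQe i γ) α = E.eta i * C.pairU E γ α := by
  induction γ with
  | zero => simp
  | add c d hc hd => simp [hc, hd, mul_add]
  | tmul c d =>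
    induction α with
    | zero => simp
    | add a b ha hb => simp [ha, hb, mul_add]
    | tmul a b => obtain ⟨r, r'⟩ := i; simp [E.eta_mul, C.qp_left, C.qp_right]

theorem pairU_right (i : R × R) (γ : Q ⊗[k] P) (α : P ⊗[k] Q) :
    C.pairU E γ (C.rPe i α) = C.pairU E γ α * E.eta i := by
  induction γ with
  | zero => simp
  | add c d hc hd => simp [hc, hd, add_mul]
  | tmul c d =>
    induction α with
    | zero => simp
    | add a b ha hb => simp [ha, hb, add_mul]
    | tmul a b => obtain ⟨r, r'⟩ := i; simp [E.eta_mul, C.qp_left, C.qp_right]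

/-- Left multiplication by `α ⊗ u ⊗ γ`. -/
def tildeMulAux (α : P ⊗[k] Q) (u : U) (γ : Q ⊗[k] P) : C.Tilde E →ₗ[k] C.Tilde E :=
  TriTensor.lift (LinearMap.mk₂ k (fun β v => C.tl E α (u * C.pairU E γ β * v))
    (by intros; simp [mul_add, add_mul])
    (by intros; simp)
    (by intros; simp [mul_add])
    (by intros; simp))
    (by intros; simp [pairU_right, mul_assoc])
    (by rintro ⟨r, r'⟩ β v δ; simpa [mul_assoc] using C.tl_right E r r' α (u * C.pairU E γ β * v) δ)

theorem tildeMulAux_tl (α β : P ⊗[k] Q) (u v : U) (γ δ : Q ⊗[k] P) :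
    C.tildeMulAux E α u γ (C.tl E β v δ) = C.tl E α (u * C.pairU E γ β * v) δ :=
  TriTensor.lift_mk _ _ _ _ _ _

/-- The multiplication of `Ũ`:
`((a₁ ⊗ b₁ᵒ) ⊗ u ⊗ (c₁ ⊗ d₁ᵒ)) ((a₂ ⊗ b₂ᵒ) ⊗ v ⊗ (c₂ ⊗ d₂ᵒ))
  = (a₁ ⊗ b₁ᵒ) ⊗ u s(c₁a₂) t(b₂d₁) v ⊗ (c₂ ⊗ d₂ᵒ)`. -/
def tildeMul : C.Tilde E →ₗ[k] C.Tilde E →ₗ[k] C.Tilde E :=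
  TriTensor.lift (LinearMap.mk₂ k
    (fun α u => { toFun := C.tildeMulAux E α u
                  map_add' := fun γ δ => TriTensor.hom_ext fun β v ε => by
                    change C.tildeMulAux E _ _ _ (C.tl E _ _ _) =
                      C.tildeMulAux E _ _ _ (C.tl E _ _ _) + C.tildeMulAux E _ _ _ (C.tl E _ _ _)
                    simp [tildeMulAux_tl, mul_add, add_mul]
                  map_smul' := fun c γ => TriTensor.hom_ext fun β v ε => by
                    change C.tildeMulAux E _ _ _ (C.tl E _ _ _) =
                      c • C.tildeMulAux E _ _ _ (C.tl E _ _ _)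
                    simp [tildeMulAux_tl] })
    (fun α α' u => LinearMap.ext fun γ => TriTensor.hom_ext fun β v ε => by
      change C.tildeMulAux E _ _ _ (C.tl E _ _ _) =
        C.tildeMulAux E _ _ _ (C.tl E _ _ _) + C.tildeMulAux E _ _ _ (C.tl E _ _ _)
      simp [tildeMulAux_tl])
    (fun c α u => LinearMap.ext fun γ => TriTensor.hom_ext fun β v ε => by
      change C.tildeMulAux E _ _ _ (C.tl E _ _ _) = c • C.tildeMulAux E _ _ _ (C.tl E _ _ _)
      simp [tildeMulAux_tl])
    (fun α u u' => LinearMap.ext fun γ => TriTensor.hom_ext fun β v ε => by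
      change C.tildeMulAux E _ _ _ (C.tl E _ _ _) =
        C.tildeMulAux E _ _ _ (C.tl E _ _ _) + C.tildeMulAux E _ _ _ (C.tl E _ _ _)
      simp [tildeMulAux_tl, add_mul])
    (fun c α u => LinearMap.ext fun γ => TriTensor.hom_ext fun β v ε => by
      change C.tildeMulAux E _ _ _ (C.tl E _ _ _) = c • C.tildeMulAux E _ _ _ (C.tl E _ _ _)
      simp [tildeMulAux_tl]))
    (fun i α u γ => TriTensor.hom_ext fun β v ε => by
      change C.tildeMulAux E _ _ _ (C.tl E _ _ _) = C.tildeMulAux E _ _ _ (C.tl E _ _ _)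
      rw [tildeMulAux_tl, tildeMulAux_tl, C.tl_left, E.lEnv_apply]
      simp only [mul_assoc])
    (fun i α u γ => TriTensor.hom_ext fun β v ε => by
      change C.tildeMulAux E _ _ _ (C.tl E _ _ _) = C.tildeMulAux E _ _ _ (C.tl E _ _ _)
      rw [tildeMulAux_tl, tildeMulAux_tl, C.pairU_left, E.rEnv_apply]
      simp only [mul_assoc])

instance : Mul (C.Tilde E) := ⟨fun x y => C.tildeMul E x y⟩

theorem tl_mul_tl (α β : P ⊗[k] Q) (u v : U) (γ δ : Q ⊗[k] P) :
    C.tl E α u γ * C.tl E β v δ = C.tl E α (u * C.pairU E γ β * v) δ :=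
  (LinearMap.congr_fun (TriTensor.lift_mk _ _ _ α u γ) (C.tl E β v δ)).trans
    (C.tildeMulAux_tl E α β u v γ δ)

/-- The identity element `∑ᵢⱼ (p'ⱼ ⊗ q'ᵢᵒ) ⊗ 1 ⊗ (q'ⱼ ⊗ p'ᵢᵒ)`. -/
instance : One (C.Tilde E) :=
  ⟨∑ i, ∑ j, C.tl E (C.p' j ⊗ₜ C.q' i) 1 (C.q' j ⊗ₜ C.p' i)⟩

theorem tilde_one_def :
    (1 : C.Tilde E) = ∑ i, ∑ j, C.tl E (C.p' j ⊗ₜ C.q' i) 1 (C.q' j ⊗ₜ C.p' i) := rfl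

protected theorem tilde_mul_add (x y z : C.Tilde E) : x * (y + z) = x * y + x * z :=
  map_add (C.tildeMul E x) y z

protected theorem tilde_add_mul (x y z : C.Tilde E) : (x + y) * z = x * z + y * z :=
  LinearMap.map_add₂ (C.tildeMul E) x y z

protected theorem tilde_mul_zero (x : C.Tilde E) : x * 0 = 0 := map_zero (C.tildeMul E x)

protected theorem tilde_zero_mul (x : C.Tilde E) : 0 * x = 0 := LinearMap.map_zero₂ (C.tildeMul E) x

instance : NonUnitalNonAssocRing (C.Tilde E) where
  left_distrib := C.tilde_mul_add E
  right_distrib := C.tilde_add_mul E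
  zero_mul := C.tilde_zero_mul E
  mul_zero := C.tilde_mul_zero E

/-- `∑ⱼ p'ⱼ (q'ⱼ a) = a`. -/
theorem sum_p'_qp (a : P) : ∑ j, op (C.qp (C.q' j) a) • C.p' j = a := by
  simp_rw [← C.pq_smul, ← Finset.sum_smul, C.sum_pq, one_smul]

/-- `∑ᵢ (b p'ᵢ) q'ᵢ = b`. -/
theorem sum_qp_q' (b : Q) : ∑ i, C.qp b (C.p' i) • C.q' i = b := by
  simp_rw [C.qp_smul, ← Finset.sum_smul, ← Finset.op_sum, C.sum_pq, op_one, one_smul]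

theorem sum_tl_left (x y : S) (a : P) (b : Q) (u : U) (γ : Q ⊗[k] P) :
    ∑ i, ∑ j, C.tl E ((x • C.p' j) ⊗ₜ C.q' i) (E.eta (C.qp (C.q' j) a, C.qp b (y • C.p' i)) * u) γ =
      C.tl E ((x • a) ⊗ₜ (op y • b)) u γ := by
  have ha : x • a = ∑ j, op (C.qp (C.q' j) a) • x • C.p' j := by
    conv_lhs => rw [← C.sum_p'_qp a, Finset.smul_sum]
    exact Finset.sum_congr rfl fun j _ => smul_comm x _ _
  rw [ha, ← C.sum_qp_q' (op y • b)]
  simp only [← C.tl_left, rPe_tmul, C.qp_bal, TensorProduct.sum_tmul, TensorProduct.tmul_sum, map_sum,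
    LinearMap.sum_apply]
end MoritaContext

namespace MoritaContext

variable {k R S P Q U M : Type*} [CommRing k] [Ring R] [Algebra k R] [Ring S]
  [Algebra k S] [AddCommGroup P] [Module k P] [Module S P] [Module Rᵐᵒᵖ P] [SMulCommClass S Rᵐᵒᵖ P]
  [IsScalarTower k S P] [IsScalarTower k Rᵐᵒᵖ P] [AddCommGroup Q] [Module k Q] [Module R Q]
  [Module Sᵐᵒᵖ Q] [SMulCommClass R Sᵐᵒᵖ Q] [IsScalarTower k R Q] [IsScalarTower k Sᵐᵒᵖ Q]
  [Ring U] [Algebra k U] [AddCommGroup M] [Module k M]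
  (C : MoritaContext k R S P Q) (E : EnvRing k R U)

/-- `η̃(x ⊗ yᵒ) = ∑ᵢⱼ (x p'ⱼ ⊗ q'ᵢᵒ) ⊗ 1 ⊗ (q'ⱼ ⊗ (y p'ᵢ)ᵒ)`. -/
def tildeEta (x y : S) : C.Tilde E :=
  ∑ i, ∑ j, C.tl E ((x • C.p' j) ⊗ₜ C.q' i) 1 (C.q' j ⊗ₜ (y • C.p' i))

theorem tildeEta_one : C.tildeEta E 1 1 = 1 := by
  simp [tildeEta, tilde_one_def]

theorem tildeEta_mul_tl (x y : S) (a : P) (b : Q) (u : U) (γ : Q ⊗[k] P) :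
    C.tildeEta E x y * C.tl E (a ⊗ₜ b) u γ = C.tl E ((x • a) ⊗ₜ (op y • b)) u γ := by
  simp only [tildeEta, Finset.sum_mul, tl_mul_tl, one_mul, pairU_tmul]
  exact C.sum_tl_left E x y a b u γ

protected theorem tilde_one_mul (x : C.Tilde E) : 1 * x = x := by
  induction x using C.tilde_induction E with
  | tl a b u c d => rw [← tildeEta_one, tildeEta_mul_tl]; simp
  | zero => simp
  | add x y hx hy => rw [mul_add, hx, hy]

/-- `∑ⱼ (c p'ⱼ) q'ⱼ = c` and `∑ᵢ p'ᵢ (q'ᵢ d) = d`, inside `Ũ`. -/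
protected theorem tilde_mul_one (x : C.Tilde E) : x * 1 = x := by
  induction x using C.tilde_induction E with
  | tl a b u c d =>
    simp only [tilde_one_def, Finset.mul_sum, tl_mul_tl, mul_one, pairU_tmul, tl_right, lQe_tmul,
      ← map_sum, ← TensorProduct.tmul_sum, ← TensorProduct.sum_tmul, C.sum_qp_q', C.sum_p'_qp]
  | zero => simp
  | add x y hx hy => rw [add_mul, hx, hy]

protected theorem tilde_mul_assoc (x y z : C.Tilde E) : x * y * z = x * (y * z) := by
  induction x using C.tilde_induction E with
  | zero => simp
  | add x x' hx hy => simp only [add_mul, hx, hy]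
  | tl a b u c d =>
    induction y using C.tilde_induction E with
    | zero => simp
    | add x y hx hy => simp only [add_mul, mul_add, hx, hy]
    | tl a' b' u' c' d' =>
      induction z using C.tilde_induction E with
      | zero => simp
      | add x y hx hy => simp only [mul_add, hx, hy]
      | tl a'' b'' u'' c'' d'' => simp only [tl_mul_tl, mul_assoc]

instance : Ring (C.Tilde E) where
  mul_assoc := C.tilde_mul_assoc E
  one_mul := C.tilde_one_mul E
  mul_one := C.tilde_mul_one E
  __ := (inferInstance : NonUnitalNonAssocRing (C.Tilde E))

instance : Algebra k (C.Tilde E) :=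
  Algebra.ofModule (fun c x y => LinearMap.map_smul₂ (C.tildeMul E) c x y)
    (fun c x y => map_smul (C.tildeMul E x) c y)

/-- `η̃(x ⊗ yᵒ)` is bilinear in `x` and `y`. -/
def tildeEtaₗ : S →ₗ[k] S →ₗ[k] C.Tilde E :=
  LinearMap.mk₂ k (C.tildeEta E)
    (by intros; simp [tildeEta, add_smul, TensorProduct.add_tmul, Finset.sum_add_distrib])
    (by intros; simp [tildeEta, smul_assoc, Finset.smul_sum, ← TensorProduct.smul_tmul'])
    (by intros; simp [tildeEta, add_smul, TensorProduct.tmul_add, Finset.sum_add_distrib])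
    (by intros; simp [tildeEta, smul_assoc, Finset.smul_sum])

theorem tildeEta_mul (x y x' y' : S) :
    C.tildeEta E x y * C.tildeEta E x' y' = C.tildeEta E (x * x') (y' * y) := by
  have h : ∀ z, C.tildeEta E x y * (C.tildeEta E x' y' * z) = C.tildeEta E (x * x') (y' * y) * z := by
    intro z
    induction z using C.tilde_induction E with
    | tl a b u c d => simp only [tildeEta_mul_tl, mul_smul, op_mul]
    | zero => simp
    | add x y hx hy => simp only [mul_add, hx, hy]
  simpa using h 1

/-- The `Sᵉ`-ring structure of `Ũ`: `s̃(x) = η̃(x ⊗ 1)` and `t̃(y) = η̃(1 ⊗ yᵒ)`. -/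
def tildeEnv : EnvRing k S (C.Tilde E) where
  s := AlgHom.ofLinearMap ((C.tildeEtaₗ E).flip 1) (C.tildeEta_one E)
    (fun x y => by
      change C.tildeEta E _ _ = C.tildeEta E _ _ * C.tildeEta E _ _
      rw [tildeEta_mul, one_mul])
  t := AlgHom.ofLinearMap (C.tildeEtaₗ E 1 ∘ₗ (opLinearEquiv k).symm.toLinearMap) (C.tildeEta_one E)
    (fun x y => by
      change C.tildeEta E _ _ = C.tildeEta E _ _ * C.tildeEta E _ _
      rw [tildeEta_mul, one_mul]; rfl)
  comm := fun a b => by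
    change C.tildeEta E _ _ * C.tildeEta E _ _ = C.tildeEta E _ _ * C.tildeEta E _ _
    simp [tildeEta_mul]

theorem tildeEnv_s (x : S) : (C.tildeEnv E).s x = C.tildeEta E x 1 := rfl
theorem tildeEnv_t (y : S) : (C.tildeEnv E).t (op y) = C.tildeEta E 1 y := rfl

theorem s_mul_tl (x : S) (a : P) (b : Q) (u : U) (γ : Q ⊗[k] P) :
    (C.tildeEnv E).s x * C.tl E (a ⊗ₜ b) u γ = C.tl E ((x • a) ⊗ₜ b) u γ := by
  rw [tildeEnv_s, tildeEta_mul_tl, op_one, one_smul]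

theorem t_mul_tl (y : S) (a : P) (b : Q) (u : U) (γ : Q ⊗[k] P) :
    (C.tildeEnv E).t (op y) * C.tl E (a ⊗ₜ b) u γ = C.tl E (a ⊗ₜ (op y • b)) u γ := by
  rw [tildeEnv_t, tildeEta_mul_tl, one_smul]

/-! ### The coring structure of `Ũ` -/

/-- `a ⊗ b ↦ ∑ᵢ (a ⊗ qᵢ) ⊗ (pᵢ ⊗ b)`. -/
def splitP : P ⊗[k] Q →ₗ[k] (P ⊗[k] Q) ⊗[k] (P ⊗[k] Q) :=
  ∑ i, TensorProduct.map ((TensorProduct.mk k P Q).flip (C.q i)) (TensorProduct.mk k P Q (C.p i))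

/-- `c ⊗ d ↦ ∑ⱼ (c ⊗ p'ⱼ) ⊗ (q'ⱼ ⊗ d)`. -/
def splitQ : Q ⊗[k] P →ₗ[k] (Q ⊗[k] P) ⊗[k] (Q ⊗[k] P) :=
  ∑ j, TensorProduct.map ((TensorProduct.mk k Q P).flip (C.p' j)) (TensorProduct.mk k Q P (C.q' j))

theorem splitP_tmul (a : P) (b : Q) :
    C.splitP (a ⊗ₜ[k] b) = ∑ i, (a ⊗ₜ[k] C.q i) ⊗ₜ[k] (C.p i ⊗ₜ[k] b) := by
  simp [splitP]

theorem splitQ_tmul (c : Q) (d : P) :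
    C.splitQ (c ⊗ₜ[k] d) = ∑ j, (c ⊗ₜ[k] C.p' j) ⊗ₜ[k] (C.q' j ⊗ₜ[k] d) := by
  simp [splitQ]

/-- `(α₁ ⊗ α₂) ⊗ ((u ⊗ v) ⊗ (γ₁ ⊗ γ₂)) ↦ (α₁ ⊗ u ⊗ γ₁) ⊗_S (α₂ ⊗ v ⊗ γ₂)`. -/
def comb : ((P ⊗[k] Q) ⊗[k] (P ⊗[k] Q)) ⊗[k] ((U ⊗[k] U) ⊗[k] ((Q ⊗[k] P) ⊗[k] (Q ⊗[k] P))) →ₗ[k]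
    (C.tildeEnv E).Tens₂ :=
  BalTensor.proj (C.tildeEnv E).lT (C.tildeEnv E).lS ∘ₗ
    TensorProduct.map (TriTensor.proj C.rPe E.lEnv E.rEnv C.lQe)
      (TriTensor.proj C.rPe E.lEnv E.rEnv C.lQe) ∘ₗ
    (TensorProduct.tensorTensorTensorComm k _ _ _ _).toLinearMap ∘ₗ
    LinearMap.lTensor _ (TensorProduct.tensorTensorTensorComm k U U (Q ⊗[k] P) (Q ⊗[k] P)).toLinearMap

theorem comb_tmul (α₁ α₂ : P ⊗[k] Q) (u v : U) (γ₁ γ₂ : Q ⊗[k] P) :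
    C.comb E ((α₁ ⊗ₜ α₂) ⊗ₜ ((u ⊗ₜ v) ⊗ₜ (γ₁ ⊗ₜ γ₂))) =
      (C.tildeEnv E).tmul₂ (C.tl E α₁ u γ₁) (C.tl E α₂ v γ₂) := rfl

end MoritaContext

namespace LeftBialgebroidData.IsLeftBialgebroid

variable {k R U M : Type*} [CommRing k] [Ring R] [Algebra k R] [Ring U] [Algebra k U]
  [AddCommGroup M] [Module k M] {H : LeftBialgebroidData k R U}

theorem comul_mul_eta (hH : H.IsLeftBialgebroid) (u : U) (r r' : R) :
    H.comul (u * H.eta (r, r')) = H.rmul (H.s r) (H.t (op r')) (H.comul u) := by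
  have := hH.comul_mul u (H.eta (r, r')) 1 (fun _ => H.s r) (fun _ => H.t (op r'))
    (by simpa [EnvRing.eta] using hH.comul_st r r')
  simpa using this

theorem comul_eta_mul (hH : H.IsLeftBialgebroid) (r r' : R) (u : U) (n : ℕ) (x y : Fin n → U)
    (h : H.comul u = ∑ i, H.tmul₂ (x i) (y i)) :
    H.comul (H.eta (r, r') * u) = ∑ i, H.tmul₂ (H.s r * x i) (H.t (op r') * y i) := by
  rw [hH.comul_mul _ u n x y h]
  refine Finset.sum_congr rfl fun i _ => ?_
  rw [EnvRing.eta, hH.comul_st, EnvRing.rmul_tmul]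

theorem counit_eta_mul (hH : H.IsLeftBialgebroid) (r r' : R) (u : U) :
    H.counit (H.eta (r, r') * u) = r * H.counit u * r' := by
  have h := hH.counit_mul (H.eta (r, r')) u 1
  rw [map_one, mul_one, mul_one] at h
  rw [h, EnvRing.eta, hH.counit_st]

theorem counit_mul_t (hH : H.IsLeftBialgebroid) (u : U) (r : R) : H.counit (u * H.t (op r)) = H.counit (u * H.s r) := by
  have h := hH.counit_mul u (H.t (op r)) 1
  have h' := hH.counit_st 1 r 1
  simp only [map_one, mul_one, one_mul] at h h'
  rw [h, h']

end LeftBialgebroidData.IsLeftBialgebroid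

namespace MoritaContext

variable {k R S P Q U M : Type*} [CommRing k] [Ring R] [Algebra k R] [Ring S]
  [Algebra k S] [AddCommGroup P] [Module k P] [Module S P] [Module Rᵐᵒᵖ P] [SMulCommClass S Rᵐᵒᵖ P]
  [IsScalarTower k S P] [IsScalarTower k Rᵐᵒᵖ P] [AddCommGroup Q] [Module k Q] [Module R Q]
  [Module Sᵐᵒᵖ Q] [SMulCommClass R Sᵐᵒᵖ Q] [IsScalarTower k R Q] [IsScalarTower k Sᵐᵒᵖ Q]
  [Ring U] [Algebra k U] [AddCommGroup M] [Module k M]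
  (C : MoritaContext k R S P Q) (E : EnvRing k R U)

/-- `∑ᵢ r qᵢ ⊗_S pᵢ = ∑ᵢ qᵢ ⊗_S pᵢ r`. -/
theorem sum_q_p_comm {Y : Type*} [AddCommGroup Y] [Module k Y] (F : Q →ₗ[k] P →ₗ[k] Y)
    (hF : ∀ (x : S) q p, F (op x • q) p = F q (x • p)) (r : R) :
    ∑ i, F (r • C.q i) (C.p i) = ∑ i, F (C.q i) (op r • C.p i) := by
  have key : ∀ q p, F q p = BalTensor.lift (ρ := fun x : S => Algebra.lsmul k k Q (op x))
      (l := fun x : S => Algebra.lsmul k k P x) F hF (C.ψ.symm (C.qp q p)) := by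
    intro q p
    rw [show C.qp q p = C.ψ (BalTensor.mk _ _ q p) from rfl, LinearEquiv.symm_apply_apply]
    exact (BalTensor.lift_mk F hF q p).symm
  simp_rw [key, ← map_sum, C.qp_left, C.qp_right, ← Finset.mul_sum, ← Finset.sum_mul, C.sum_qp,
    mul_one, one_mul]

/-- `(u, v) ↦ ∑ᵢⱼ ((a ⊗ qᵢᵒ) ⊗ u ⊗ (c ⊗ p'ⱼᵒ)) ⊗_S ((pᵢ ⊗ bᵒ) ⊗ v ⊗ (q'ⱼ ⊗ dᵒ))`
for `α = a ⊗ b` and `γ = c ⊗ d`. -/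
def tildeComulBil (α : P ⊗[k] Q) (γ : Q ⊗[k] P) : U →ₗ[k] U →ₗ[k] (C.tildeEnv E).Tens₂ :=
  (TensorProduct.mk k U U).compr₂ (C.comb E ∘ₗ TensorProduct.mk k _ _ (C.splitP α) ∘ₗ
    (TensorProduct.mk k (U ⊗[k] U) _).flip (C.splitQ γ))

theorem tildeComulBil_apply (α : P ⊗[k] Q) (γ : Q ⊗[k] P) (u v : U) :
    C.tildeComulBil E α γ u v = C.comb E (C.splitP α ⊗ₜ ((u ⊗ₜ v) ⊗ₜ C.splitQ γ)) := rfl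

theorem tildeComulBil_tmul (a : P) (b : Q) (c : Q) (d : P) (u v : U) :
    C.tildeComulBil E (a ⊗ₜ b) (c ⊗ₜ d) u v = ∑ i, ∑ j, (C.tildeEnv E).tmul₂
      (C.tl E (a ⊗ₜ C.q i) u (c ⊗ₜ C.p' j)) (C.tl E (C.p i ⊗ₜ b) v (C.q' j ⊗ₜ d)) := by
  simp only [tildeComulBil_apply, splitP_tmul, splitQ_tmul, TensorProduct.sum_tmul,
    TensorProduct.tmul_sum, map_sum, comb_tmul]
  exact Finset.sum_comm

theorem tl_s (r : R) (a : P) (b : Q) (u : U) (γ : Q ⊗[k] P) :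
    C.tl E (a ⊗ₜ b) (E.s r * u) γ = C.tl E ((op r • a) ⊗ₜ b) u γ := by
  simpa [EnvRing.eta] using (C.tl_left E r 1 (a ⊗ₜ b) u γ).symm

theorem tl_t (r : R) (a : P) (b : Q) (u : U) (γ : Q ⊗[k] P) :
    C.tl E (a ⊗ₜ b) (E.t (op r) * u) γ = C.tl E (a ⊗ₜ (r • b)) u γ := by
  simpa [EnvRing.eta] using (C.tl_left E 1 r (a ⊗ₜ b) u γ).symm

theorem tl_mul_s (r : R) (α : P ⊗[k] Q) (u : U) (c : Q) (d : P) :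
    C.tl E α (u * E.s r) (c ⊗ₜ d) = C.tl E α u ((r • c) ⊗ₜ d) := by
  simpa [EnvRing.eta] using C.tl_right E r 1 α u (c ⊗ₜ d)

theorem tl_mul_t (r : R) (α : P ⊗[k] Q) (u : U) (c : Q) (d : P) :
    C.tl E α (u * E.t (op r)) (c ⊗ₜ d) = C.tl E α u (c ⊗ₜ (op r • d)) := by
  simpa [EnvRing.eta] using C.tl_right E 1 r α u (c ⊗ₜ d)

/-- For fixed `u, v, b, γ, γ'` the expression `((a ⊗ qᵒ) ⊗ u ⊗ γ) ⊗_S ((p ⊗ bᵒ) ⊗ v ⊗ γ')`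
as a bilinear map in `q` and `p`, with an arbitrary linear map `f` in place of the second factor. -/
def legs {Y : Type*} [AddCommGroup Y] [Module k Y] {l : S → Module.End k Y} (a : P) (u : U)
    (γ : Q ⊗[k] P) (f : P →ₗ[k] Y) : Q →ₗ[k] P →ₗ[k] (C.tildeEnv E).Tens l :=
  (BalTensor.mk (C.tildeEnv E).lT l).compl₁₂
    (((C.tl E).flip u).flip γ ∘ₗ TensorProduct.mk k P Q a) f

theorem legs_apply {Y : Type*} [AddCommGroup Y] [Module k Y] {l : S → Module.End k Y} (a : P) (u : U)
    (γ : Q ⊗[k] P) (f : P →ₗ[k] Y) (q : Q) (p : P) :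
    C.legs E (l := l) a u γ f q p = (C.tildeEnv E).tmul l (C.tl E (a ⊗ₜ q) u γ) (f p) := rfl

theorem sum_legs {Y : Type*} [AddCommGroup Y] [Module k Y] {l : S → Module.End k Y} (a : P) (u : U)
    (γ : Q ⊗[k] P) (f : P →ₗ[k] Y) (hf : ∀ x p, f (x • p) = l x (f p)) (r : R) :
    ∑ i, (C.tildeEnv E).tmul l (C.tl E (a ⊗ₜ C.q i) (E.t (op r) * u) γ) (f (C.p i)) =
      ∑ i, (C.tildeEnv E).tmul l (C.tl E (a ⊗ₜ C.q i) u γ) (f (op r • C.p i)) := by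
  simp_rw [tl_t]
  refine C.sum_q_p_comm (C.legs E (l := l) a u γ f) (fun x q p => ?_) r
  rw [legs_apply, legs_apply, hf, ← t_mul_tl]
  exact BalTensor.mk_bal _ _ x _ _

theorem tildeComulBil_bal (α : P ⊗[k] Q) (γ : Q ⊗[k] P) (r : R) (u v : U) :
    C.tildeComulBil E α γ (E.lT r u) v = C.tildeComulBil E α γ u (E.lS r v) := by
  simp only [tildeComulBil_apply]
  induction α with
  | zero => simp
  | add a b ha hb => simp only [map_add, TensorProduct.add_tmul, ha, hb]
  | tmul a b =>
    generalize C.splitQ γ = g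
    induction g with
    | zero => simp
    | add a b ha hb => simp only [map_add, TensorProduct.tmul_add, ha, hb]
    | tmul γ₁ γ₂ =>
      simp only [splitP_tmul, TensorProduct.sum_tmul, map_sum, comb_tmul, E.lT_apply, E.lS_apply, tl_s]
      exact C.sum_legs E (l := (C.tildeEnv E).lS) a u γ₁
        (((C.tl E).flip v).flip γ₂ ∘ₗ (TensorProduct.mk k P Q).flip b)
        (fun x p => (C.s_mul_tl E x p b v γ₂).symm) r

/-- The map on `U_◃ ⊗_R ▹U` induced by `tildeComulBil`. -/
def tildeComulAux (α : P ⊗[k] Q) (γ : Q ⊗[k] P) : E.Tens₂ →ₗ[k] (C.tildeEnv E).Tens₂ :=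
  BalTensor.lift (C.tildeComulBil E α γ) (C.tildeComulBil_bal E α γ)

@[simp] theorem tildeComulAux_tmul (α : P ⊗[k] Q) (γ : Q ⊗[k] P) (u v : U) :
    C.tildeComulAux E α γ (E.tmul₂ u v) = C.tildeComulBil E α γ u v := BalTensor.lift_mk _ _ _ _

theorem tildeComulAux_add_right (α : P ⊗[k] Q) (γ γ' : Q ⊗[k] P) (x : E.Tens₂) :
    C.tildeComulAux E α (γ + γ') x = C.tildeComulAux E α γ x + C.tildeComulAux E α γ' x := by
  rw [← LinearMap.add_apply]
  refine LinearMap.congr_fun (BalTensor.hom_ext fun u v => ?_) x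
  rw [LinearMap.add_apply, tildeComulAux_tmul, tildeComulAux_tmul, tildeComulAux_tmul]
  simp only [tildeComulBil_apply, map_add, TensorProduct.tmul_add]

theorem tildeComulAux_smul_right (c : k) (α : P ⊗[k] Q) (γ : Q ⊗[k] P) (x : E.Tens₂) :
    C.tildeComulAux E α (c • γ) x = c • C.tildeComulAux E α γ x := by
  rw [← LinearMap.smul_apply]
  refine LinearMap.congr_fun (BalTensor.hom_ext fun u v => ?_) x
  rw [LinearMap.smul_apply, tildeComulAux_tmul, tildeComulAux_tmul]
  simp only [tildeComulBil_apply, map_smul, TensorProduct.tmul_smul]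

theorem tildeComulAux_add_left (α α' : P ⊗[k] Q) (γ : Q ⊗[k] P) (x : E.Tens₂) :
    C.tildeComulAux E (α + α') γ x = C.tildeComulAux E α γ x + C.tildeComulAux E α' γ x := by
  rw [← LinearMap.add_apply]
  refine LinearMap.congr_fun (BalTensor.hom_ext fun u v => ?_) x
  rw [LinearMap.add_apply, tildeComulAux_tmul, tildeComulAux_tmul, tildeComulAux_tmul]
  simp only [tildeComulBil_apply, map_add, TensorProduct.add_tmul]

theorem tildeComulAux_smul_left (c : k) (α : P ⊗[k] Q) (γ : Q ⊗[k] P) (x : E.Tens₂) :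
    C.tildeComulAux E (c • α) γ x = c • C.tildeComulAux E α γ x := by
  rw [← LinearMap.smul_apply]
  refine LinearMap.congr_fun (BalTensor.hom_ext fun u v => ?_) x
  rw [LinearMap.smul_apply, tildeComulAux_tmul, tildeComulAux_tmul]
  simp only [tildeComulBil_apply, map_smul, ← TensorProduct.smul_tmul']

theorem splitP_rPe (r r' : R) (α : P ⊗[k] Q) : C.splitP (C.rPe (r, r') α) =
    TensorProduct.map (C.rPe (r, 1)) (C.rPe (1, r')) (C.splitP α) := by
  induction α with
  | zero => simp
  | add a b ha hb => simp only [map_add, ha, hb]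
  | tmul a b => simp [splitP_tmul]

theorem splitQ_lQe (r r' : R) (γ : Q ⊗[k] P) : C.splitQ (C.lQe (r, r') γ) =
    TensorProduct.map (C.lQe (r, 1)) (C.lQe (1, r')) (C.splitQ γ) := by
  induction γ with
  | zero => simp
  | add a b ha hb => simp only [map_add, ha, hb]
  | tmul a b => simp [splitQ_tmul]

theorem tildeComulBil_left (r r' : R) (α : P ⊗[k] Q) (γ : Q ⊗[k] P) (u v : U) :
    C.tildeComulBil E (C.rPe (r, r') α) γ u v =
      C.tildeComulBil E α γ (E.s r * u) (E.t (op r') * v) := by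
  simp only [tildeComulBil_apply, splitP_rPe]
  generalize C.splitP α = f
  generalize C.splitQ γ = g
  induction f with
  | zero => simp
  | add a b ha hb => simp only [map_add, TensorProduct.add_tmul, ha, hb]
  | tmul α₁ α₂ =>
    induction g with
    | zero => simp
    | add a b ha hb => simp only [map_add, TensorProduct.tmul_add, ha, hb]
    | tmul γ₁ γ₂ => simp only [TensorProduct.map_tmul, comb_tmul, tl_left]; simp [EnvRing.eta]

theorem tildeComulBil_right (r r' : R) (α : P ⊗[k] Q) (γ : Q ⊗[k] P) (u v : U) :
    C.tildeComulBil E α (C.lQe (r, r') γ) u v =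
      C.tildeComulBil E α γ (u * E.s r) (v * E.t (op r')) := by
  simp only [tildeComulBil_apply, splitQ_lQe]
  generalize C.splitP α = f
  generalize C.splitQ γ = g
  induction f with
  | zero => simp
  | add a b ha hb => simp only [map_add, TensorProduct.add_tmul, ha, hb]
  | tmul α₁ α₂ =>
    induction g with
    | zero => simp
    | add a b ha hb => simp only [map_add, TensorProduct.tmul_add, ha, hb]
    | tmul γ₁ γ₂ => simp only [TensorProduct.map_tmul, comb_tmul, ← tl_right]; simp [EnvRing.eta]

/-- `a ⊗ b ↦ (r ↦ a r b)`. -/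
def sandwich : P ⊗[k] Q →ₗ[k] R →ₗ[k] S :=
  TensorProduct.lift (LinearMap.mk₂ k (fun a b => C.pq a ∘ₗ
      ((Algebra.lsmul k k Q).toLinearMap : R →ₗ[k] Module.End k Q).flip b)
    (by intros; ext; simp)
    (by intros; ext; simp)
    (by intros; ext; simp)
    (by intros; ext; simp))

@[simp] theorem sandwich_tmul (a : P) (b : Q) (r : R) :
    C.sandwich (a ⊗ₜ b) r = C.pq a (r • b) := rfl

/-- `c ⊗ d ↦ cd`. -/
def evQP : Q ⊗[k] P →ₗ[k] R := TensorProduct.lift C.qp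

@[simp] theorem evQP_tmul (c : Q) (d : P) : C.evQP (c ⊗ₜ d) = C.qp c d := rfl

theorem sandwich_rPe (r r' : R) (α : P ⊗[k] Q) (x : R) :
    C.sandwich (C.rPe (r, r') α) x = C.sandwich α (r * x * r') := by
  induction α with
  | zero => simp
  | add a b ha hb => simp only [map_add, LinearMap.add_apply, ha, hb]
  | tmul a b => simp [pq_bal, mul_smul]

theorem evQP_lQe (r r' : R) (γ : Q ⊗[k] P) : C.evQP (C.lQe (r, r') γ) = r * C.evQP γ * r' := by
  induction γ with
  | zero => simp
  | add a b ha hb => simp only [map_add, ha, hb, mul_add, add_mul]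
  | tmul a b => simp [qp_left, qp_right, mul_assoc]

variable {H : LeftBialgebroidData k R U} (hH : H.IsLeftBialgebroid)

/-- The coproduct of `Ũ`: on `(a ⊗ bᵒ) ⊗ u ⊗ (c ⊗ dᵒ)` it is
`∑ᵢⱼ ((a ⊗ qᵢᵒ) ⊗ u₍₁₎ ⊗ (c ⊗ p'ⱼᵒ)) ⊗_S ((pᵢ ⊗ bᵒ) ⊗ u₍₂₎ ⊗ (q'ⱼ ⊗ dᵒ))`. -/
def tildeComul : C.Tilde H.toEnvRing →ₗ[k] (C.tildeEnv H.toEnvRing).Tens₂ :=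
  TriTensor.lift (LinearMap.mk₂ k
    (fun α u => { toFun := fun γ => C.tildeComulAux H.toEnvRing α γ (H.comul u)
                  map_add' := fun γ γ' => C.tildeComulAux_add_right _ α γ γ' _
                  map_smul' := fun c γ => C.tildeComulAux_smul_right _ c α γ _ })
    (fun α α' u => LinearMap.ext fun γ => C.tildeComulAux_add_left _ α α' γ _)
    (fun c α u => LinearMap.ext fun γ => C.tildeComulAux_smul_left _ c α γ _)
    (fun α u u' => LinearMap.ext fun γ => by
      change C.tildeComulAux _ _ _ (H.comul (u + u')) = C.tildeComulAux _ _ _ (H.comul u) +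
        C.tildeComulAux _ _ _ (H.comul u')
      rw [map_add, map_add])
    (fun c α u => LinearMap.ext fun γ => by
      change C.tildeComulAux _ _ _ (H.comul (c • u)) = c • C.tildeComulAux _ _ _ (H.comul u)
      rw [map_smul, map_smul]))
    (fun ⟨r, r'⟩ α u γ => by
      obtain ⟨n, x, y, h⟩ := BalTensor.exists_rep (H.comul u)
      change C.tildeComulAux _ _ _ (H.comul u) = C.tildeComulAux _ _ _ (H.comul (H.eta (r, r') * u))
      rw [hH.comul_eta_mul r r' u n x y h, h]
      simp only [map_sum, tildeComulAux_tmul, tildeComulBil_left])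
    (fun ⟨r, r'⟩ α u γ => by
      obtain ⟨n, x, y, h⟩ := BalTensor.exists_rep (H.comul u)
      change C.tildeComulAux _ _ _ (H.comul (u * H.eta (r, r'))) = C.tildeComulAux _ _ _ (H.comul u)
      rw [hH.comul_mul_eta, h]
      simp only [map_sum, tildeComulAux_tmul, EnvRing.rmul_tmul, tildeComulBil_right])

/-- The counit of `Ũ`: on `(a ⊗ bᵒ) ⊗ u ⊗ (c ⊗ dᵒ)` it is `a ε(u ◂ (cd)) b`. -/
def tildeCounit : C.Tilde H.toEnvRing →ₗ[k] S :=
  TriTensor.lift (LinearMap.mk₂ k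
    (fun α u => C.sandwich α ∘ₗ H.counit ∘ₗ LinearMap.mulLeft k u ∘ₗ H.s.toLinearMap ∘ₗ C.evQP)
    (by intros; ext; simp)
    (by intros; ext; simp)
    (by intros; ext; simp [add_mul])
    (by intros; ext; simp))
    (fun ⟨r, r'⟩ α u γ => by
      simp [sandwich_rPe, mul_assoc, hH.counit_eta_mul])
    (fun ⟨r, r'⟩ α u γ => by
      have : u * H.eta (r, r') * H.s (C.evQP γ) = u * H.s (r * C.evQP γ) * H.t (op r') := by
        rw [EnvRing.eta, map_mul]
        simp only [mul_assoc, ← H.comm]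
      simp only [LinearMap.mk₂_apply, LinearMap.comp_apply, LinearMap.mulLeft_apply, H.rEnv_apply,
        AlgHom.toLinearMap_apply, evQP_lQe, this, hH.counit_mul_t]
      simp [mul_assoc])

/-- The structure maps of the Morita base change `(S, Ũ)` of `(R, U)`. -/
def tilde : LeftBialgebroidData k S (C.Tilde H.toEnvRing) where
  toEnvRing := C.tildeEnv H.toEnvRing
  comul := C.tildeComul hH
  counit := C.tildeCounit hH

end MoritaContext

namespace EnvRing

variable {k R U M : Type*} [CommRing k] [Ring R] [Algebra k R] [Ring U] [Algebra k U]
  [AddCommGroup M] [Module k M] (E : EnvRing k R U)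

/-- The right `R`-action `(u ⊗ m) ◂ r = u s(r) ⊗ m` on `U_◃ ⊗_R M`. -/
def rTens (l : R → Module.End k M) (r : R) : Module.End k (E.Tens l) :=
  BalTensor.map (E.rS r) LinearMap.id (fun i m => by simp [mul_assoc]) (fun _ _ => rfl)

theorem rTens_tmul (l : R → Module.End k M) (r : R) (u : U) (m : M) :
    E.rTens l r (E.tmul l u m) = E.tmul l (u * E.s r) m :=
  BalTensor.map_mk _ _ _ _ _ _

theorem lTens_add (l : R → Module.End k M) (r r' : R) :
    E.lTens l (r + r') = E.lTens l r + E.lTens l r' :=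
  BalTensor.hom_ext fun u m => by
    rw [LinearMap.add_apply, lTens_tmul, lTens_tmul, lTens_tmul, map_add, add_mul, map_add,
      LinearMap.add_apply]

theorem lTens_smul (l : R → Module.End k M) (c : k) (r : R) :
    E.lTens l (c • r) = c • E.lTens l r :=
  BalTensor.hom_ext fun u m => by
    rw [LinearMap.smul_apply, lTens_tmul, lTens_tmul, map_smul, smul_mul_assoc, map_smul,
      LinearMap.smul_apply]

theorem lTens_mul (l : R → Module.End k M) (r r' : R) :
    E.lTens l (r * r') = E.lTens l r ∘ₗ E.lTens l r' :=
  BalTensor.hom_ext fun u m => by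
    rw [LinearMap.comp_apply, lTens_tmul, lTens_tmul, lTens_tmul, map_mul E.s, mul_assoc]

end EnvRing

namespace LeftBialgebroidData

variable {k R U M : Type*} [CommRing k] [Ring R] [Algebra k R] [Ring U] [Algebra k U]
  [AddCommGroup M] [Module k M] {H : LeftBialgebroidData k R U}

/-- The right `R`-action `m r = ε(m₍₋₁₎ ◂ r) m₍₀₎` on a left comodule. -/
def coRight (hH : H.IsLeftBialgebroid) (N : H.LeftComoduleData M) (r : R) : Module.End k M :=
  BalTensor.lift (ρ := H.lT) (l := fun r => N.lact r)
    (N.lact.toLinearMap ∘ₗ H.counit ∘ₗ LinearMap.mulRight k (H.s r))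
    (fun a u m => by
      have h : H.counit (H.t (op a) * u * H.s r) = H.counit (u * H.s r) * a := by
        simpa [EnvRing.eta, mul_assoc] using hH.counit_eta_mul 1 a (u * H.s r)
      simp [h]) ∘ₗ N.coact

theorem coRight_apply (hH : H.IsLeftBialgebroid) (N : H.LeftComoduleData M) (r : R) (m : M) (n : ℕ)
    (x : Fin n → U) (y : Fin n → M)
    (h : N.coact m = ∑ i, H.tmul (fun r => N.lact r) (x i) (y i)) :
    coRight hH N r m = ∑ i, N.lact (H.counit (x i * H.s r)) (y i) := by
  rw [coRight, LinearMap.comp_apply, h, map_sum]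
  exact Finset.sum_congr rfl fun i _ => BalTensor.lift_mk _ _ _ _

/-- `Δ_M(m r) = m₍₋₁₎ ◂ r ⊗ m₍₀₎`. -/
theorem coact_coRight (hH : H.IsLeftBialgebroid) (N : H.LeftComoduleData M) (hN : N.IsLeftComodule)
    (r : R) (m : M) :
    N.coact (coRight hH N r m) = H.rTens (fun r => N.lact r) r (N.coact m) := by
  obtain ⟨n, x, y, h⟩ := BalTensor.exists_rep (N.coact m)
  choose a x' x'' hx using fun i => BalTensor.exists_rep (H.comul (x i))
  choose b y' y'' hy using fun i => BalTensor.exists_rep (N.coact (y i))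
  have h₃ := hN.coassoc m n x y h a b x' x'' y' y'' hx hy
  let K : H.Tens₃ (fun r => N.lact r) →ₗ[k] H.Tens (fun r => N.lact r) :=
    BalTensor.lift (LinearMap.mk₂ k
      (fun u X => H.lTens (fun r => N.lact r) (H.counit (u * H.s r)) X)
      (fun u u' X => by rw [add_mul, map_add, H.lTens_add, LinearMap.add_apply])
      (fun c u X => by rw [smul_mul_assoc, map_smul, H.lTens_smul, LinearMap.smul_apply])
      (fun u X X' => map_add _ _ _)
      (fun c u X => map_smul _ _ _))
      (fun i u X => by
        have h : H.counit (H.t (op i) * u * H.s r) = H.counit (u * H.s r) * i := by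
          simpa [EnvRing.eta, mul_assoc] using hH.counit_eta_mul 1 i (u * H.s r)
        simp only [LinearMap.mk₂_apply, EnvRing.lT_apply]
        rw [h, H.lTens_mul, LinearMap.comp_apply])
  have hK : ∀ u X, K (H.tmul (H.lTens (fun r => N.lact r)) u X) =
      H.lTens (fun r => N.lact r) (H.counit (u * H.s r)) X := fun u X =>
    BalTensor.lift_mk _ _ _ _
  have h₄ := congrArg K h₃
  simp only [map_sum, hK] at h₄
  have e₁ : ∀ i, ∑ j, H.lTens (fun r => N.lact r) (H.counit (x i * H.s r))
      (H.tmul (fun r => N.lact r) (y' i j) (y'' i j)) =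
      N.coact (N.lact (H.counit (x i * H.s r)) (y i)) := fun i => by
    rw [hN.coact_lact, hy, map_sum]
  have e₂ : ∀ i, ∑ j, H.lTens (fun r => N.lact r) (H.counit (x' i j * H.s r))
      (H.tmul (fun r => N.lact r) (x'' i j) (y i)) =
      H.tmul (fun r => N.lact r) (x i * H.s r) (y i) := fun i => by
    have hc : H.comul (x i * H.s r) = ∑ j, H.tmul₂ (x' i j * H.s r) (x'' i j) := by
      have := hH.comul_mul_eta (x i) r 1
      rw [hx, map_sum] at this
      simpa only [EnvRing.eta, op_one, map_one, mul_one, EnvRing.rmul_tmul] using this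
    conv_rhs => rw [← hH.counit_left _ _ _ _ hc]
    rw [map_sum, LinearMap.sum_apply]
    exact Finset.sum_congr rfl fun j _ => H.lTens_tmul _ _ _ _
  rw [coRight_apply hH N r m n x y h, map_sum, ← Finset.sum_congr rfl (fun i _ => e₁ i), ← h₄,
    Finset.sum_congr rfl (fun i _ => e₂ i), h, map_sum]
  exact Finset.sum_congr rfl fun i _ => (H.rTens_tmul _ _ _ _).symm

end LeftBialgebroidData

/-! ### The transported module and comodule -/

namespace MoritaContext

variable {k R S P Q U M : Type*} [CommRing k] [Ring R] [Algebra k R] [Ring S]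
  [Algebra k S] [AddCommGroup P] [Module k P] [Module S P] [Module Rᵐᵒᵖ P] [SMulCommClass S Rᵐᵒᵖ P]
  [IsScalarTower k S P] [IsScalarTower k Rᵐᵒᵖ P] [AddCommGroup Q] [Module k Q] [Module R Q]
  [Module Sᵐᵒᵖ Q] [SMulCommClass R Sᵐᵒᵖ Q] [IsScalarTower k R Q] [IsScalarTower k Sᵐᵒᵖ Q]
  [Ring U] [Algebra k U] [AddCommGroup M] [Module k M]
  (C : MoritaContext k R S P Q) (E : EnvRing k R U)

/-- The right `R`-action on `P`. -/
def rP (_ : MoritaContext k R S P Q) (r : R) : Module.End k P := Algebra.lsmul k k P (op r)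

/-- The left `R`-action on `Q`. -/
def lQ (_ : MoritaContext k R S P Q) (r : R) : Module.End k Q := Algebra.lsmul k k Q r

@[simp] theorem rP_apply (r : R) (p : P) : C.rP r p = op r • p := rfl
@[simp] theorem lQ_apply (r : R) (q : Q) : C.lQ r q = r • q := rfl

/-- The `k`-module `P ⊗_R M ⊗_R Q` for an `(R,R)`-bimodule `M` with actions `l` and `ρ`. -/
abbrev Sand (l ρ : R → Module.End k M) : Type _ := TriTensor C.rP l ρ C.lQ

/-- The pure tensor `p ⊗ m ⊗ q`. -/
abbrev sd (l ρ : R → Module.End k M) : P →ₗ[k] M →ₗ[k] Q →ₗ[k] C.Sand l ρ :=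
  TriTensor.mk C.rP l ρ C.lQ

/-- The left `R`-action `r ▸ m = m t(r)` on a right `U`-module. -/
def modLeft (act : Uᵐᵒᵖ →ₐ[k] Module.End k M) (r : R) : Module.End k M := act (op (E.t (op r)))

/-- The right `R`-action `m ◂ r = m s(r)` on a right `U`-module. -/
def modRight (act : Uᵐᵒᵖ →ₐ[k] Module.End k M) (r : R) : Module.End k M := act (op (E.s r))

/-- `M̃ = P ⊗_R M ⊗_R Q` for a right `U`-module `M`. -/
abbrev ModTilde (act : Uᵐᵒᵖ →ₐ[k] Module.End k M) : Type _ :=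
  C.Sand (modLeft E act) (modRight E act)

/-- `(m, c ⊗ d) ↦ d ⊗ m ⊗ c`. -/
def swapSd (l ρ : R → Module.End k M) : M →ₗ[k] Q ⊗[k] P →ₗ[k] C.Sand l ρ where
  toFun m := TensorProduct.lift ((C.sd l ρ).flip m).flip
  map_add' _ _ := by ext; simp
  map_smul' _ _ := by ext; simp

theorem swapSd_tmul (l ρ : R → Module.End k M) (m : M) (c : Q) (d : P) :
    C.swapSd l ρ m (c ⊗ₜ d) = C.sd l ρ d m c := rfl

theorem swapSd_eta (act : Uᵐᵒᵖ →ₐ[k] Module.End k M) (m : M) (i : R × R) (γ : Q ⊗[k] P) :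
    C.swapSd (modLeft E act) (modRight E act) (act (op (E.eta i)) m) γ =
      C.swapSd (modLeft E act) (modRight E act) m (C.lQe i γ) := by
  obtain ⟨r, r'⟩ := i
  induction γ with
  | zero => simp
  | add a b ha hb => simp only [map_add, ha, hb]
  | tmul c d =>
    rw [lQe_tmul, swapSd_tmul, swapSd_tmul, EnvRing.eta, op_mul, map_mul, Module.End.mul_apply]
    exact (TriTensor.mk_left C.rP _ _ C.lQ r' d (act (op (E.s r)) m) c).symm.trans
      (TriTensor.mk_right C.rP (modLeft E act) (modRight E act) C.lQ r (op r' • d) m c)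

/-- The action of `α ⊗ u ⊗ γ` on `M̃`. -/
def tildeActAux (act : Uᵐᵒᵖ →ₐ[k] Module.End k M) (α : P ⊗[k] Q) (u : U) (γ : Q ⊗[k] P) :
    Module.End k (C.ModTilde E act) :=
  TriTensor.lift (LinearMap.mk₂ k
    (fun p m =>
      { toFun := fun q => C.swapSd _ _ (act (op (C.pairU E (q ⊗ₜ p) α * u)) m) γ
        map_add' := fun q q' => by simp [TensorProduct.add_tmul, add_mul]
        map_smul' := fun c q => by simp [← TensorProduct.smul_tmul'] })
    (fun p p' m => LinearMap.ext fun q => by simp [TensorProduct.tmul_add, add_mul])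
    (fun c p m => LinearMap.ext fun q => by simp)
    (fun p m m' => LinearMap.ext fun q => by simp)
    (fun c p m => LinearMap.ext fun q => by simp))
    (fun r p m q => by
      have h : q ⊗ₜ[k] (op r • p) = C.lQe (1, r) (q ⊗ₜ[k] p) := by simp
      change C.swapSd _ _ (act (op (C.pairU E (q ⊗ₜ (op r • p)) α * u)) m) γ =
        C.swapSd _ _ (act (op (C.pairU E (q ⊗ₜ p) α * u)) (act (op (E.t (op r))) m)) γ
      rw [h, pairU_left, ← Module.End.mul_apply, ← map_mul, ← op_mul]
      simp [EnvRing.eta, mul_assoc])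
    (fun r p m q => by
      have h : (r • q) ⊗ₜ[k] p = C.lQe (r, 1) (q ⊗ₜ[k] p) := by simp
      change C.swapSd _ _ (act (op (C.pairU E (q ⊗ₜ p) α * u)) (act (op (E.s r)) m)) γ =
        C.swapSd _ _ (act (op (C.pairU E ((r • q) ⊗ₜ p) α * u)) m) γ
      rw [h, pairU_left, ← Module.End.mul_apply, ← map_mul, ← op_mul]
      simp [EnvRing.eta, mul_assoc])

theorem tildeActAux_sd (act : Uᵐᵒᵖ →ₐ[k] Module.End k M) (α : P ⊗[k] Q) (u : U) (γ : Q ⊗[k] P)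
    (p : P) (m : M) (q : Q) :
    C.tildeActAux E act α u γ (C.sd (modLeft E act) (modRight E act) p m q) =
      C.swapSd _ _ (act (op (C.pairU E (q ⊗ₜ p) α * u)) m) γ := TriTensor.lift_mk _ _ _ _ _ _

/-- The linear map `Ũ → End_k(M̃)` with
`(p ⊗ m ⊗ q) ((a ⊗ bᵒ) ⊗ u ⊗ (c ⊗ dᵒ)) = d ⊗ ((bp) ▸ m ◂ (qa)) u ⊗ c`. -/
def tildeActₗ (act : Uᵐᵒᵖ →ₐ[k] Module.End k M) :
    C.Tilde E →ₗ[k] Module.End k (C.ModTilde E act) :=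
  TriTensor.lift (LinearMap.mk₂ k
    (fun α u =>
      { toFun := fun γ => C.tildeActAux E act α u γ
        map_add' := fun γ γ' => TriTensor.hom_ext fun p m q => by
          rw [LinearMap.add_apply, tildeActAux_sd, tildeActAux_sd, tildeActAux_sd, map_add]
        map_smul' := fun c γ => TriTensor.hom_ext fun p m q => by
          rw [RingHom.id_apply, LinearMap.smul_apply, tildeActAux_sd, tildeActAux_sd, map_smul] })
    (fun α α' u => LinearMap.ext fun γ => TriTensor.hom_ext fun p m q => by
      change C.tildeActAux E act _ _ _ _ = C.tildeActAux E act _ _ _ _ + C.tildeActAux E act _ _ _ _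
      simp [tildeActAux_sd, add_mul])
    (fun c α u => LinearMap.ext fun γ => TriTensor.hom_ext fun p m q => by
      change C.tildeActAux E act _ _ _ _ = c • C.tildeActAux E act _ _ _ _
      simp [tildeActAux_sd])
    (fun α u u' => LinearMap.ext fun γ => TriTensor.hom_ext fun p m q => by
      change C.tildeActAux E act _ _ _ _ = C.tildeActAux E act _ _ _ _ + C.tildeActAux E act _ _ _ _
      simp [tildeActAux_sd, mul_add])
    (fun c α u => LinearMap.ext fun γ => TriTensor.hom_ext fun p m q => by
      change C.tildeActAux E act _ _ _ _ = c • C.tildeActAux E act _ _ _ _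
      simp [tildeActAux_sd]))
    (fun i α u γ => TriTensor.hom_ext fun p m q => by
      change C.tildeActAux E act _ _ _ _ = C.tildeActAux E act _ _ _ _
      rw [tildeActAux_sd, tildeActAux_sd, pairU_right, mul_assoc, E.lEnv_apply])
    (fun i α u γ => TriTensor.hom_ext fun p m q => by
      change C.tildeActAux E act _ _ _ _ = C.tildeActAux E act _ _ _ _
      rw [tildeActAux_sd, tildeActAux_sd, E.rEnv_apply, ← mul_assoc, op_mul, map_mul,
        Module.End.mul_apply, swapSd_eta])

theorem tildeActₗ_tl (act : Uᵐᵒᵖ →ₐ[k] Module.End k M) (a : P) (b : Q) (u : U) (c : Q) (d : P)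
    (p : P) (m : M) (q : Q) :
    C.tildeActₗ E act (C.tl E (a ⊗ₜ b) u (c ⊗ₜ d))
      (C.sd (modLeft E act) (modRight E act) p m q) =
    C.sd (modLeft E act) (modRight E act) d
      (act (op u) (modRight E act (C.qp q a) (modLeft E act (C.qp b p) m))) c := by
  refine (LinearMap.congr_fun (TriTensor.lift_mk _ _ _ _ _ _) _).trans ?_
  refine (C.tildeActAux_sd E act _ _ _ _ _ _).trans ?_
  rw [swapSd_tmul, pairU_tmul, EnvRing.eta, E.comm]
  simp only [modLeft, modRight, op_mul, map_mul, Module.End.mul_apply]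

theorem tildeActₗ_one (act : Uᵐᵒᵖ →ₐ[k] Module.End k M) : C.tildeActₗ E act 1 = 1 :=
  TriTensor.hom_ext fun p m q => by
    change _ = C.sd _ _ p m q
    rw [tilde_one_def, map_sum, LinearMap.sum_apply]
    simp only [map_sum, LinearMap.sum_apply]
    have h : ∀ i j, C.tildeActₗ E act (C.tl E (C.p' j ⊗ₜ C.q' i) 1 (C.q' j ⊗ₜ C.p' i))
        (C.sd _ _ p m q) =
        C.sd (modLeft E act) (modRight E act) (op (C.qp (C.q' i) p) • C.p' i) m
          (C.qp q (C.p' j) • C.q' j) := fun i j => by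
      rw [tildeActₗ_tl, op_one, map_one, Module.End.one_apply]
      exact (TriTensor.mk_right _ _ _ _ _ _ _ _).trans (TriTensor.mk_left _ _ _ _ _ _ _ _).symm
    refine (Finset.sum_congr rfl fun i _ => Finset.sum_congr rfl fun j _ => h i j).trans ?_
    simp only [← map_sum, C.sum_qp_q']
    rw [← LinearMap.sum_apply, ← LinearMap.sum_apply, ← map_sum, C.sum_p'_qp]

theorem tildeActₗ_mul (act : Uᵐᵒᵖ →ₐ[k] Module.End k M) (x y : C.Tilde E) :
    C.tildeActₗ E act (x * y) = C.tildeActₗ E act y * C.tildeActₗ E act x := by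
  induction x using C.tilde_induction E with
  | zero => simp
  | add x x' hx hy => simp only [add_mul, mul_add, map_add, hx, hy]
  | tl a b u c d =>
    induction y using C.tilde_induction E with
    | zero => simp
    | add x y hx hy => simp only [add_mul, mul_add, map_add, hx, hy]
    | tl a' b' v c' d' =>
      refine TriTensor.hom_ext fun p m q => ?_
      rw [Module.End.mul_apply, tl_mul_tl, pairU_tmul]
      rw [tildeActₗ_tl, tildeActₗ_tl, tildeActₗ_tl, EnvRing.eta, E.comm]
      simp only [modLeft, modRight, op_mul, map_mul, Module.End.mul_apply]

/-- The right `Ũ`-module structure of `M̃`. -/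
def tildeAct (act : Uᵐᵒᵖ →ₐ[k] Module.End k M) :
    (C.Tilde E)ᵐᵒᵖ →ₐ[k] Module.End k (C.ModTilde E act) :=
  AlgHom.ofLinearMap (C.tildeActₗ E act ∘ₗ (opLinearEquiv k).symm.toLinearMap)
    (C.tildeActₗ_one E act) (fun x y => C.tildeActₗ_mul E act y.unop x.unop)

variable {H : LeftBialgebroidData k R U} (hH : H.IsLeftBialgebroid) (N : H.LeftComoduleData M)

/-- `M̃ = P ⊗_R M ⊗_R Q` for a left `U`-comodule `M`. -/
abbrev ComTilde : Type _ := C.Sand (fun r => N.lact r) (LeftBialgebroidData.coRight hH N)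

/-- The pure tensor `p ⊗ m ⊗ q` in the comodule `M̃`. -/
abbrev cd : P →ₗ[k] M →ₗ[k] Q →ₗ[k] C.ComTilde hH N :=
  C.sd (fun r => N.lact r) (LeftBialgebroidData.coRight hH N)

/-- The left `S`-action `x (p ⊗ m ⊗ q) = xp ⊗ m ⊗ q` on `M̃`. -/
def tildeLactAux (x : S) : Module.End k (C.ComTilde hH N) :=
  TriTensor.lift (C.cd hH N ∘ₗ Algebra.lsmul k k P x)
    (fun r p m q => by
      change C.cd hH N (x • op r • p) m q = C.cd hH N (x • p) (N.lact r m) q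
      rw [smul_comm]
      exact TriTensor.mk_left C.rP _ _ C.lQ r (x • p) m q)
    (fun r p m q => TriTensor.mk_right C.rP _ _ C.lQ r (x • p) m q)

theorem tildeLactAux_cd (x : S) (p : P) (m : M) (q : Q) :
    C.tildeLactAux hH N x (C.cd hH N p m q) = C.cd hH N (x • p) m q := TriTensor.lift_mk _ _ _ _ _ _

/-- The left `S`-module structure of `M̃`. -/
def tildeLact : S →ₐ[k] Module.End k (C.ComTilde hH N) :=
  AlgHom.ofLinearMap
    { toFun := C.tildeLactAux hH N
      map_add' := fun x y => TriTensor.hom_ext fun p m q => by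
        rw [LinearMap.add_apply, tildeLactAux_cd, tildeLactAux_cd, tildeLactAux_cd, add_smul]; simp
      map_smul' := fun c x => TriTensor.hom_ext fun p m q => by
        rw [RingHom.id_apply, LinearMap.smul_apply, tildeLactAux_cd, tildeLactAux_cd, smul_assoc]
        simp }
    (TriTensor.hom_ext fun p m q => by
      change C.tildeLactAux hH N 1 _ = C.cd hH N p m q
      rw [tildeLactAux_cd, one_smul])
    (fun x y => TriTensor.hom_ext fun p m q => by
      change C.tildeLactAux hH N (x * y) (C.cd hH N p m q) =
        C.tildeLactAux hH N x (C.tildeLactAux hH N y (C.cd hH N p m q))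
      rw [tildeLactAux_cd, tildeLactAux_cd, tildeLactAux_cd, mul_smul])

/-- `U_◃ ⊗_R M → Ũ ⊗_S M̃`,
`u ⊗ m ↦ ∑ᵢⱼ ((p ⊗ qᵢᵒ) ⊗ u ⊗ (q ⊗ p'ⱼᵒ)) ⊗_S (pᵢ ⊗ m ⊗ q'ⱼ)`. -/
def tildeCoactAux (p : P) (q : Q) : H.Tens (fun r => N.lact r) →ₗ[k]
    (C.tildeEnv H.toEnvRing).Tens (fun x => C.tildeLact hH N x) :=
  BalTensor.lift (∑ i, ∑ j, ((C.tildeEnv H.toEnvRing).tmul (fun x => C.tildeLact hH N x)).compl₁₂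
      (((C.tl H.toEnvRing (p ⊗ₜ C.q i))).flip (q ⊗ₜ C.p' j))
      ((C.cd hH N (C.p i)).flip (C.q' j)))
    (fun r u m => by
      have h : ∀ i j, C.cd hH N (C.p i) (N.lact r m) (C.q' j) =
          C.cd hH N (op r • C.p i) m (C.q' j) := fun i j =>
        (TriTensor.mk_left C.rP _ _ C.lQ r (C.p i) m (C.q' j)).symm
      simp only [LinearMap.sum_apply, LinearMap.compl₁₂_apply, LinearMap.flip_apply, h,
        EnvRing.lT_apply]
      rw [Finset.sum_comm]
      conv_rhs => rw [Finset.sum_comm]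
      exact Finset.sum_congr rfl fun j _ => C.sum_legs H.toEnvRing p u (q ⊗ₜ C.p' j)
        (((C.cd hH N).flip m).flip (C.q' j))
        (fun x p => (C.tildeLactAux_cd hH N x p m (C.q' j)).symm) r)

theorem tildeCoactAux_tmul (p : P) (q : Q) (u : U) (m : M) :
    C.tildeCoactAux hH N p q (H.tmul (fun r => N.lact r) u m) =
      ∑ i, ∑ j, (C.tildeEnv H.toEnvRing).tmul (fun x => C.tildeLact hH N x)
        (C.tl H.toEnvRing (p ⊗ₜ C.q i) u (q ⊗ₜ C.p' j)) (C.cd hH N (C.p i) m (C.q' j)) := by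
  refine (BalTensor.lift_mk _ _ _ _).trans ?_
  simp only [LinearMap.sum_apply, LinearMap.compl₁₂_apply, LinearMap.flip_apply]

/-- The coaction of `M̃`: on `p ⊗ m ⊗ q` it is
`∑ᵢⱼ ((p ⊗ qᵢᵒ) ⊗ m₍₋₁₎ ⊗ (q ⊗ p'ⱼᵒ)) ⊗_S (pᵢ ⊗ m₍₀₎ ⊗ q'ⱼ)`. -/
def tildeCoact (hN : N.IsLeftComodule) : C.ComTilde hH N →ₗ[k]
    (C.tildeEnv H.toEnvRing).Tens (fun x => C.tildeLact hH N x) :=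
  TriTensor.lift (LinearMap.mk₂ k
    (fun p m =>
      { toFun := fun q => C.tildeCoactAux hH N p q (N.coact m)
        map_add' := fun q q' => by
          rw [← LinearMap.add_apply]
          refine LinearMap.congr_fun (BalTensor.hom_ext fun u m => ?_) _
          rw [LinearMap.add_apply, tildeCoactAux_tmul, tildeCoactAux_tmul, tildeCoactAux_tmul]
          simp only [TensorProduct.add_tmul, map_add, LinearMap.add_apply, Finset.sum_add_distrib]
        map_smul' := fun c q => by
          rw [RingHom.id_apply, ← LinearMap.smul_apply]
          refine LinearMap.congr_fun (BalTensor.hom_ext fun u m => ?_) _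
          rw [LinearMap.smul_apply, tildeCoactAux_tmul, tildeCoactAux_tmul]
          simp only [← TensorProduct.smul_tmul', map_smul, LinearMap.smul_apply, Finset.smul_sum] })
    (fun p p' m => LinearMap.ext fun q => by
      change C.tildeCoactAux hH N _ _ _ =
        (C.tildeCoactAux hH N p q + C.tildeCoactAux hH N p' q) (N.coact m)
      refine LinearMap.congr_fun (BalTensor.hom_ext fun u m => ?_) _
      rw [LinearMap.add_apply, tildeCoactAux_tmul, tildeCoactAux_tmul, tildeCoactAux_tmul]
      simp only [TensorProduct.add_tmul, map_add, LinearMap.add_apply, Finset.sum_add_distrib])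
    (fun c p m => LinearMap.ext fun q => by
      change C.tildeCoactAux hH N (c • p) q (N.coact m) =
        (c • C.tildeCoactAux hH N p q) (N.coact m)
      refine LinearMap.congr_fun (BalTensor.hom_ext fun u m => ?_) _
      rw [LinearMap.smul_apply, tildeCoactAux_tmul, tildeCoactAux_tmul]
      simp only [← TensorProduct.smul_tmul', map_smul, LinearMap.smul_apply, Finset.smul_sum])
    (fun p m m' => LinearMap.ext fun q => by
      change C.tildeCoactAux hH N _ _ _ = C.tildeCoactAux hH N _ _ _ + C.tildeCoactAux hH N _ _ _
      rw [map_add, map_add])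
    (fun c p m => LinearMap.ext fun q => by
      change C.tildeCoactAux hH N _ _ _ = c • C.tildeCoactAux hH N _ _ _
      rw [map_smul, map_smul]))
    (fun r p m q => by
      change C.tildeCoactAux hH N (op r • p) q (N.coact m) =
        C.tildeCoactAux hH N p q (N.coact (N.lact r m))
      rw [hN.coact_lact]
      change _ = (C.tildeCoactAux hH N p q ∘ₗ H.lTens _ r) (N.coact m)
      refine LinearMap.congr_fun (BalTensor.hom_ext fun u m => ?_) _
      rw [LinearMap.comp_apply, EnvRing.lTens_tmul, tildeCoactAux_tmul, tildeCoactAux_tmul]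
      simp only [tl_s])
    (fun r p m q => by
      change C.tildeCoactAux hH N p q (N.coact (LeftBialgebroidData.coRight hH N r m)) =
        C.tildeCoactAux hH N p (r • q) (N.coact m)
      rw [LeftBialgebroidData.coact_coRight hH N hN, ← LinearMap.comp_apply]
      refine LinearMap.congr_fun (BalTensor.hom_ext fun u m => ?_) _
      rw [LinearMap.comp_apply, EnvRing.rTens_tmul, tildeCoactAux_tmul, tildeCoactAux_tmul]
      simp only [tl_mul_s])

/-- The structure maps of the left `Ũ`-comodule `M̃`. -/
def tildeComodule (hN : N.IsLeftComodule) : (C.tilde hH).LeftComoduleData (C.ComTilde hH N) where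
  lact := C.tildeLact hH N
  coact := C.tildeCoact hH N hN

/-- `M̃ = P ⊗_R M ⊗_R Q` is anti Yetter–Drinfel'd over `Ũ`.  The right `Ũ`-module `M̃` is formed with
the bimodule structure that `M` has as a right `U`-module, and the left `Ũ`-comodule `M̃` with the one
that `M` has as a left `U`-comodule; the statement says that the two agree, by the map
`e(p ⊗ m ⊗ q) = p ⊗ m ⊗ q`, and that the resulting right `Ũ`-module and left `Ũ`-comodule is anti
Yetter–Drinfel'd. -/
def TildeIsAYD (act : Uᵐᵒᵖ →ₐ[k] Module.End k M) (hN : N.IsLeftComodule) : Prop :=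
  ∃ e : C.ModTilde H.toEnvRing act ≃ₗ[k] C.ComTilde hH N,
    (∀ p m q, e (C.sd _ _ p m q) = C.cd hH N p m q) ∧
    LeftBialgebroidData.IsAYD
      (((e.conjAlgEquiv k).toAlgHom).comp (C.tildeAct H.toEnvRing act)) (C.tildeComodule hH N hN)

/-- `M̃ = P ⊗_R M ⊗_R Q` is stable anti Yetter–Drinfel'd over `Ũ`. -/
def TildeIsSAYD (act : Uᵐᵒᵖ →ₐ[k] Module.End k M) (hN : N.IsLeftComodule) : Prop :=
  ∃ e : C.ModTilde H.toEnvRing act ≃ₗ[k] C.ComTilde hH N,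
    (∀ p m q, e (C.sd _ _ p m q) = C.cd hH N p m q) ∧
    LeftBialgebroidData.IsSAYD
      (((e.conjAlgEquiv k).toAlgHom).comp (C.tildeAct H.toEnvRing act)) (C.tildeComodule hH N hN)

end MoritaContext

end MoritaBaseChange

end

open scoped TensorProduct
open MulOpposite

noncomputable section

namespace MoritaBaseChange

/-! ### Sweedler identities as identities of linear maps on balanced tensor products -/

namespace EnvRing

variable {k R U M : Type*} [CommRing k] [Ring R] [Algebra k R] [Ring U] [Algebra k U]
  [AddCommGroup M] [Module k M] (E : EnvRing k R U) (l : R → Module.End k M)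

/-! The passage from `U`, `M` to `Ũ`, `M̃` is conjugation by the Morita context. An element `u ⊗ m`
of `U ⊗_R M` is sent to `Ũ ⊗_S M̃` by choosing outer elements of `P` and `Q` and inserting `∑ qᵢ ⊗
pᵢ` and `∑ p'ⱼ ⊗ q'ⱼ` at the inner junction. This operation, `thicken`, is defined for any target
`Y` with a map `P × M × Q → Y` that is `S`-linear in `P` and `R`-balanced (`IsFramed`). It thus
covers the coproduct of `Ũ` and the coaction of `M̃` alike, and it can be iterated.

Every structure map of `Ũ` and `M̃` commutes with thickening up to scalars `qp` in `R`. These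
scalars disappear for always the same reasons: `∑ⱼ p'ⱼ(q'ⱼa) = a`, `∑ᵢ (bp'ᵢ)q'ᵢ = b`, `∑ᵢ qᵢpᵢ =
1`, and, when both dual bases meet, `∑ᵢⱼ (qᵢp'ⱼ)(q'ⱼpᵢ) = 1`. The two factors of the last product
usually arise on different legs. They are brought together by the Takeuchi condition `u₍₁₎t(r) ⊗
u₍₂₎ = u₍₁₎ ⊗ u₍₂₎s(r)`, or by its analogue for a coaction, `m₍₋₁₎t(r) ⊗ m₍₀₎ = m₍₋₁₎ ⊗ m₍₀₎r`
(`coact_takeuchi`), which follows from the comodule axioms. To use it, the pair `p'ⱼ, q'ⱼ` is often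
kept as a free pair of variables (`tlOpen`, `thickenOpen`) and contracted only at the end.

The bialgebroid and comodule axioms follow in this way; coassociativity of both is one lemma,
`coassoc_framed`. For the Hopf property, the Galois map of `Ũ` is the conjugate of that of `U`
(`tildeGalois_thickenOp`). Surjectivity is then immediate. A left inverse is built by compressing `Ũ
⊗_S Ũ` to `U ⊗_R U`, inverting `β` there, and thickening back, summed over `φ⁻¹(1)` in all outer
slots.

For anti Yetter–Drinfel'd modules, the right side `u₋m₍₋₁₎u₊₍₁₎ ⊗ m₍₀₎u₊₍₂₎` is made into a
well-defined map `twistTens` in `Δ(u)`, which requires `Δ_M(m)` to lie in the Takeuchi product. The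
translation map of `Ũ` is the thickened one of `U` (`translation_tl`), hence the twisted coaction of
`M̃` is the thickened twisted coaction of `M` (`twistTens_thicken`). So the condition for `M`
implies that for `M̃`. Conversely, an element of the Takeuchi product is determined by its
thickenings (`eq_of_thicken_eq`), both sides of the condition lie in that product, and every `u` is
a sum of elements `η(qᵢpᵢ, qⱼpⱼ)u` that occur in the action of `Ũ`. The agreement of the bimodule
structures descends because `m` is determined by all `p ⊗ m ⊗ q` (`eq_of_cd_eq`). Stability
transfers since `m ↦ m₍₀₎m₍₋₁₎` on `M̃` is `p ⊗ m ⊗ q ↦ p ⊗ m₍₀₎m₍₋₁₎ ⊗ q`. -/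

theorem tmul_bal (r : R) (u : U) (m : M) :
    E.tmul l (E.t (op r) * u) m = E.tmul l u (l r m) :=
  BalTensor.mk_bal E.lT l r u m

theorem tmul₂_bal (r : R) (u v : U) :
    E.tmul₂ (E.t (op r) * u) v = E.tmul₂ u (E.s r * v) :=
  BalTensor.mk_bal E.lT E.lS r u v

/-- Right multiplication `u ⊗ m ↦ u x ⊗ m` on `U_◃ ⊗_R M`. -/
def rmulLeft (x : U) : Module.End k (E.Tens l) :=
  BalTensor.map (LinearMap.mulRight k x) LinearMap.id
    (fun i m => by simp [mul_assoc]) (fun _ _ => rfl)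

@[simp] theorem rmulLeft_tmul (x u : U) (m : M) :
    E.rmulLeft l x (E.tmul l u m) = E.tmul l (u * x) m :=
  BalTensor.map_mk _ _ _ _ _ _

/-- The map `u ⊗ v ↦ u ⊗ t(r) v` on `U_◃ ⊗_R ▹U`. -/
def lmulT (r : R) : Module.End k E.Tens₂ :=
  BalTensor.map LinearMap.id (E.lT r) (fun _ _ => rfl)
    (fun i m => by simp only [lS_apply, lT_apply, ← mul_assoc, E.comm])

@[simp] theorem lmulT_tmul (r : R) (u v : U) :
    E.lmulT r (E.tmul₂ u v) = E.tmul₂ u (E.t (op r) * v) :=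
  BalTensor.map_mk _ _ _ _ _ _

/-- The associativity map `(u ⊗ v, m) ↦ u ⊗ (v ⊗ m)`. -/
def assoc : E.Tens₂ →ₗ[k] M →ₗ[k] E.Tens₃ l :=
  BalTensor.lift (LinearMap.mk₂ k (fun u v => E.tmul (E.lTens l) u ∘ₗ E.tmul l v)
    (fun _ _ _ => by ext; simp) (fun _ _ _ => by ext; simp)
    (fun _ _ _ => by ext; simp) (fun _ _ _ => by ext; simp))
    (fun r u v => LinearMap.ext fun m => by
      change E.tmul (E.lTens l) (E.t (op r) * u) (E.tmul l v m) =
        E.tmul (E.lTens l) u (E.tmul l (E.s r * v) m)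
      rw [tmul_bal, lTens_tmul])

@[simp] theorem assoc_tmul (u v : U) (m : M) :
    E.assoc l (E.tmul₂ u v) m = E.tmul₃ l u v m :=
  LinearMap.congr_fun (BalTensor.lift_mk _ _ _ _) m

/-- The third factor is balanced against `t(r)` on the middle leg; with `Δ(t(r)u) = u₍₁₎ ⊗ t(r)u₍₂₎`
this makes `Δ ⊗ id` well defined on `U ⊗_R M`. -/
theorem assoc_lmulT (r : R) (X : E.Tens₂) (m : M) :
    E.assoc l (E.lmulT r X) m = E.assoc l X (l r m) := by
  induction X using BalTensor.induction with
  | mk u v =>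
    rw [lmulT_tmul, assoc_tmul, assoc_tmul]
    change E.tmul (E.lTens l) _ (E.tmul l _ _) = _
    rw [tmul_bal]
  | zero => simp
  | add X Y hX hY => simp only [map_add, LinearMap.add_apply, hX, hY]

end EnvRing

namespace EnvRing

variable {k R U M : Type*} [CommRing k] [Ring R] [Algebra k R] [Ring U] [Algebra k U]
  [AddCommGroup M] [Module k M] (E : EnvRing k R U) (l : R → Module.End k M)
  (δ : U →ₗ[k] E.Tens₂) (ε : U →ₗ[k] R)

/-- The map `δ ⊗ id` on `U_◃ ⊗_R M`. -/
def comulId (hT : ∀ r u, δ (E.t (op r) * u) = E.lmulT r (δ u)) : E.Tens l →ₗ[k] E.Tens₃ l :=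
  BalTensor.lift (E.assoc l ∘ₗ δ) (fun r u m => by
    simp only [LinearMap.comp_apply, EnvRing.lT_apply, hT, EnvRing.assoc_lmulT])

theorem comulId_tmul (hT : ∀ r u, δ (E.t (op r) * u) = E.lmulT r (δ u)) (u : U) (m : M) :
    E.comulId l δ hT (E.tmul l u m) = E.assoc l (δ u) m :=
  BalTensor.lift_mk _ _ _ _

variable {l}

/-- The map `id ⊗ c` on `U_◃ ⊗_R M`, for a left `R`-linear coaction `c`. -/
def idCoact (c : M →ₗ[k] E.Tens l) (hc : ∀ r m, c (l r m) = E.lTens l r (c m)) :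
    E.Tens l →ₗ[k] E.Tens₃ l :=
  BalTensor.map LinearMap.id c (fun _ _ => rfl) hc

theorem idCoact_tmul (c : M →ₗ[k] E.Tens l) (hc : ∀ r m, c (l r m) = E.lTens l r (c m))
    (u : U) (m : M) :
    E.idCoact c hc (E.tmul l u m) = E.tmul (E.lTens l) u (c m) :=
  BalTensor.map_mk _ _ _ _ _ _

/-- Coassociativity of `c` in Sweedler form, for all representations, is the identity
`(δ ⊗ id) ∘ c = (id ⊗ c) ∘ c`. -/
theorem coassoc_iff (hT : ∀ r u, δ (E.t (op r) * u) = E.lmulT r (δ u))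
    (c : M →ₗ[k] E.Tens l) (hc : ∀ r m, c (l r m) = E.lTens l r (c m)) (m : M) :
    (∀ (n : ℕ) (x : Fin n → U) (y : Fin n → M), c m = ∑ i, E.tmul l (x i) (y i) →
      ∀ (a b : Fin n → ℕ) (x' x'' : (i : Fin n) → Fin (a i) → U)
        (y' : (i : Fin n) → Fin (b i) → U) (y'' : (i : Fin n) → Fin (b i) → M),
      (∀ i, δ (x i) = ∑ j, E.tmul₂ (x' i j) (x'' i j)) →
      (∀ i, c (y i) = ∑ j, E.tmul l (y' i j) (y'' i j)) →
      ∑ i, ∑ j, E.tmul₃ l (x' i j) (x'' i j) (y i) =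
        ∑ i, ∑ j, E.tmul₃ l (x i) (y' i j) (y'' i j)) ↔
    E.comulId l δ hT (c m) = E.idCoact c hc (c m) := by
  -- On any choice of representations the two linear maps evaluate to the two Sweedler sums. So the
  -- quantified statement needs only one choice, and such a choice exists.
  have key : ∀ (n : ℕ) (x : Fin n → U) (y : Fin n → M), c m = ∑ i, E.tmul l (x i) (y i) →
      ∀ (a b : Fin n → ℕ) (x' x'' : (i : Fin n) → Fin (a i) → U)
        (y' : (i : Fin n) → Fin (b i) → U) (y'' : (i : Fin n) → Fin (b i) → M),
      (∀ i, δ (x i) = ∑ j, E.tmul₂ (x' i j) (x'' i j)) →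
      (∀ i, c (y i) = ∑ j, E.tmul l (y' i j) (y'' i j)) →
      E.comulId l δ hT (c m) = ∑ i, ∑ j, E.tmul₃ l (x' i j) (x'' i j) (y i) ∧
      E.idCoact c hc (c m) = ∑ i, ∑ j, E.tmul₃ l (x i) (y' i j) (y'' i j) := by
    intro n x y h a b x' x'' y' y'' hx hy
    rw [h]
    constructor
    · simp only [map_sum, comulId_tmul, hx, LinearMap.sum_apply, EnvRing.assoc_tmul]
    · simp only [map_sum, idCoact_tmul, hy]
  constructor
  · intro h
    obtain ⟨n, x, y, hm⟩ := BalTensor.exists_rep (c m)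
    choose a x' x'' hx using fun i => BalTensor.exists_rep (δ (x i))
    choose b y' y'' hy using fun i => BalTensor.exists_rep (c (y i))
    obtain ⟨h₁, h₂⟩ := key n x y hm a b x' x'' y' y'' hx hy
    rw [h₁, h₂]
    exact h n x y hm a b x' x'' y' y'' hx hy
  · intro h n x y hm a b x' x'' y' y'' hx hy
    obtain ⟨h₁, h₂⟩ := key n x y hm a b x' x'' y' y'' hx hy
    rw [← h₁, ← h₂, h]

/-- The map `u ⊗ v ↦ s(ε(u)) v`. -/
def counitLeft (h : ∀ r u, ε (E.t (op r) * u) = ε u * r) : E.Tens₂ →ₗ[k] U :=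
  BalTensor.lift (LinearMap.mul k U ∘ₗ E.s.toLinearMap ∘ₗ ε)
    (fun r u v => by simp [h, mul_assoc])

theorem counitLeft_tmul (h : ∀ r u, ε (E.t (op r) * u) = ε u * r) (u v : U) :
    E.counitLeft ε h (E.tmul₂ u v) = E.s (ε u) * v :=
  BalTensor.lift_mk _ _ _ _

/-- The map `u ⊗ v ↦ t(ε(v)) u`. -/
def counitRight (h : ∀ r u, ε (E.s r * u) = r * ε u) : E.Tens₂ →ₗ[k] U :=
  BalTensor.lift
    (LinearMap.mul k U ∘ₗ E.t.toLinearMap ∘ₗ (opLinearEquiv k).toLinearMap ∘ₗ ε).flip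
    (fun r u v => by simp [h, mul_assoc])

theorem counitRight_tmul (h : ∀ r u, ε (E.s r * u) = r * ε u) (u v : U) :
    E.counitRight ε h (E.tmul₂ u v) = E.t (op (ε v)) * u :=
  BalTensor.lift_mk _ _ _ _

/-- The map `u ⊗ m ↦ ε(u s(r)) m`. -/
def counitTens (h : ∀ r u, ε (E.t (op r) * u) = ε u * r) (l : R →ₐ[k] Module.End k M) (r : R) :
    E.Tens (fun r => l r) →ₗ[k] M :=
  BalTensor.lift (l.toLinearMap ∘ₗ ε ∘ₗ LinearMap.mulRight k (E.s r))
    (fun a u m => by simp [h, mul_assoc])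

theorem counitTens_tmul (h : ∀ r u, ε (E.t (op r) * u) = ε u * r) (l : R →ₐ[k] Module.End k M)
    (r : R) (u : U) (m : M) :
    E.counitTens ε h l r (E.tmul (fun r => l r) u m) = l (ε (u * E.s r)) m :=
  BalTensor.lift_mk _ _ _ _

end EnvRing

/-! ### The bimodule structure and the Takeuchi property of a left comodule -/

namespace LeftBialgebroidData

variable {k R U M : Type*} [CommRing k] [Ring R] [Algebra k R] [Ring U] [Algebra k U]
  [AddCommGroup M] [Module k M] {H : LeftBialgebroidData k R U}

namespace IsLeftBialgebroid

theorem comul_t_mul (hH : H.IsLeftBialgebroid) (r : R) (u : U) :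
    H.comul (H.t (op r) * u) = H.lmulT r (H.comul u) := by
  obtain ⟨n, x, y, h⟩ := BalTensor.exists_rep (H.comul u)
  have := hH.comul_eta_mul 1 r u n x y h
  simp only [EnvRing.eta, map_one, one_mul] at this
  rw [this, h, map_sum]
  simp only [EnvRing.lmulT_tmul]

theorem comul_s_mul (hH : H.IsLeftBialgebroid) (r : R) (u : U) :
    H.comul (H.s r * u) = H.lTens H.lS r (H.comul u) := by
  obtain ⟨n, x, y, h⟩ := BalTensor.exists_rep (H.comul u)
  have := hH.comul_eta_mul r 1 u n x y h
  simp only [EnvRing.eta, op_one, map_one, mul_one, one_mul] at this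
  rw [this, h, map_sum]
  simp only [EnvRing.lTens_tmul]

theorem comul_mul_t (hH : H.IsLeftBialgebroid) (u : U) (r : R) :
    H.comul (u * H.t (op r)) = H.rmul 1 (H.t (op r)) (H.comul u) := by
  simpa [EnvRing.eta] using hH.comul_mul_eta u 1 r

theorem comul_mul_s (hH : H.IsLeftBialgebroid) (u : U) (r : R) :
    H.comul (u * H.s r) = H.rmul (H.s r) 1 (H.comul u) := by
  simpa [EnvRing.eta] using hH.comul_mul_eta u r 1

theorem counit_s_mul (hH : H.IsLeftBialgebroid) (r : R) (u : U) :
    H.counit (H.s r * u) = r * H.counit u := by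
  simpa [EnvRing.eta] using hH.counit_eta_mul r 1 u

theorem counit_t_mul (hH : H.IsLeftBialgebroid) (r : R) (u : U) :
    H.counit (H.t (op r) * u) = H.counit u * r := by
  simpa [EnvRing.eta] using hH.counit_eta_mul 1 r u

theorem counit_s (hH : H.IsLeftBialgebroid) (r : R) : H.counit (H.s r) = r := by
  simpa using hH.counit_st 1 1 r

end IsLeftBialgebroid

variable (hH : H.IsLeftBialgebroid) (N : H.LeftComoduleData M)

theorem coRight_eq (r : R) (m : M) :
    coRight hH N r m = H.counitTens H.counit hH.counit_t_mul N.lact r (N.coact m) := rfl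

theorem coRight_one (hN : N.IsLeftComodule) (m : M) : coRight hH N 1 m = m := by
  obtain ⟨n, x, y, h⟩ := BalTensor.exists_rep (N.coact m)
  rw [coRight_apply hH N 1 m n x y h]
  simpa using hN.counit m n x y h

theorem coRight_mul (hN : N.IsLeftComodule) (r r' : R) (m : M) :
    coRight hH N r' (coRight hH N r m) = coRight hH N (r * r') m := by
  rw [coRight_eq, coact_coRight hH N hN, coRight_eq]
  generalize N.coact m = X
  induction X using BalTensor.induction with
  | mk u m =>
    rw [H.rTens_tmul, EnvRing.counitTens_tmul, EnvRing.counitTens_tmul, map_mul H.s, mul_assoc]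
  | zero => simp
  | add X Y hX hY => simp only [map_add, hX, hY]

/-- The coaction sends `r m` to `s(r)m₍₋₁₎ ⊗ m₍₀₎`, and `ε` is left linear over `s`; thus the two
`R`-actions commute and `m ↦ m r` may be applied to the second factor of `U ⊗_R M`. -/
theorem coRight_lact (hN : N.IsLeftComodule) (r r' : R) (m : M) :
    coRight hH N r' (N.lact r m) = N.lact r (coRight hH N r' m) := by
  rw [coRight_eq, hN.coact_lact, coRight_eq]
  generalize N.coact m = X
  induction X using BalTensor.induction with
  | mk u m =>
    rw [H.lTens_tmul, EnvRing.counitTens_tmul, EnvRing.counitTens_tmul, mul_assoc,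
      hH.counit_s_mul, map_mul]
    rfl
  | zero => simp
  | add X Y hX hY => simp only [map_add, hX, hY]

/-- The map `u ⊗ m ↦ u ⊗ m r` on `U_◃ ⊗_R M`, for the right `R`-action of a left comodule. -/
def idCoRight (hN : N.IsLeftComodule) (r : R) : Module.End k (H.Tens (fun r => N.lact r)) :=
  BalTensor.map LinearMap.id (coRight hH N r) (fun _ _ => rfl)
    (fun i m => coRight_lact hH N hN i r m)

theorem idCoRight_tmul (hN : N.IsLeftComodule) (r : R) (u : U) (m : M) :
    idCoRight hH N hN r (H.tmul (fun r => N.lact r) u m) =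
      H.tmul (fun r => N.lact r) u (coRight hH N r m) :=
  BalTensor.map_mk _ _ _ _ _ _

/-- The coaction takes values in the Takeuchi product: `m₍₋₁₎ t(r) ⊗ m₍₀₎ = m₍₋₁₎ ⊗ m₍₀₎ r`. -/
theorem coact_takeuchi (hN : N.IsLeftComodule) (r : R) (m : M) :
    H.rmulLeft (fun r => N.lact r) (H.t (op r)) (N.coact m) =
      idCoRight hH N hN r (N.coact m) := by
  have h := (H.coassoc_iff H.comul hH.comul_t_mul N.coact hN.coact_lact m).1 (hN.coassoc m)
  -- `K` applies `v ⊗ m ↦ ε(v s(r)) m` to the last two factors of the coassociativity identity. On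
  -- the side `id ⊗ Δ_M` this is the right action on `m₍₀₎`.
  let K : H.Tens₃ (fun r => N.lact r) →ₗ[k] H.Tens (fun r => N.lact r) :=
    BalTensor.map LinearMap.id (H.counitTens H.counit hH.counit_t_mul N.lact r) (fun _ _ => rfl)
      (fun i X => by
      induction X using BalTensor.induction with
      | mk u m =>
        rw [H.lTens_tmul, EnvRing.counitTens_tmul, EnvRing.counitTens_tmul, mul_assoc,
          hH.counit_s_mul, map_mul]
        rfl
      | zero => simp
      | add X Y hX hY => simp only [map_add, hX, hY])
  have hK : ∀ u X, K (H.tmul (H.lTens (fun r => N.lact r)) u X) =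
      H.tmul (fun r => N.lact r) u (H.counitTens H.counit hH.counit_t_mul N.lact r X) :=
    fun u X => BalTensor.map_mk _ _ _ _ _ _
  -- On the side `Δ ⊗ id` use `ε(u₍₂₎s(r)) = ε(u₍₂₎t(r))` and `Δ(u t(r)) = u₍₁₎ ⊗ u₍₂₎t(r)`; right
  -- counitality then leaves `u t(r)`.
  have e₁ : ∀ X, K (H.comulId _ H.comul hH.comul_t_mul X) =
      H.rmulLeft (fun r => N.lact r) (H.t (op r)) X := by
    intro X
    induction X using BalTensor.induction with
    | mk u m =>
      rw [H.comulId_tmul, H.rmulLeft_tmul]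
      obtain ⟨n, x, y, hx⟩ := BalTensor.exists_rep (H.comul u)
      have hc : H.comul (u * H.t (op r)) = ∑ j, H.tmul₂ (x j) (y j * H.t (op r)) := by
        rw [hH.comul_mul_t, hx, map_sum]
        simp only [EnvRing.rmul_tmul, mul_one]
      rw [← hH.counit_right _ _ _ _ hc, hx]
      simp only [map_sum, LinearMap.sum_apply, EnvRing.assoc_tmul, hK, EnvRing.counitTens_tmul,
        H.tmul_bal, hH.counit_mul_t]
    | zero => simp
    | add X Y hX hY => simp only [map_add, hX, hY]
  have e₂ : ∀ X, K (H.idCoact N.coact hN.coact_lact X) = idCoRight hH N hN r X := by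
    intro X
    induction X using BalTensor.induction with
    | mk u m => rw [H.idCoact_tmul, hK, idCoRight_tmul, coRight_eq]
    | zero => simp
    | add X Y hX hY => simp only [map_add, hX, hY]
  rw [← e₁, ← e₂, h]

end LeftBialgebroidData

/-! ### Dual basis identities, thickening and compression -/

namespace MoritaContext

variable {k R S P Q U M : Type*} [CommRing k] [Ring R] [Algebra k R] [Ring S]
  [Algebra k S] [AddCommGroup P] [Module k P] [Module S P] [Module Rᵐᵒᵖ P] [SMulCommClass S Rᵐᵒᵖ P]
  [IsScalarTower k S P] [IsScalarTower k Rᵐᵒᵖ P] [AddCommGroup Q] [Module k Q] [Module R Q]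
  [Module Sᵐᵒᵖ Q] [SMulCommClass R Sᵐᵒᵖ Q] [IsScalarTower k R Q] [IsScalarTower k Sᵐᵒᵖ Q]
  [Ring U] [Algebra k U] [AddCommGroup M] [Module k M]
  (C : MoritaContext k R S P Q) (E : EnvRing k R U)

theorem qp_mul_qp (q : Q) (p : P) (q' : Q) (p' : P) :
    C.qp q p * C.qp q' p' = C.qp q (C.pq p q' • p') := by
  rw [C.pq_smul, C.qp_right]

theorem sum_qp_mul_qp (q : Q) (p : P) : ∑ j, C.qp q (C.p' j) * C.qp (C.q' j) p = C.qp q p := by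
  simp_rw [qp_mul_qp]
  rw [← map_sum, ← Finset.sum_smul, C.sum_pq, one_smul]

/-- `∑ᵢⱼ (qᵢ p'ⱼ)(q'ⱼ pᵢ) = 1`. -/
theorem sum_sum_qp_mul_qp : ∑ i, ∑ j, C.qp (C.q i) (C.p' j) * C.qp (C.q' j) (C.p i) = 1 := by
  simp_rw [sum_qp_mul_qp, sum_qp]

/-- `q ⊗_S p = ∑ᵢ (qp) qᵢ ⊗_S pᵢ`. -/
theorem eq_sum_q_p {Y : Type*} [AddCommGroup Y] [Module k Y] (F : Q →ₗ[k] P →ₗ[k] Y)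
    (hF : ∀ (x : S) q p, F (op x • q) p = F q (x • p)) (q : Q) (p : P) :
    F q p = ∑ i, F (C.qp q p • C.q i) (C.p i) := by
  -- `(qp)qᵢ = q(pqᵢ)`; balancing over `S` moves `pqᵢ` onto `pᵢ`, and `(pqᵢ)pᵢ = p(qᵢpᵢ)` sums to
  -- `p`.
  simp_rw [C.qp_smul, hF, C.pq_smul]
  rw [← map_sum]
  congr 1
  have h : ∀ i, op (C.qp (C.q i) (C.p i)) • p = C.pq p (C.q i) • C.p i := fun i => (C.pq_smul _ _ _).symm
  simp_rw [← C.pq_smul, ← h, ← Finset.sum_smul, ← Finset.op_sum, C.sum_qp, op_one, one_smul]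

/-- `∑ⱼ y p'ⱼ ⊗_R q'ⱼ = ∑ⱼ p'ⱼ ⊗_R q'ⱼ y`. -/
theorem sum_p'_q'_comm {Y : Type*} [AddCommGroup Y] [Module k Y] (F : P →ₗ[k] Q →ₗ[k] Y)
    (hF : ∀ (r : R) p q, F (op r • p) q = F p (r • q)) (y : S) :
    ∑ j, F (y • C.p' j) (C.q' j) = ∑ j, F (C.p' j) (op y • C.q' j) := by
  -- A balanced `F` factors through `φ : P ⊗_R Q ≃ S`, where both sums become the image of `y`.
  have key : ∀ p q, F p q = BalTensor.lift (ρ := fun r : R => Algebra.lsmul k k P (op r))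
      (l := fun r : R => Algebra.lsmul k k Q r) F hF (C.φ.symm (C.pq p q)) := by
    intro p q
    rw [show C.pq p q = C.φ (BalTensor.mk _ _ p q) from rfl, LinearEquiv.symm_apply_apply]
    exact (BalTensor.lift_mk F hF p q).symm
  simp_rw [key, ← map_sum, C.pq_left, C.pq_right, ← Finset.mul_sum, ← Finset.sum_mul, C.sum_pq,
    mul_one, one_mul]

/-- Right-hand counterpart of `tildeEta_mul_tl`: the scalars formed with `c` and `d` pass through
the balancing over `Rᵉ`, and the dual bases reassemble `c x` and `y d`. -/
theorem tl_mul_tildeEta (x y : S) (α : P ⊗[k] Q) (u : U) (c : Q) (d : P) :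
    C.tl E α u (c ⊗ₜ d) * C.tildeEta E x y = C.tl E α u ((op x • c) ⊗ₜ (y • d)) := by
  simp only [tildeEta, Finset.mul_sum, tl_mul_tl, mul_one, pairU_tmul, tl_right, lQe_tmul,
    ← map_sum, ← TensorProduct.tmul_sum, ← TensorProduct.sum_tmul]
  simp_rw [← C.qp_bal, C.sum_qp_q', ← smul_comm y, ← Finset.smul_sum, C.sum_p'_qp]

theorem tl_mul_tildeEnv_s (x : S) (α : P ⊗[k] Q) (u : U) (c : Q) (d : P) :
    C.tl E α u (c ⊗ₜ d) * (C.tildeEnv E).s x = C.tl E α u ((op x • c) ⊗ₜ d) := by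
  rw [tildeEnv_s, tl_mul_tildeEta, one_smul]

theorem tl_mul_tildeEnv_t (y : S) (α : P ⊗[k] Q) (u : U) (c : Q) (d : P) :
    C.tl E α u (c ⊗ₜ d) * (C.tildeEnv E).t (op y) = C.tl E α u (c ⊗ₜ (y • d)) := by
  rw [tildeEnv_t, tl_mul_tildeEta, op_one, one_smul]

theorem tildeEnv_eta (x y : S) : (C.tildeEnv E).s x * (C.tildeEnv E).t (op y) = C.tildeEta E x y := by
  rw [tildeEnv_s, tildeEnv_t, tildeEta_mul, mul_one, mul_one]

/-- Representing the inner indices by `qᵢ ⊗_S pᵢ`. -/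
theorem tmul_tl_eq_sum {Y : Type*} [AddCommGroup Y] [Module k Y] {l : S → Module.End k Y} (a : P)
    (b : Q) (u : U) (γ : Q ⊗[k] P) (f : P →ₗ[k] Y) (hf : ∀ x p, f (x • p) = l x (f p)) (p : P) :
    (C.tildeEnv E).tmul l (C.tl E (a ⊗ₜ b) u γ) (f p) =
      ∑ i, (C.tildeEnv E).tmul l (C.tl E (a ⊗ₜ C.q i) (E.t (op (C.qp b p)) * u) γ) (f (C.p i)) := by
  refine (C.eq_sum_q_p (C.legs E (l := l) a u γ f) (fun x q p => ?_) b p).trans ?_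
  · rw [legs_apply, legs_apply, hf, ← t_mul_tl]
    exact BalTensor.mk_bal _ _ x _ _
  · simp only [legs_apply, tl_t]

/-! ### Transport of elements of `U_◃ ⊗_R M` -/

section Thicken

variable {Y : Type*} [AddCommGroup Y] [Module k Y]

/-- A trilinear map `(p, m, q) ↦ F p m q` that is left `S`-linear in `p` and `R`-balanced in
`p` and `m`. -/
structure IsFramed (_ : MoritaContext k R S P Q) (lM : R → Module.End k M) (l : S → Module.End k Y)
    (F : P →ₗ[k] M →ₗ[k] Q →ₗ[k] Y) : Prop where
  smul : ∀ x p m q, F (x • p) m q = l x (F p m q)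
  bal : ∀ r p m q, F (op r • p) m q = F p (lM r m) q

variable {C} {lM : R → Module.End k M} {l : S → Module.End k Y} {F : P →ₗ[k] M →ₗ[k] Q →ₗ[k] Y}

/-- The map `u ⊗ m ↦ ∑ᵢⱼ ((p ⊗ qᵢᵒ) ⊗ u ⊗ (q ⊗ p'ⱼᵒ)) ⊗_S F pᵢ m q'ⱼ` for a fixed `p`. -/
def thickenAux (hF : C.IsFramed lM l F) (p : P) :
    E.Tens lM →ₗ[k] Q →ₗ[k] (C.tildeEnv E).Tens l :=
  BalTensor.lift (LinearMap.mk₂ k (fun u m => ∑ i, ∑ j,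
      ((C.tildeEnv E).tmul l).flip (F (C.p i) m (C.q' j)) ∘ₗ C.tl E (p ⊗ₜ C.q i) u ∘ₗ
        (TensorProduct.mk k Q P).flip (C.p' j))
    (fun _ _ _ => by ext; simp [Finset.sum_add_distrib])
    (fun _ _ _ => by ext; simp [Finset.smul_sum])
    (fun _ _ _ => by ext; simp [Finset.sum_add_distrib])
    (fun _ _ _ => by ext; simp [Finset.smul_sum]))
    (fun r u m => LinearMap.ext fun q => by
      simp only [LinearMap.mk₂_apply, LinearMap.sum_apply, LinearMap.comp_apply,
        LinearMap.flip_apply, TensorProduct.mk_apply, EnvRing.lT_apply, ← hF.bal]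
      rw [Finset.sum_comm]
      conv_rhs => rw [Finset.sum_comm]
      exact Finset.sum_congr rfl fun j _ => C.sum_legs E p u (q ⊗ₜ C.p' j)
        ((F.flip m).flip (C.q' j)) (fun x p => hF.smul x p m (C.q' j)) r)

theorem thickenAux_tmul (hF : C.IsFramed lM l F) (p : P) (u : U) (m : M) (q : Q) :
    thickenAux E hF p (E.tmul lM u m) q = ∑ i, ∑ j, (C.tildeEnv E).tmul l
      (C.tl E (p ⊗ₜ C.q i) u (q ⊗ₜ C.p' j)) (F (C.p i) m (C.q' j)) := by
  refine (LinearMap.congr_fun (BalTensor.lift_mk _ _ _ _) q).trans ?_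
  simp

/-- The trilinear map
`(p, u ⊗ m, q) ↦ ∑ᵢⱼ ((p ⊗ qᵢᵒ) ⊗ u ⊗ (q ⊗ p'ⱼᵒ)) ⊗_S F pᵢ m q'ⱼ`. -/
def thicken (hF : C.IsFramed lM l F) : P →ₗ[k] E.Tens lM →ₗ[k] Q →ₗ[k] (C.tildeEnv E).Tens l where
  toFun := thickenAux E hF
  map_add' p p' := BalTensor.hom_ext fun u m => LinearMap.ext fun q => by
    rw [LinearMap.add_apply, LinearMap.add_apply, thickenAux_tmul, thickenAux_tmul, thickenAux_tmul]
    simp [TensorProduct.add_tmul, Finset.sum_add_distrib]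
  map_smul' c p := BalTensor.hom_ext fun u m => LinearMap.ext fun q => by
    rw [LinearMap.smul_apply, LinearMap.smul_apply, thickenAux_tmul, thickenAux_tmul]
    simp [← TensorProduct.smul_tmul', Finset.smul_sum]

theorem thicken_tmul (hF : C.IsFramed lM l F) (p : P) (u : U) (m : M) (q : Q) :
    thicken E hF p (E.tmul lM u m) q = ∑ i, ∑ j, (C.tildeEnv E).tmul l
      (C.tl E (p ⊗ₜ C.q i) u (q ⊗ₜ C.p' j)) (F (C.p i) m (C.q' j)) :=
  thickenAux_tmul E hF p u m q

/-- Thickening involves the outer `p` only through the slot of `Ũ` on which `s̃(x)` and `s(r)` act,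
so it is again framed. Iterating it produces the threefold tensors needed for coassociativity. -/
theorem IsFramed.thicken (hF : C.IsFramed lM l F) :
    C.IsFramed (E.lTens lM) ((C.tildeEnv E).lTens l) (thicken E hF) where
  smul x p X q := by
    induction X using BalTensor.induction with
    | mk u m =>
      rw [thicken_tmul, thicken_tmul]
      simp only [map_sum, EnvRing.lTens_tmul, s_mul_tl]
    | zero => simp
    | add X Y hX hY => simp only [map_add, LinearMap.add_apply, hX, hY]
  bal r p X q := by
    induction X using BalTensor.induction with
    | mk u m =>
      rw [EnvRing.lTens_tmul, thicken_tmul, thicken_tmul]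
      simp only [tl_s]
    | zero => simp
    | add X Y hX hY => simp only [map_add, LinearMap.add_apply, hX, hY]

end Thicken

/-! ### Compression of `Ũ` to `U` -/

/-- The map `α ⊗ u ⊗ γ ↦ (γ₀ α) u (γ α₀)` from `Ũ` to `U`. -/
def compress (γ₀ : Q ⊗[k] P) (α₀ : P ⊗[k] Q) : C.Tilde E →ₗ[k] U :=
  TriTensor.lift (LinearMap.mk₂ k
    (fun α u => LinearMap.mulLeft k (C.pairU E γ₀ α * u) ∘ₗ (C.pairU E).flip α₀)
    (fun _ _ _ => by ext; simp [add_mul, mul_assoc])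
    (fun _ _ _ => by ext; simp [mul_assoc])
    (fun _ _ _ => by ext; simp [mul_add, add_mul, mul_assoc])
    (fun _ _ _ => by ext; simp [mul_assoc]))
    (fun i α u γ => by simp [pairU_right])
    (fun i α u γ => by simp [pairU_left])

theorem compress_tl (γ₀ : Q ⊗[k] P) (α₀ α : P ⊗[k] Q) (u : U) (γ : Q ⊗[k] P) :
    C.compress E γ₀ α₀ (C.tl E α u γ) = C.pairU E γ₀ α * u * C.pairU E γ α₀ :=
  TriTensor.lift_mk _ _ _ _ _ _

end MoritaContext

/-! ### Counit identities and right multiplication on the Takeuchi product -/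

namespace LeftBialgebroidData

variable {k R U : Type*} [CommRing k] [Ring R] [Algebra k R] [Ring U] [Algebra k U]
  {H : LeftBialgebroidData k R U}

theorem IsLeftBialgebroid.comul_one (hH : H.IsLeftBialgebroid) : H.comul 1 = H.tmul₂ 1 1 := by
  simpa using hH.comul_st 1 1

theorem IsLeftBialgebroid.counitLeft_comul (hH : H.IsLeftBialgebroid) (u : U) :
    H.counitLeft H.counit hH.counit_t_mul (H.comul u) = u := by
  obtain ⟨n, x, y, h⟩ := BalTensor.exists_rep (H.comul u)
  conv_rhs => rw [← hH.counit_left u n x y h]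
  rw [h, map_sum]
  exact Finset.sum_congr rfl fun i _ => H.counitLeft_tmul _ _ _ _

theorem IsLeftBialgebroid.counitRight_comul (hH : H.IsLeftBialgebroid) (u : U) :
    H.counitRight H.counit hH.counit_s_mul (H.comul u) = u := by
  obtain ⟨n, x, y, h⟩ := BalTensor.exists_rep (H.comul u)
  conv_rhs => rw [← hH.counit_right u n x y h]
  rw [h, map_sum]
  exact Finset.sum_congr rfl fun i _ => H.counitRight_tmul _ _ _ _

end LeftBialgebroidData

namespace EnvRing

variable {k R U : Type*} [CommRing k] [Ring R] [Algebra k R] [Ring U] [Algebra k U]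
  (E : EnvRing k R U)

theorem rmul_rmul (x y x' y' : U) (X : E.Tens₂) :
    E.rmul x' y' (E.rmul x y X) = E.rmul (x * x') (y * y') X := by
  induction X using BalTensor.induction with
  | mk u v => simp only [rmul_tmul, mul_assoc]
  | zero => simp
  | add X Y hX hY => simp only [map_add, hX, hY]

theorem rmul_one_one (X : E.Tens₂) : E.rmul 1 1 X = X := by
  induction X using BalTensor.induction with
  | mk u v => simp only [rmul_tmul, mul_one]
  | zero => simp
  | add X Y hX hY => simp only [map_add, hX, hY]

/-- Right multiplication `u ⊗ v ↦ u x ⊗ v y`, as a bilinear map in `x` and `y`. -/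
def rmulₗ (X : E.Tens₂) : U →ₗ[k] U →ₗ[k] E.Tens₂ :=
  LinearMap.mk₂ k (fun x y => E.rmul x y X)
    (fun x x' y => by
      induction X using BalTensor.induction with
      | mk u v => simp only [rmul_tmul, mul_add, map_add, LinearMap.add_apply]
      | zero => simp
      | add X Y hX hY => simp only [map_add, hX, hY]; abel)
    (fun c x y => by
      induction X using BalTensor.induction with
      | mk u v => simp only [rmul_tmul, mul_smul_comm, map_smul, LinearMap.smul_apply]
      | zero => simp
      | add X Y hX hY => simp only [map_add, hX, hY, smul_add])
    (fun x y y' => by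
      induction X using BalTensor.induction with
      | mk u v => simp only [rmul_tmul, mul_add, map_add]
      | zero => simp
      | add X Y hX hY => simp only [map_add, hX, hY]; abel)
    (fun c x y => by
      induction X using BalTensor.induction with
      | mk u v => simp only [rmul_tmul, mul_smul_comm, map_smul]
      | zero => simp
      | add X Y hX hY => simp only [map_add, hX, hY, smul_add])

theorem rmulₗ_apply (X : E.Tens₂) (x y : U) : E.rmulₗ X x y = E.rmul x y X := rfl

/-- `u t(r) ⊗ v s(r') = u ⊗ v s(r r')` in the Takeuchi product. -/
theorem rmul_t_s {X : E.Tens₂} (hX : ∀ r, E.rmul (E.t (op r)) 1 X = E.rmul 1 (E.s r) X) (r r' : R) :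
    E.rmul (E.t (op r)) (E.s r') X = E.rmul 1 (E.s (r * r')) X := by
  have := congrArg (E.rmul 1 (E.s r')) (hX r)
  simpa only [rmul_rmul, mul_one, one_mul, map_mul] using this

end EnvRing

/-! ### The coproduct of `Ũ` and its Takeuchi condition -/

namespace MoritaContext

variable {k R S P Q U M : Type*} [CommRing k] [Ring R] [Algebra k R] [Ring S]
  [Algebra k S] [AddCommGroup P] [Module k P] [Module S P] [Module Rᵐᵒᵖ P] [SMulCommClass S Rᵐᵒᵖ P]
  [IsScalarTower k S P] [IsScalarTower k Rᵐᵒᵖ P] [AddCommGroup Q] [Module k Q] [Module R Q]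
  [Module Sᵐᵒᵖ Q] [SMulCommClass R Sᵐᵒᵖ Q] [IsScalarTower k R Q] [IsScalarTower k Sᵐᵒᵖ Q]
  [Ring U] [Algebra k U] [AddCommGroup M] [Module k M]
  (C : MoritaContext k R S P Q) (E : EnvRing k R U)

/-- The trilinear map `(a, u, c) ↦ (a ⊗ bᵒ) ⊗ u ⊗ (c ⊗ dᵒ)`. -/
def tlFrame (b : Q) (d : P) : P →ₗ[k] U →ₗ[k] Q →ₗ[k] C.Tilde E :=
  LinearMap.mk₂ k (fun a u => C.tl E (a ⊗ₜ b) u ∘ₗ (TensorProduct.mk k Q P).flip d)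
    (fun _ _ _ => by ext; simp [TensorProduct.add_tmul])
    (fun _ _ _ => by ext; simp [← TensorProduct.smul_tmul'])
    (fun _ _ _ => by ext; simp)
    (fun _ _ _ => by ext; simp)

theorem tlFrame_apply (b : Q) (d : P) (a : P) (u : U) (c : Q) :
    C.tlFrame E b d a u c = C.tl E (a ⊗ₜ b) u (c ⊗ₜ d) := rfl

/-- Places the coproduct of `Ũ` under `thicken`, with `M = U` and `Y = Ũ`. -/
theorem isFramed_tlFrame (b : Q) (d : P) :
    C.IsFramed E.lS (C.tildeEnv E).lS (C.tlFrame E b d) where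
  smul x p u q := (C.s_mul_tl E x p b u (q ⊗ₜ d)).symm
  bal r p u q := (C.tl_s E r p b u (q ⊗ₜ d)).symm

/-- The map `u ⊗ v ↦ ∑ᵢ ((a ⊗ qᵢᵒ) ⊗ u ⊗ (c ⊗ p₀ᵒ)) ⊗_S ((pᵢ ⊗ bᵒ) ⊗ v ⊗ (q₀ ⊗ dᵒ))`, bilinear
in `p₀` and `q₀`. -/
def tlOpen (a : P) (b c : Q) (d : P) : E.Tens₂ →ₗ[k] P →ₗ[k] Q →ₗ[k] (C.tildeEnv E).Tens₂ :=
  BalTensor.lift (LinearMap.mk₂ k (fun u v => ∑ i, (C.tildeEnv E).tmul₂.compl₁₂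
      (C.tl E (a ⊗ₜ C.q i) u ∘ₗ TensorProduct.mk k Q P c) (C.tlFrame E b d (C.p i) v))
    (fun _ _ _ => by ext; simp [Finset.sum_add_distrib])
    (fun _ _ _ => by ext; simp [Finset.smul_sum])
    (fun _ _ _ => by ext; simp [Finset.sum_add_distrib])
    (fun _ _ _ => by ext; simp [Finset.smul_sum]))
    (fun r u v => LinearMap.ext fun p₀ => LinearMap.ext fun q₀ => by
      simp only [LinearMap.mk₂_apply, LinearMap.sum_apply, LinearMap.compl₁₂_apply,
        LinearMap.comp_apply, TensorProduct.mk_apply, EnvRing.lT_apply,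
        ← (C.isFramed_tlFrame E b d).bal]
      exact C.sum_legs E a u (c ⊗ₜ p₀) (((C.tlFrame E b d).flip v).flip q₀)
        (fun x p => (C.isFramed_tlFrame E b d).smul x p v q₀) r)

theorem tlOpen_tmul (a : P) (b c : Q) (d : P) (u v : U) (p₀ : P) (q₀ : Q) :
    C.tlOpen E a b c d (E.tmul₂ u v) p₀ q₀ = ∑ i, (C.tildeEnv E).tmul₂
      (C.tl E (a ⊗ₜ C.q i) u (c ⊗ₜ p₀)) (C.tl E (C.p i ⊗ₜ b) v (q₀ ⊗ₜ d)) := by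
  refine (LinearMap.congr_fun₂ (BalTensor.lift_mk _ _ _ _) p₀ q₀).trans ?_
  simp [tlFrame_apply]

/-- The point of `tlOpen`: the inner slots `p₀, q₀` stay free, so scalars can be moved through them
before they are contracted against `φ⁻¹(1)`. -/
theorem thicken_tlFrame (a : P) (b c : Q) (d : P) (X : E.Tens₂) :
    thicken E (C.isFramed_tlFrame E b d) a X c =
      ∑ j, C.tlOpen E a b c d X (C.p' j) (C.q' j) := by
  induction X using BalTensor.induction with
  | mk u v =>
    rw [thicken_tmul, Finset.sum_comm]
    exact Finset.sum_congr rfl fun j _ => (C.tlOpen_tmul E a b c d u v _ _).symm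
  | zero => simp
  | add X Y hX hY => simp only [map_add, LinearMap.add_apply, Finset.sum_add_distrib, hX, hY]

theorem tildeComulAux_eq_thicken (a : P) (b c : Q) (d : P) (X : E.Tens₂) :
    C.tildeComulAux E (a ⊗ₜ b) (c ⊗ₜ d) X = thicken E (C.isFramed_tlFrame E b d) a X c := by
  induction X using BalTensor.induction with
  | mk u v => rw [thicken_tmul, tildeComulAux_tmul, tildeComulBil_tmul]; rfl
  | zero => simp
  | add X Y hX hY => simp only [map_add, LinearMap.add_apply, hX, hY]

theorem tlOpen_rmul_t (a : P) (b c : Q) (d : P) (X : E.Tens₂) (r : R) (p₀ : P) (q₀ : Q) :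
    C.tlOpen E a b c d (E.rmul (E.t (op r)) 1 X) p₀ q₀ =
      C.tlOpen E a b c d X (op r • p₀) q₀ := by
  induction X using BalTensor.induction with
  | mk u v => rw [EnvRing.rmul_tmul, tlOpen_tmul, tlOpen_tmul]; simp only [tl_mul_t, mul_one]
  | zero => simp
  | add X Y hX hY => simp only [map_add, LinearMap.add_apply, hX, hY]

theorem tlOpen_rmul_s (a : P) (b c : Q) (d : P) (X : E.Tens₂) (r : R) (p₀ : P) (q₀ : Q) :
    C.tlOpen E a b c d (E.rmul 1 (E.s r) X) p₀ q₀ =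
      C.tlOpen E a b c d X p₀ (r • q₀) := by
  induction X using BalTensor.induction with
  | mk u v => rw [EnvRing.rmul_tmul, tlOpen_tmul, tlOpen_tmul]; simp only [tl_mul_s, mul_one]
  | zero => simp
  | add X Y hX hY => simp only [map_add, LinearMap.add_apply, hX, hY]

/-- Multiplying in `Ũ` on both legs consumes the free slots `p₀, q₀`: they pair with `b'` and `a''`,
and `d', c''` become the new free slots. -/
theorem rmul_tlOpen (a : P) (b c : Q) (d : P) (X : E.Tens₂) (p₀ : P) (q₀ : Q) (a' : P) (b' b'' : Q)
    (a'' : P) (v w : U) (c' c'' : Q) (d' d'' : P) :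
    (C.tildeEnv E).rmul (C.tl E (a' ⊗ₜ b') v (c' ⊗ₜ d')) (C.tl E (a'' ⊗ₜ b'') w (c'' ⊗ₜ d''))
      (C.tlOpen E a b c d X p₀ q₀) =
    C.tlOpen E a b c' d'' (E.rmul (E.eta (C.qp c a', C.qp b' p₀) * v)
      (E.eta (C.qp q₀ a'', C.qp b'' d) * w) X) d' c'' := by
  induction X using BalTensor.induction with
  | mk x y =>
    rw [tlOpen_tmul, EnvRing.rmul_tmul, tlOpen_tmul, map_sum]
    simp only [EnvRing.rmul_tmul, tl_mul_tl, pairU_tmul, mul_assoc]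
  | zero => simp
  | add X Y hX hY => simp only [map_add, LinearMap.add_apply, hX, hY]

variable {H : LeftBialgebroidData k R U} (hH : H.IsLeftBialgebroid)

theorem tildeComul_tl (a : P) (b : Q) (u : U) (c : Q) (d : P) :
    C.tildeComul hH (C.tl H.toEnvRing (a ⊗ₜ b) u (c ⊗ₜ d)) =
      thicken H.toEnvRing (C.isFramed_tlFrame H.toEnvRing b d) a (H.comul u) c :=
  (TriTensor.lift_mk _ _ _ _ _ _).trans (C.tildeComulAux_eq_thicken _ _ _ _ _ _)

theorem tildeComul_tl_open (a : P) (b : Q) (u : U) (c : Q) (d : P) :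
    C.tildeComul hH (C.tl H.toEnvRing (a ⊗ₜ b) u (c ⊗ₜ d)) =
      ∑ j, C.tlOpen H.toEnvRing a b c d (H.comul u) (C.p' j) (C.q' j) := by
  rw [tildeComul_tl, thicken_tlFrame]

theorem tildeCounit_tl (a : P) (b : Q) (u : U) (c : Q) (d : P) :
    C.tildeCounit hH (C.tl H.toEnvRing (a ⊗ₜ b) u (c ⊗ₜ d)) =
      C.pq a (H.counit (u * H.s (C.qp c d)) • b) :=
  TriTensor.lift_mk _ _ _ _ _ _

/-- The Takeuchi condition for `Δ(u)` is what makes the open coproduct `R`-balanced in its free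
slots, since `t(r)` on the first leg acts on `p₀` and `s(r)` on the second leg acts on `q₀`. -/
theorem tlOpen_comul_bal (hH : H.IsLeftBialgebroid) (a : P) (b c : Q) (d : P) (u : U) (r : R) (p₀ : P) (q₀ : Q) :
    C.tlOpen H.toEnvRing a b c d (H.comul u) (op r • p₀) q₀ =
      C.tlOpen H.toEnvRing a b c d (H.comul u) p₀ (r • q₀) := by
  rw [← tlOpen_rmul_t, hH.comul_takeuchi, tlOpen_rmul_s]

theorem rmul_tildeEnv_t_tlOpen (a : P) (b c : Q) (d : P) (X : E.Tens₂) (p₀ : P) (q₀ : Q) (y : S) :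
    (C.tildeEnv E).rmul ((C.tildeEnv E).t (op y)) 1 (C.tlOpen E a b c d X p₀ q₀) =
      C.tlOpen E a b c d X (y • p₀) q₀ := by
  induction X using BalTensor.induction with
  | mk u v =>
    rw [tlOpen_tmul, tlOpen_tmul, map_sum]
    simp only [EnvRing.rmul_tmul, tl_mul_tildeEnv_t, mul_one]
  | zero => simp
  | add X Y hX hY => simp only [map_add, LinearMap.add_apply, hX, hY]

theorem rmul_tildeEnv_s_tlOpen (a : P) (b c : Q) (d : P) (X : E.Tens₂) (p₀ : P) (q₀ : Q) (y : S) :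
    (C.tildeEnv E).rmul 1 ((C.tildeEnv E).s y) (C.tlOpen E a b c d X p₀ q₀) =
      C.tlOpen E a b c d X p₀ (op y • q₀) := by
  induction X using BalTensor.induction with
  | mk u v =>
    rw [tlOpen_tmul, tlOpen_tmul, map_sum]
    simp only [EnvRing.rmul_tmul, tl_mul_tildeEnv_s, mul_one]
  | zero => simp
  | add X Y hX hY => simp only [map_add, LinearMap.add_apply, hX, hY]

/-- `t̃(y)` and `s̃(y)` act on the inner slots by `y p'ⱼ` and `q'ⱼ y`; the two agree because
`φ⁻¹(1)` commutes with `S`, which may be used once the open coproduct is `R`-balanced. -/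
theorem tildeComul_takeuchi (x : C.Tilde H.toEnvRing) (y : S) :
    (C.tildeEnv H.toEnvRing).rmul ((C.tildeEnv H.toEnvRing).t (op y)) 1 (C.tildeComul hH x) =
      (C.tildeEnv H.toEnvRing).rmul 1 ((C.tildeEnv H.toEnvRing).s y) (C.tildeComul hH x) := by
  induction x using C.tilde_induction H.toEnvRing with
  | tl a b u c d =>
    simp only [tildeComul_tl_open, map_sum, rmul_tildeEnv_t_tlOpen, rmul_tildeEnv_s_tlOpen]
    exact C.sum_p'_q'_comm (C.tlOpen H.toEnvRing a b c d (H.comul u))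
      (fun r p q => C.tlOpen_comul_bal hH a b c d u r p q) y
  | zero => simp
  | add x y hx hy => simp only [map_add, hx, hy]

/-- Expand `q'ₘ ⊗_S p₀` as `∑ᵢ (q'ₘp₀)qᵢ ⊗ pᵢ`. The scalar passes through the middle factor `1` as
`t(r)` onto `p'ₘ`, and `∑ₘ p'ₘ(q'ₘp₀) = p₀`. This converts a tensor of two unit-like sums into a
coproduct, as needed for `Δ̃ ∘ η̃`. -/
theorem sum_tmul₂_tl_one (a : P) (b c : Q) (d p₀ : P) (q₀ : Q) :
    ∑ m, (C.tildeEnv E).tmul₂ (C.tl E (a ⊗ₜ C.q' m) 1 (c ⊗ₜ C.p' m))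
      (C.tl E (p₀ ⊗ₜ b) 1 (q₀ ⊗ₜ d)) = C.tlOpen E a b c d (E.tmul₂ 1 1) p₀ q₀ := by
  have h : ∀ m, (C.tildeEnv E).tmul₂ (C.tl E (a ⊗ₜ C.q' m) 1 (c ⊗ₜ C.p' m))
      (C.tl E (p₀ ⊗ₜ b) 1 (q₀ ⊗ₜ d)) = C.tlOpen E a b c d (E.tmul₂ 1 1)
        (op (C.qp (C.q' m) p₀) • C.p' m) q₀ := fun m => by
    refine (C.tmul_tl_eq_sum E (l := (C.tildeEnv E).lS) a (C.q' m) 1 (c ⊗ₜ C.p' m)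
      (((C.tlFrame E b d).flip 1).flip q₀)
      (fun x p => (C.isFramed_tlFrame E b d).smul x p 1 q₀) p₀).trans ?_
    rw [tlOpen_tmul]
    refine Finset.sum_congr rfl fun i _ => ?_
    rw [mul_one, ← C.tl_mul_t, one_mul]
    rfl
  simp only [h]
  rw [← LinearMap.sum_apply, ← map_sum, C.sum_p'_qp]

end MoritaContext

theorem sum_sum_comm {ι κ ι' κ' Y : Type*} [Fintype ι] [Fintype κ] [Fintype ι'] [Fintype κ']
    [AddCommMonoid Y] (f : ι → κ → ι' → κ' → Y) :
    ∑ i, ∑ j, ∑ i', ∑ j', f i j i' j' = ∑ i', ∑ j', ∑ i, ∑ j, f i j i' j' := by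
  have h : ∑ x : ι × κ, ∑ y : ι' × κ', f x.1 x.2 y.1 y.2 =
      ∑ y : ι' × κ', ∑ x : ι × κ, f x.1 x.2 y.1 y.2 := Finset.sum_comm
  simpa only [Fintype.sum_prod_type] using h

/-! ### `Ũ` is a left bialgebroid -/

namespace EnvRing

variable {k R U : Type*} [CommRing k] [Ring R] [Algebra k R] [Ring U] [Algebra k U]
  (E : EnvRing k R U)

/-- Right multiplication of an element `X` of the Takeuchi product by elements of `U_◃ ⊗_R ▹U`. -/
def rmulTens (X : E.Tens₂) (hX : ∀ r, E.rmul (E.t (op r)) 1 X = E.rmul 1 (E.s r) X) :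
    E.Tens₂ →ₗ[k] E.Tens₂ :=
  BalTensor.lift (E.rmulₗ X) (fun r x y => by
    have := congrArg (E.rmul x y) (hX r)
    simp only [rmul_rmul, one_mul] at this
    exact this)

theorem rmulTens_tmul (X : E.Tens₂) (hX : ∀ r, E.rmul (E.t (op r)) 1 X = E.rmul 1 (E.s r) X)
    (x y : U) : E.rmulTens X hX (E.tmul₂ x y) = E.rmul x y X :=
  BalTensor.lift_mk _ _ _ _

end EnvRing

namespace MoritaContext

variable {k R S P Q U M : Type*} [CommRing k] [Ring R] [Algebra k R] [Ring S]
  [Algebra k S] [AddCommGroup P] [Module k P] [Module S P] [Module Rᵐᵒᵖ P] [SMulCommClass S Rᵐᵒᵖ P]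
  [IsScalarTower k S P] [IsScalarTower k Rᵐᵒᵖ P] [AddCommGroup Q] [Module k Q] [Module R Q]
  [Module Sᵐᵒᵖ Q] [SMulCommClass R Sᵐᵒᵖ Q] [IsScalarTower k R Q] [IsScalarTower k Sᵐᵒᵖ Q]
  [Ring U] [Algebra k U] [AddCommGroup M] [Module k M]
  (C : MoritaContext k R S P Q) (E : EnvRing k R U)

variable {H : LeftBialgebroidData k R U} (hH : H.IsLeftBialgebroid)

theorem tildeComul_tildeEta (x y : S) :
    C.tildeComul hH (C.tildeEta H.toEnvRing x y) = (C.tildeEnv H.toEnvRing).tmul₂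
      (C.tildeEta H.toEnvRing x 1) (C.tildeEta H.toEnvRing 1 y) := by
  simp only [tildeEta, one_smul, map_sum, LinearMap.sum_apply, tildeComul_tl_open, hH.comul_one,
    ← C.sum_tmul₂_tl_one]
  refine Finset.sum_congr rfl fun i _ => ?_
  rw [Finset.sum_comm]
  refine Finset.sum_congr rfl fun l _ => ?_
  rw [Finset.sum_comm]

/-- Here both dual bases meet: the first legs contribute `t(qᵢp'ⱼ)`, the second legs `s(q'ⱼpᵢ)`. The
Takeuchi condition for `Δ(u)` moves the former to the second leg, and the resulting
`s((qᵢp'ⱼ)(q'ⱼpᵢ))` sum to `1`. Only `s(ca')` and `t(b'd)`, which come from the product in `Ũ`,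
remain. -/
theorem rmulTens_tlOpen (a : P) (b : Q) (u : U) (c : Q) (d : P) (a' : P) (b' c' : Q)
    (d' : P) (X : H.Tens₂) (p₀ : P) (q₀ : Q) :
    (C.tildeEnv H.toEnvRing).rmulTens _
        (C.tildeComul_takeuchi hH (C.tl H.toEnvRing (a ⊗ₜ b) u (c ⊗ₜ d)))
        (C.tlOpen H.toEnvRing a' b' c' d' X p₀ q₀) =
      C.tlOpen H.toEnvRing a b c' d' (H.rmulTens (H.rmul (H.s (C.qp c a')) (H.t (op (C.qp b' d)))
        (H.comul u)) (by
          intro r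
          have := congrArg (H.rmul (H.s (C.qp c a')) (H.t (op (C.qp b' d)))) (hH.comul_takeuchi u r)
          simpa only [EnvRing.rmul_rmul, mul_one, one_mul, H.comm] using this) X) p₀ q₀ := by
  induction X using BalTensor.induction with
  | mk v w =>
    rw [tlOpen_tmul, EnvRing.rmulTens_tmul]
    simp only [map_sum, EnvRing.rmulTens_tmul, tildeComul_tl_open, rmul_tlOpen]
    simp only [← map_sum, ← LinearMap.sum_apply]
    congr 3
    have h : ∀ (r r' : R), H.rmul (H.eta (C.qp c a', r) * v) (H.eta (r', C.qp b' d) * w) (H.comul u) =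
        H.rmul (H.s (C.qp c a') * v) (H.t (op (C.qp b' d)) * w)
          (H.rmulₗ (H.comul u) 1 (H.s (r * r'))) := fun r r' => by
      rw [EnvRing.rmulₗ_apply, ← EnvRing.rmul_t_s _ (hH.comul_takeuchi u), EnvRing.rmul_rmul]
      simp only [EnvRing.eta, mul_assoc]
      rw [← mul_assoc (H.s _) (H.t _), H.comm, mul_assoc]
    simp only [LinearMap.sum_apply, h]
    simp only [← map_sum, C.sum_sum_qp_mul_qp]
    rw [map_one H.s, EnvRing.rmulₗ_apply, EnvRing.rmul_one_one, EnvRing.rmul_rmul]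
  | zero => simp
  | add X Y hX hY => simp only [map_add, LinearMap.add_apply, hX, hY]

theorem tildeComul_mul (x y : C.Tilde H.toEnvRing) :
    C.tildeComul hH (x * y) = (C.tildeEnv H.toEnvRing).rmulTens _ (C.tildeComul_takeuchi hH x)
      (C.tildeComul hH y) := by
  induction y using C.tilde_induction H.toEnvRing with
  | zero => simp
  | add y y' hy hy' => simp only [mul_add, map_add, hy, hy']
  | tl a' b' v c' d' =>
    induction x using C.tilde_induction H.toEnvRing with
    | zero =>
      -- `rmulTens` carries a proof about `Δ̃(x)`, so its linearity in `x` is checked on pure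
      -- tensors in place of `Δ̃(y)`.
      refine (congrArg _ (zero_mul _)).trans ((map_zero _).trans (Eq.symm ?_))
      generalize C.tildeComul hH (C.tl H.toEnvRing (a' ⊗ₜ b') v (c' ⊗ₜ d')) = Z
      induction Z using BalTensor.induction with
      | mk v w => rw [EnvRing.rmulTens_tmul, map_zero, map_zero]
      | zero => simp
      | add X Y hX hY => rw [map_add, hX, hY, add_zero]
    | add x x' hx hx' =>
      rw [add_mul, map_add, hx, hx']
      generalize C.tildeComul hH (C.tl H.toEnvRing (a' ⊗ₜ b') v (c' ⊗ₜ d')) = Z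
      induction Z using BalTensor.induction with
      | mk v w => simp only [EnvRing.rmulTens_tmul, map_add]
      | zero => simp
      | add X Y hX hY => rw [map_add, map_add, map_add, ← hX, ← hY]; abel
    | tl a b u c d =>
      rw [tl_mul_tl, pairU_tmul, tildeComul_tl_open, C.tildeComul_tl_open hH a' b' v c' d', map_sum]
      refine Finset.sum_congr rfl fun l _ => ?_
      rw [rmulTens_tlOpen]
      congr 3
      -- What is left is multiplicativity of `Δ` for the product of `u` with `η(ca', b'd)v`.
      obtain ⟨n, x, y, h⟩ := BalTensor.exists_rep (H.comul v)
      rw [mul_assoc, hH.comul_mul _ _ _ _ _ (hH.comul_eta_mul _ _ v n x y h), h, map_sum]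
      simp only [EnvRing.rmulTens_tmul, EnvRing.rmul_rmul]

theorem tildeCounit_t_mul (y : S) (x : C.Tilde H.toEnvRing) :
    C.tildeCounit hH ((C.tildeEnv H.toEnvRing).t (op y) * x) = C.tildeCounit hH x * y := by
  induction x using C.tilde_induction H.toEnvRing with
  | zero => simp
  | add x x' hx hx' => simp only [mul_add, add_mul, map_add, hx, hx']
  | tl a b u c d => rw [t_mul_tl, tildeCounit_tl, tildeCounit_tl, smul_comm, pq_right]

theorem tildeCounit_s_mul (y : S) (x : C.Tilde H.toEnvRing) :
    C.tildeCounit hH ((C.tildeEnv H.toEnvRing).s y * x) = y * C.tildeCounit hH x := by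
  induction x using C.tilde_induction H.toEnvRing with
  | zero => simp
  | add x x' hx hx' => simp only [mul_add, map_add, hx, hx']
  | tl a b u c d => rw [s_mul_tl, tildeCounit_tl, tildeCounit_tl, pq_left]

/-- The counit gives `a ε(u s(cp₀)) qᵢ` in `S`, which acts on `pᵢ`; the factor `qᵢpᵢ` sums to `1`
and the rest is the contraction in `U`. The remaining scalar `cp₀` is used up when `p₀ ⊗ q₀` runs
over `p'ⱼ ⊗ q'ⱼ`. -/
theorem counitLeft_tlOpen (a : P) (b c : Q) (d : P) (X : H.Tens₂) (p₀ : P) (q₀ : Q) :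
    (C.tildeEnv H.toEnvRing).counitLeft (C.tildeCounit hH) (C.tildeCounit_t_mul hH) (C.tlOpen H.toEnvRing a b c d X p₀ q₀) =
      C.tl H.toEnvRing (a ⊗ₜ b)
        (H.counitLeft H.counit hH.counit_t_mul (H.rmul (H.s (C.qp c p₀)) 1 X)) (q₀ ⊗ₜ d) := by
  induction X using BalTensor.induction with
  | mk u v =>
    have h : ∀ i, (C.tildeEnv H.toEnvRing).counitLeft (C.tildeCounit hH) (C.tildeCounit_t_mul hH) ((C.tildeEnv H.toEnvRing).tmul₂
        (C.tl H.toEnvRing (a ⊗ₜ C.q i) u (c ⊗ₜ p₀)) (C.tl H.toEnvRing (C.p i ⊗ₜ b) v (q₀ ⊗ₜ d))) =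
        C.tlFrame H.toEnvRing b d (op (H.counit (u * H.s (C.qp c p₀)) * C.qp (C.q i) (C.p i)) • a)
          v q₀ := fun i => by
      refine ((C.tildeEnv H.toEnvRing).counitLeft_tmul _ _ _ _).trans ?_
      rw [tildeCounit_tl, s_mul_tl, C.pq_smul, C.qp_left, tlFrame_apply]
    rw [tlOpen_tmul, map_sum, Finset.sum_congr rfl fun i _ => h i]
    rw [← LinearMap.sum_apply, ← LinearMap.sum_apply, ← map_sum, ← Finset.sum_smul, ← Finset.op_sum,
      ← Finset.mul_sum, C.sum_qp, mul_one, EnvRing.rmul_tmul, H.counitLeft_tmul, tl_s, mul_one,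
      tlFrame_apply]
  | zero => simp
  | add X Y hX hY => simp only [map_add, LinearMap.add_apply, hX, hY]

/-- Mirror image of `counitLeft_tlOpen`; here `ε(v s(r)) = ε(v t(r))` is used to put the scalar
`q₀d` where right counitality of `U` can absorb it. -/
theorem counitRight_tlOpen (a : P) (b c : Q) (d : P) (X : H.Tens₂) (p₀ : P) (q₀ : Q) :
    (C.tildeEnv H.toEnvRing).counitRight (C.tildeCounit hH) (C.tildeCounit_s_mul hH) (C.tlOpen H.toEnvRing a b c d X p₀ q₀) =
      C.tl H.toEnvRing (a ⊗ₜ b)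
        (H.counitRight H.counit hH.counit_s_mul (H.rmul 1 (H.t (op (C.qp q₀ d))) X)) (c ⊗ₜ p₀) := by
  induction X using BalTensor.induction with
  | mk u v =>
    have h : ∀ i, (C.tildeEnv H.toEnvRing).counitRight (C.tildeCounit hH) (C.tildeCounit_s_mul hH) ((C.tildeEnv H.toEnvRing).tmul₂
        (C.tl H.toEnvRing (a ⊗ₜ C.q i) u (c ⊗ₜ p₀)) (C.tl H.toEnvRing (C.p i ⊗ₜ b) v (q₀ ⊗ₜ d))) =
        C.tl H.toEnvRing (a ⊗ₜ (C.qp (C.q i) (C.p i) • H.counit (v * H.s (C.qp q₀ d)) • b)) u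
          (c ⊗ₜ p₀) := fun i => by
      refine ((C.tildeEnv H.toEnvRing).counitRight_tmul _ _ _ _).trans ?_
      rw [tildeCounit_tl, t_mul_tl, ← C.qp_smul]
    rw [tlOpen_tmul, map_sum, Finset.sum_congr rfl fun i _ => h i]
    rw [← LinearMap.sum_apply, ← LinearMap.sum_apply, ← map_sum, ← TensorProduct.tmul_sum,
      ← Finset.sum_smul, C.sum_qp, one_smul, EnvRing.rmul_tmul, H.counitRight_tmul, tl_t, mul_one,
      hH.counit_mul_t]
  | zero => simp
  | add X Y hX hY => simp only [map_add, LinearMap.add_apply, hX, hY]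

theorem counitLeft_tildeComul (x : C.Tilde H.toEnvRing) :
    (C.tildeEnv H.toEnvRing).counitLeft (C.tildeCounit hH) (C.tildeCounit_t_mul hH) (C.tildeComul hH x) = x := by
  induction x using C.tilde_induction H.toEnvRing with
  | zero => simp
  | add x x' hx hx' => simp only [map_add, hx, hx']
  | tl a b u c d =>
    rw [tildeComul_tl_open, map_sum]
    simp only [counitLeft_tlOpen, ← hH.comul_mul_s, hH.counitLeft_comul, tl_mul_s]
    rw [← map_sum, ← TensorProduct.sum_tmul, C.sum_qp_q']

theorem counitRight_tildeComul (x : C.Tilde H.toEnvRing) :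
    (C.tildeEnv H.toEnvRing).counitRight (C.tildeCounit hH) (C.tildeCounit_s_mul hH) (C.tildeComul hH x) = x := by
  induction x using C.tilde_induction H.toEnvRing with
  | zero => simp
  | add x x' hx hx' => simp only [map_add, hx, hx']
  | tl a b u c d =>
    rw [tildeComul_tl_open, map_sum]
    simp only [counitRight_tlOpen, ← hH.comul_mul_t, hH.counitRight_comul, tl_mul_t]
    rw [← map_sum, ← TensorProduct.tmul_sum, C.sum_p'_qp]

theorem tildeCounit_tildeEta (x y : S) : C.tildeCounit hH (C.tildeEta H.toEnvRing x y) = x * y := by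
  simp only [tildeEta, map_sum, tildeCounit_tl, one_mul, hH.counit_s]
  rw [Finset.sum_comm]
  have h : ∀ j, ∑ i, C.pq (x • C.p' j) (C.qp (C.q' j) (y • C.p' i) • C.q' i) =
      x * C.pq (C.p' j) (C.q' j) * y := fun j => by
    rw [← map_sum]
    simp only [← C.qp_bal, C.sum_qp_q', C.pq_left, C.pq_right, mul_assoc]
  simp only [h, ← Finset.mul_sum, ← Finset.sum_mul, C.sum_pq, mul_one]

/-- The argument `a` of the counit axiom can be absorbed into `y`, so this form suffices. On
generators it is the axiom for `U`; the scalar `b'd`, which enters through `t`, is turned into a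
source by `ε(w t(r)) = ε(w s(r))`. -/
theorem tildeCounit_mul (x y : C.Tilde H.toEnvRing) :
    C.tildeCounit hH (x * y) =
      C.tildeCounit hH (x * (C.tildeEnv H.toEnvRing).s (C.tildeCounit hH y)) := by
  induction y using C.tilde_induction H.toEnvRing with
  | zero => simp
  | add y y' hy hy' => simp only [mul_add, map_add, hy, hy']
  | tl a' b' v c' d' =>
    induction x using C.tilde_induction H.toEnvRing with
    | zero => simp
    | add x x' hx hx' => simp only [add_mul, map_add, hx, hx']
    | tl a b u c d =>
      have h : H.counit (u * H.eta (C.qp c a', C.qp b' d) * v * H.s (C.qp c' d')) =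
          H.counit (u * H.s (C.qp c a' * (H.counit (v * H.s (C.qp c' d')) * C.qp b' d))) := by
        rw [hH.counit_mul, EnvRing.eta, mul_assoc, mul_assoc, ← H.comm, ← mul_assoc, ← mul_assoc,
          hH.counit_mul_t, mul_assoc, mul_assoc, map_mul H.s, map_mul H.s]
      rw [tl_mul_tl, pairU_tmul, tildeCounit_tl, tildeCounit_tl, tl_mul_tildeEnv_s, tildeCounit_tl,
        h, C.qp_bal, C.pq_smul, C.qp_right, C.qp_left]

/-- Both sides insert one dual basis pair at each of the two junctions and differ only in the order
of summation. -/
theorem assoc_thicken {Y : Type*} [AddCommGroup Y] [Module k Y] {lM : R → Module.End k M}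
    {l : S → Module.End k Y} {F : P →ₗ[k] M →ₗ[k] Q →ₗ[k] Y} (hF : C.IsFramed lM l F) (p : P)
    (X : E.Tens₂) (m : M) (q : Q) :
    ∑ i, ∑ j, (C.tildeEnv E).assoc l
        (thicken E (C.isFramed_tlFrame E (C.q i) (C.p' j)) p X q) (F (C.p i) m (C.q' j)) =
      thicken E (hF.thicken E) p (E.assoc lM X m) q := by
  induction X using BalTensor.induction with
  | mk u v =>
    rw [EnvRing.assoc_tmul, thicken_tmul]
    simp only [thicken_tmul, map_sum, LinearMap.sum_apply, EnvRing.assoc_tmul]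
    exact sum_sum_comm _
  | zero => simp
  | add X Y hX hY => simp only [map_add, LinearMap.add_apply, Finset.sum_add_distrib, hX, hY]

theorem tildeComul_t_mul (y : S) (x : C.Tilde H.toEnvRing) :
    C.tildeComul hH ((C.tildeEnv H.toEnvRing).t (op y) * x) =
      (C.tildeEnv H.toEnvRing).lmulT y (C.tildeComul hH x) := by
  induction x using C.tilde_induction H.toEnvRing with
  | zero => simp
  | add x x' hx hx' => simp only [mul_add, map_add, hx, hx']
  | tl a b u c d =>
    rw [t_mul_tl, tildeComul_tl, tildeComul_tl]
    generalize H.comul u = X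
    induction X using BalTensor.induction with
    | mk u v =>
      rw [thicken_tmul, thicken_tmul]
      simp only [map_sum, EnvRing.lmulT_tmul, tlFrame_apply, t_mul_tl]
    | zero => simp
    | add X Y hX hY => simp only [map_add, LinearMap.add_apply, hX, hY]

theorem tildeComul_s_mul (y : S) (x : C.Tilde H.toEnvRing) :
    C.tildeComul hH ((C.tildeEnv H.toEnvRing).s y * x) =
      (C.tildeEnv H.toEnvRing).lTens (C.tildeEnv H.toEnvRing).lS y (C.tildeComul hH x) := by
  induction x using C.tilde_induction H.toEnvRing with
  | zero => simp
  | add x x' hx hx' => simp only [mul_add, map_add, hx, hx']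
  | tl a b u c d =>
    rw [s_mul_tl, tildeComul_tl, tildeComul_tl, ((C.isFramed_tlFrame _ b d).thicken _).smul]

/-- Coassociativity passes from a coaction `c` on `M` to a coaction `c'` on `Y` that is given by
`thicken` on the elements `F p m q`. -/
theorem coassoc_framed {Y : Type*} [AddCommGroup Y] [Module k Y] {lM : R → Module.End k M}
    {l : S → Module.End k Y} {F : P →ₗ[k] M →ₗ[k] Q →ₗ[k] Y} (hF : C.IsFramed lM l F)
    (c : M →ₗ[k] H.Tens lM) (hc : ∀ r m, c (lM r m) = H.lTens lM r (c m))
    (c' : Y →ₗ[k] (C.tildeEnv H.toEnvRing).Tens l)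
    (hc' : ∀ x y, c' (l x y) = (C.tildeEnv H.toEnvRing).lTens l x (c' y))
    (h : ∀ p m q, c' (F p m q) = thicken H.toEnvRing hF p (c m) q) (p : P) (m : M) (q : Q)
    (hm : H.comulId lM H.comul hH.comul_t_mul (c m) = H.idCoact c hc (c m)) :
    (C.tildeEnv H.toEnvRing).comulId l (C.tildeComul hH) (C.tildeComul_t_mul hH) (c' (F p m q)) =
      (C.tildeEnv H.toEnvRing).idCoact c' hc' (c' (F p m q)) := by
  -- Twofold thickening intertwines `Δ ⊗ id` with `Δ̃ ⊗ id` and, in `h₂`, `id ⊗ c` with `id ⊗ c'`;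
  -- coassociativity of `c` is then thickened.
  have h₁ : ∀ X, (C.tildeEnv H.toEnvRing).comulId l (C.tildeComul hH) (C.tildeComul_t_mul hH)
      (thicken H.toEnvRing hF p X q) = thicken H.toEnvRing (hF.thicken H.toEnvRing) p
        (H.comulId lM H.comul hH.comul_t_mul X) q := fun X => by
    induction X using BalTensor.induction with
    | mk u m =>
      rw [thicken_tmul, EnvRing.comulId_tmul, ← assoc_thicken]
      simp only [map_sum, EnvRing.comulId_tmul, tildeComul_tl]
    | zero => simp
    | add X Y hX hY => simp only [map_add, LinearMap.add_apply, hX, hY]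
  have h₂ : ∀ X, (C.tildeEnv H.toEnvRing).idCoact c' hc'
      (thicken H.toEnvRing hF p X q) = thicken H.toEnvRing (hF.thicken H.toEnvRing) p
        (H.idCoact c hc X) q := fun X => by
    induction X using BalTensor.induction with
    | mk u m =>
      rw [thicken_tmul, EnvRing.idCoact_tmul, thicken_tmul]
      simp only [map_sum, EnvRing.idCoact_tmul, h]
    | zero => simp
    | add X Y hX hY => simp only [map_add, LinearMap.add_apply, hX, hY]
  rw [h, h₁, h₂, hm]

theorem tilde_isLeftBialgebroid : (C.tilde hH).IsLeftBialgebroid where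
  comul_takeuchi := C.tildeComul_takeuchi hH
  comul_st x y := by
    change C.tildeComul hH ((C.tildeEnv H.toEnvRing).s x * (C.tildeEnv H.toEnvRing).t (op y)) = _
    rw [tildeEnv_eta, tildeComul_tildeEta]
    rfl
  comul_mul u v n x y h := by
    refine (C.tildeComul_mul hH u v).trans ?_
    refine (congrArg _ h).trans ?_
    refine (map_sum _ _ _).trans ?_
    exact Finset.sum_congr rfl fun i _ => EnvRing.rmulTens_tmul _ _ _ _ _
  coassoc u := by
    refine ((C.tildeEnv H.toEnvRing).coassoc_iff (C.tildeComul hH) (C.tildeComul_t_mul hH)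
      (C.tildeComul hH) (C.tildeComul_s_mul hH) u).2 ?_
    induction u using C.tilde_induction H.toEnvRing with
    | zero => simp
    | add x x' hx hx' => simp only [map_add, hx, hx']
    | tl a b u c d =>
      exact C.coassoc_framed hH (C.isFramed_tlFrame _ b d) H.comul hH.comul_s_mul _ _
        (fun p m q => C.tildeComul_tl hH p b m q d) a u c
        ((H.coassoc_iff H.comul hH.comul_t_mul H.comul hH.comul_s_mul u).1 (hH.coassoc u))
  counit_left u n x y h := by
    refine Eq.trans ?_ (C.counitLeft_tildeComul hH u)
    refine Eq.trans ?_ ((map_sum _ _ _).symm.trans (congrArg _ h.symm))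
    exact Finset.sum_congr rfl fun i _ => (EnvRing.counitLeft_tmul _ _ _ _ _).symm
  counit_right u n x y h := by
    refine Eq.trans ?_ (C.counitRight_tildeComul hH u)
    refine Eq.trans ?_ ((map_sum _ _ _).symm.trans (congrArg _ h.symm))
    exact Finset.sum_congr rfl fun i _ => (EnvRing.counitRight_tmul _ _ _ _ _).symm
  counit_st x y a := by
    change C.tildeCounit hH ((C.tildeEnv H.toEnvRing).s x * (C.tildeEnv H.toEnvRing).t (op y) *
      (C.tildeEnv H.toEnvRing).s a) = _
    rw [mul_assoc, ← (C.tildeEnv H.toEnvRing).comm, ← mul_assoc, ← map_mul, tildeEnv_eta,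
      tildeCounit_tildeEta]
  counit_mul u v a := by
    change C.tildeCounit hH (u * v * (C.tildeEnv H.toEnvRing).s a) = C.tildeCounit hH
      (u * (C.tildeEnv H.toEnvRing).s (C.tildeCounit hH (v * (C.tildeEnv H.toEnvRing).s a)))
    rw [mul_assoc, tildeCounit_mul]

end MoritaContext

/-! ### `M̃` is a left `Ũ`-comodule -/

namespace MoritaContext

variable {k R S P Q U M : Type*} [CommRing k] [Ring R] [Algebra k R] [Ring S]
  [Algebra k S] [AddCommGroup P] [Module k P] [Module S P] [Module Rᵐᵒᵖ P] [SMulCommClass S Rᵐᵒᵖ P]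
  [IsScalarTower k S P] [IsScalarTower k Rᵐᵒᵖ P] [AddCommGroup Q] [Module k Q] [Module R Q]
  [Module Sᵐᵒᵖ Q] [SMulCommClass R Sᵐᵒᵖ Q] [IsScalarTower k R Q] [IsScalarTower k Sᵐᵒᵖ Q]
  [Ring U] [Algebra k U] [AddCommGroup M] [Module k M]
  (C : MoritaContext k R S P Q) (E : EnvRing k R U)

variable {H : LeftBialgebroidData k R U} (hH : H.IsLeftBialgebroid) (N : H.LeftComoduleData M)

theorem tildeLact_cd (x : S) (p : P) (m : M) (q : Q) :
    C.tildeLact hH N x (C.cd hH N p m q) = C.cd hH N (x • p) m q :=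
  C.tildeLactAux_cd hH N x p m q

theorem cd_lact (p : P) (r : R) (m : M) (q : Q) :
    C.cd hH N p (N.lact r m) q = C.cd hH N (op r • p) m q :=
  (TriTensor.mk_left C.rP _ _ C.lQ r p m q).symm

theorem cd_coRight (p : P) (r : R) (m : M) (q : Q) :
    C.cd hH N p (LeftBialgebroidData.coRight hH N r m) q = C.cd hH N p m (r • q) :=
  TriTensor.mk_right C.rP _ _ C.lQ r p m q

theorem isFramed_cd :
    C.IsFramed (fun r => N.lact r) (fun x => C.tildeLact hH N x) (C.cd hH N) where
  smul x p m q := (C.tildeLact_cd hH N x p m q).symm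
  bal r p m q := (C.cd_lact hH N p r m q).symm

variable (hN : N.IsLeftComodule)

theorem tildeCoact_cd (p : P) (m : M) (q : Q) :
    C.tildeCoact hH N hN (C.cd hH N p m q) =
      thicken H.toEnvRing (C.isFramed_cd hH N) p (N.coact m) q := by
  refine (TriTensor.lift_mk _ _ _ _ _ _).trans ?_
  change C.tildeCoactAux hH N p q (N.coact m) = _
  generalize N.coact m = X
  induction X using BalTensor.induction with
  | mk u m => rw [thicken_tmul, tildeCoactAux_tmul]
  | zero => simp
  | add X Y hX hY => simp only [map_add, LinearMap.add_apply, hX, hY]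

theorem tildeCoact_lact (x : S) (y : C.ComTilde hH N) :
    C.tildeCoact hH N hN (C.tildeLact hH N x y) =
      (C.tildeEnv H.toEnvRing).lTens (fun x => C.tildeLact hH N x) x (C.tildeCoact hH N hN y) := by
  induction y using TriTensor.induction with
  | mk p m q =>
    rw [tildeLact_cd, tildeCoact_cd, tildeCoact_cd, ((C.isFramed_cd hH N).thicken _).smul]
  | zero => simp
  | add y y' hy hy' => simp only [map_add, hy, hy']

/-- The counit contracts `qᵢ` with `pᵢ` and leaves one scalar `(qx)p'ⱼ` inside the counit of `U`,
with `q'ⱼ` outside. -/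
theorem counitTens_thicken (x : S) (p : P) (X : H.Tens (fun r => N.lact r)) (q : Q) :
    (C.tildeEnv H.toEnvRing).counitTens (C.tildeCounit hH) (C.tildeCounit_t_mul hH)
        (C.tildeLact hH N) x (thicken H.toEnvRing (C.isFramed_cd hH N) p X q) =
      ∑ j, C.cd hH N p (H.counitTens H.counit hH.counit_t_mul N.lact (C.qp (op x • q) (C.p' j)) X)
        (C.q' j) := by
  induction X using BalTensor.induction with
  | mk u m =>
    rw [thicken_tmul, Finset.sum_comm, map_sum]
    refine Finset.sum_congr rfl fun j _ => ?_
    rw [map_sum, EnvRing.counitTens_tmul, cd_lact]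
    simp only [EnvRing.counitTens_tmul, tl_mul_tildeEnv_s, tildeCounit_tl, tildeLact_cd,
      C.pq_smul, C.qp_left]
    rw [← LinearMap.sum_apply, ← LinearMap.sum_apply, ← map_sum, ← Finset.sum_smul, ← Finset.op_sum,
      ← Finset.mul_sum, C.sum_qp, mul_one]
  | zero => simp
  | add X Y hX hY => simp only [map_add, LinearMap.add_apply, Finset.sum_add_distrib, hX, hY]

/-- The scalar `(qx)p'ⱼ` acts on `m` from the right, hence on `q'ⱼ` from the left, and the sum is
`qx`. For `x = 1` this is counitality; in general it identifies the right `S`-action induced by the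
coaction with the obvious one on `Q`. -/
theorem counitTens_tildeCoact (x : S) (p : P) (m : M) (q : Q) :
    (C.tildeEnv H.toEnvRing).counitTens (C.tildeCounit hH) (C.tildeCounit_t_mul hH)
        (C.tildeLact hH N) x (C.tildeCoact hH N hN (C.cd hH N p m q)) =
      C.cd hH N p m (op x • q) := by
  rw [tildeCoact_cd, counitTens_thicken]
  simp only [← LeftBialgebroidData.coRight_eq hH N, cd_coRight, ← map_sum, C.sum_qp_q']

theorem tildeComodule_isLeftComodule : (C.tildeComodule hH N hN).IsLeftComodule where
  coact_lact := C.tildeCoact_lact hH N hN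
  coassoc y := by
    refine ((C.tildeEnv H.toEnvRing).coassoc_iff (C.tildeComul hH) (C.tildeComul_t_mul hH)
      (C.tildeCoact hH N hN) (C.tildeCoact_lact hH N hN) y).2 ?_
    induction y using TriTensor.induction with
    | zero => simp
    | add x x' hx hx' => simp only [map_add, hx, hx']
    | mk p m q =>
      exact C.coassoc_framed hH (C.isFramed_cd hH N) N.coact hN.coact_lact _ _
        (C.tildeCoact_cd hH N hN) p m q
        ((H.coassoc_iff H.comul hH.comul_t_mul N.coact hN.coact_lact m).1 (hN.coassoc m))
  counit y n x z h := by
    have key : ∀ y, (C.tildeEnv H.toEnvRing).counitTens (C.tildeCounit hH)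
        (C.tildeCounit_t_mul hH) (C.tildeLact hH N) 1 (C.tildeCoact hH N hN y) = y := fun y => by
      induction y using TriTensor.induction with
      | zero => simp
      | add x x' hx hx' => simp only [map_add, hx, hx']
      | mk p m q => rw [counitTens_tildeCoact, op_one, one_smul]
    refine Eq.trans ?_ (key y)
    refine Eq.trans ?_ ((map_sum _ _ _).symm.trans (congrArg _ h.symm))
    refine Finset.sum_congr rfl fun i _ => ?_
    refine Eq.trans ?_ (EnvRing.counitTens_tmul _ _ _ _ _ _ _).symm
    rw [map_one, mul_one]
    rfl

theorem coRight_tildeComodule (hU : (C.tilde hH).IsLeftBialgebroid) (x : S) (p : P) (m : M) (q : Q) :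
    LeftBialgebroidData.coRight hU (C.tildeComodule hH N hN) x (C.cd hH N p m q) =
      C.cd hH N p m (op x • q) :=
  C.counitTens_tildeCoact hH N hN x p m q

end MoritaContext

/-! ### The Galois map and the left Hopf property of `Ũ` -/

namespace EnvRing

variable {k R U : Type*} [CommRing k] [Ring R] [Algebra k R] [Ring U] [Algebra k U]
  (E : EnvRing k R U)

/-- `U ⊗_{Rᵒ} U = (U ⊗ U) / (u t(r) ⊗ v - u ⊗ t(r) v)`. -/
abbrev TensOp : Type _ := BalTensor E.rT E.lT

/-- The pure tensor `u ⊗ v` in `U ⊗_{Rᵒ} U`. -/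
abbrev tmulOp : U →ₗ[k] U →ₗ[k] E.TensOp := BalTensor.mk E.rT E.lT

theorem tmulOp_bal (r : R) (u v : U) :
    E.tmulOp (u * E.t (op r)) v = E.tmulOp u (E.t (op r) * v) :=
  BalTensor.mk_bal E.rT E.lT r u v

/-- The Galois map `u ⊗ v ↦ u₍₁₎ ⊗ u₍₂₎ v` of a coproduct `δ`. -/
def galoisMap (δ : U →ₗ[k] E.Tens₂) (hδ : ∀ u r, δ (u * E.t (op r)) = E.rmul 1 (E.t (op r)) (δ u)) :
    E.TensOp →ₗ[k] E.Tens₂ :=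
  BalTensor.lift (LinearMap.mk₂ k (fun u v => E.rmulₗ (δ u) 1 v)
    (fun u u' v => by simp only [rmulₗ_apply, map_add])
    (fun c u v => by simp only [rmulₗ_apply, map_smul])
    (fun u v v' => map_add _ _ _)
    (fun c u v => map_smul _ _ _))
    (fun r u v => by
      simp only [LinearMap.mk₂_apply, rmulₗ_apply, rT_apply, lT_apply, hδ, rmul_rmul, one_mul])

theorem galoisMap_tmul (δ : U →ₗ[k] E.Tens₂)
    (hδ : ∀ u r, δ (u * E.t (op r)) = E.rmul 1 (E.t (op r)) (δ u)) (u v : U) :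
    E.galoisMap δ hδ (E.tmulOp u v) = E.rmul 1 v (δ u) :=
  BalTensor.lift_mk _ _ _ _

end EnvRing

namespace LeftBialgebroidData

variable {k R U : Type*} [CommRing k] [Ring R] [Algebra k R] [Ring U] [Algebra k U]
  {H : LeftBialgebroidData k R U}

/-- A linear map on `U ⊗_{Rᵒ} U` is determined by pure tensors, so the map in the Hopf property must
be `galoisMap`. -/
theorem IsLeftHopfAlgebroid.galoisMap_bijective (hH : H.IsLeftHopfAlgebroid) :
    Function.Bijective (H.galoisMap H.comul hH.toIsLeftBialgebroid.comul_mul_t) := by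
  obtain ⟨β, hβ, hb⟩ := hH.hopf
  have h : H.galoisMap H.comul hH.toIsLeftBialgebroid.comul_mul_t = β :=
    BalTensor.hom_ext fun u v => (H.galoisMap_tmul _ _ u v).trans (hβ u v).symm
  rwa [h]

end LeftBialgebroidData

namespace MoritaContext

variable {k R S P Q U M : Type*} [CommRing k] [Ring R] [Algebra k R] [Ring S]
  [Algebra k S] [AddCommGroup P] [Module k P] [Module S P] [Module Rᵐᵒᵖ P] [SMulCommClass S Rᵐᵒᵖ P]
  [IsScalarTower k S P] [IsScalarTower k Rᵐᵒᵖ P] [AddCommGroup Q] [Module k Q] [Module R Q]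
  [Module Sᵐᵒᵖ Q] [SMulCommClass R Sᵐᵒᵖ Q] [IsScalarTower k R Q] [IsScalarTower k Sᵐᵒᵖ Q]
  [Ring U] [Algebra k U] [AddCommGroup M] [Module k M]
  (C : MoritaContext k R S P Q) (E : EnvRing k R U)

/-- The identity `∑ᵢⱼ (qᵢp'ⱼ)(q'ⱼpᵢ) = 1` with its two factors on the two sides of `⊗_R`. -/
theorem sum_tmul_collapse (l : R → Module.End k M) (u : U) (m : M) :
    ∑ i, ∑ j, E.tmul l (E.t (op (C.qp (C.q i) (C.p' j))) * u) (l (C.qp (C.q' j) (C.p i)) m) =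
      E.tmul l u m := by
  simp only [← E.tmul_bal, ← mul_assoc, ← map_mul E.t, ← op_mul]
  simp only [← LinearMap.sum_apply, ← map_sum, ← Finset.sum_mul, ← Finset.op_sum,
    C.sum_sum_qp_mul_qp, op_one, map_one, one_mul]

/-- The compression map, linear in its first argument. -/
def compressₗ (α₀ : P ⊗[k] Q) : Q ⊗[k] P →ₗ[k] C.Tilde E →ₗ[k] U where
  toFun γ₀ := C.compress E γ₀ α₀
  map_add' γ γ' := TriTensor.hom_ext fun α u δ => by
    change C.compress E _ _ (C.tl E α u δ) = C.compress E _ _ (C.tl E α u δ) +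
      C.compress E _ _ (C.tl E α u δ)
    simp only [compress_tl, map_add, LinearMap.add_apply, add_mul]
  map_smul' c γ := TriTensor.hom_ext fun α u δ => by
    change C.compress E _ _ (C.tl E α u δ) = c • C.compress E _ _ (C.tl E α u δ)
    simp only [compress_tl, map_smul, LinearMap.smul_apply, smul_mul_assoc]

theorem compressₗ_tl (α₀ : P ⊗[k] Q) (q : Q) (p a : P) (b : Q) (u : U) (γ : Q ⊗[k] P) :
    C.compressₗ E α₀ (q ⊗ₜ p) (C.tl E (a ⊗ₜ b) u γ) =
      E.eta (C.qp q a, C.qp b p) * u * C.pairU E γ α₀ := by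
  rw [← pairU_tmul]
  exact C.compress_tl E _ _ _ _ _

/-- This and the next three rules let `s̃, t̃` act on the compressing element from one side and `s,
t` come out of it on the other; they are what makes compression descend to a map from `Ũ ⊗_S Y` to
`U ⊗_R M`. -/
theorem compressₗ_t_mul (α₀ : P ⊗[k] Q) (q : Q) (p : P) (x : S) (z : C.Tilde E) :
    C.compressₗ E α₀ (q ⊗ₜ p) ((C.tildeEnv E).t (op x) * z) =
      C.compressₗ E α₀ (q ⊗ₜ (x • p)) z := by
  induction z using C.tilde_induction E with
  | zero => simp
  | add z z' h h' => simp only [mul_add, map_add, h, h']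
  | tl a b u c d => rw [t_mul_tl, compressₗ_tl, compressₗ_tl, C.qp_bal]

theorem compressₗ_s_mul (α₀ : P ⊗[k] Q) (q : Q) (p : P) (x : S) (z : C.Tilde E) :
    C.compressₗ E α₀ (q ⊗ₜ p) ((C.tildeEnv E).s x * z) =
      C.compressₗ E α₀ ((op x • q) ⊗ₜ p) z := by
  induction z using C.tilde_induction E with
  | zero => simp
  | add z z' h h' => simp only [mul_add, map_add, h, h']
  | tl a b u c d => rw [s_mul_tl, compressₗ_tl, compressₗ_tl, C.qp_bal]

theorem compressₗ_smul (α₀ : P ⊗[k] Q) (q : Q) (p : P) (r : R) (z : C.Tilde E) :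
    C.compressₗ E α₀ ((r • q) ⊗ₜ p) z = E.s r * C.compressₗ E α₀ (q ⊗ₜ p) z := by
  induction z using C.tilde_induction E with
  | zero => simp
  | add z z' h h' => simp only [mul_add, map_add, h, h']
  | tl a b u c d =>
    rw [compressₗ_tl, compressₗ_tl, C.qp_left]
    simp only [EnvRing.eta, map_mul, mul_assoc]

theorem compressₗ_op_smul (α₀ : P ⊗[k] Q) (q : Q) (p : P) (r : R) (z : C.Tilde E) :
    C.compressₗ E α₀ (q ⊗ₜ (op r • p)) z = E.t (op r) * C.compressₗ E α₀ (q ⊗ₜ p) z := by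
  induction z using C.tilde_induction E with
  | zero => simp
  | add z z' h h' => simp only [mul_add, map_add, h, h']
  | tl a b u c d =>
    rw [compressₗ_tl, compressₗ_tl, C.qp_right]
    simp only [EnvRing.eta, E.comm]
    simp only [op_mul, map_mul, mul_assoc]

section Compress

variable {Y : Type*} [AddCommGroup Y] [Module k Y] {lM : R → Module.End k M}
  {l : S → Module.End k Y} (g : Q →ₗ[k] Y →ₗ[k] M)
  (hl : ∀ x q y, g (op x • q) y = g q (l x y)) (hr : ∀ r q y, g (r • q) y = lM r (g q y))

/-- The map `ũ ⊗_S y ↦ ∑ⱼ ((q₁ ⊗ p'ⱼ) ũ α₀) ⊗_R g q'ⱼ y` from `Ũ ⊗_S Y` to `U ⊗_R M`. -/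
def compressTens (q₁ : Q) (α₀ : P ⊗[k] Q) : (C.tildeEnv E).Tens l →ₗ[k] E.Tens lM :=
  BalTensor.lift (∑ j, (E.tmul lM).compl₁₂ (C.compressₗ E α₀ (q₁ ⊗ₜ C.p' j)) (g (C.q' j)))
    (fun x z y => by
      simp only [LinearMap.sum_apply, LinearMap.compl₁₂_apply, EnvRing.lT_apply, compressₗ_t_mul,
        ← hl]
      exact C.sum_p'_q'_comm ((E.tmul lM).compl₁₂
        (((C.compressₗ E α₀).flip z) ∘ₗ TensorProduct.mk k Q P q₁) (g.flip y)) (fun r p q => by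
          simp only [LinearMap.compl₁₂_apply, LinearMap.comp_apply, LinearMap.flip_apply,
            TensorProduct.mk_apply, compressₗ_op_smul, hr, EnvRing.tmul_bal]) x)

theorem compressTens_tmul (q₁ : Q) (α₀ : P ⊗[k] Q) (z : C.Tilde E) (y : Y) :
    C.compressTens E g hl hr q₁ α₀ ((C.tildeEnv E).tmul l z y) =
      ∑ j, E.tmul lM (C.compressₗ E α₀ (q₁ ⊗ₜ C.p' j) z) (g (C.q' j) y) := by
  refine (BalTensor.lift_mk _ _ _ _).trans ?_
  simp only [LinearMap.sum_apply, LinearMap.compl₁₂_apply]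

/-- Compression contracts the inserted `qᵢ ⊗ pᵢ` against its own `p'ⱼ ⊗ q'ⱼ`, and the sum collapses
by `sum_tmul_collapse`. -/
theorem compressTens_sum (q₁ : Q) (α₀ : P ⊗[k] Q) (a : P) (u : U) (γ : Q ⊗[k] P) (f : P → Y) (m : M)
    (hf : ∀ q p, g q (f p) = lM (C.qp q p) m) :
    C.compressTens E g hl hr q₁ α₀
        (∑ i, (C.tildeEnv E).tmul l (C.tl E (a ⊗ₜ C.q i) u γ) (f (C.p i))) =
      E.tmul lM (E.s (C.qp q₁ a) * u * C.pairU E γ α₀) m := by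
  rw [map_sum, ← C.sum_tmul_collapse]
  simp only [compressTens_tmul, compressₗ_tl, hf, EnvRing.eta, E.comm, mul_assoc]

end Compress

/-- The compression of `Ũ ⊗_S Ũ` to `U ⊗_R U`. -/
def compressTens₂ (q₁ : Q) (p₁ : P) (α₀ α₁ : P ⊗[k] Q) : (C.tildeEnv E).Tens₂ →ₗ[k] E.Tens₂ :=
  C.compressTens E (lM := E.lS) (l := (C.tildeEnv E).lS)
    (C.compressₗ E α₁ ∘ₗ (TensorProduct.mk k Q P).flip p₁)
    (fun x q y => (C.compressₗ_s_mul E α₁ q p₁ x y).symm)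
    (fun r q y => C.compressₗ_smul E α₁ q p₁ r y) q₁ α₀

/-- Compression undoes opening up to multiplication by scalars on the outer sides of both legs; with
dual bases in the outer slots these scalars rebuild the original elements of `P` and `Q`. -/
theorem compressTens₂_tlOpen (q₁ : Q) (p₁ p₂ : P) (q₂ : Q) (p₃ : P) (q₃ : Q) (a : P) (b c : Q)
    (d : P) (X : E.Tens₂) (p₀ : P) (q₀ : Q) :
    C.compressTens₂ E q₁ p₁ (p₂ ⊗ₜ q₂) (p₃ ⊗ₜ q₃) (C.tlOpen E a b c d X p₀ q₀) =
      E.lTens E.lS (C.qp q₁ a) (E.lmulT (C.qp b p₁)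
        (E.rmul (E.eta (C.qp c p₂, C.qp q₂ p₀)) (E.eta (C.qp q₀ p₃, C.qp q₃ d)) X)) := by
  induction X using BalTensor.induction with
  | mk u v =>
    rw [tlOpen_tmul, EnvRing.rmul_tmul, EnvRing.lmulT_tmul, EnvRing.lTens_tmul]
    refine (C.compressTens_sum E (lM := E.lS) _ _ _ q₁ (p₂ ⊗ₜ q₂) a u (c ⊗ₜ p₀)
      (fun p => C.tl E (p ⊗ₜ b) v (q₀ ⊗ₜ d))
      (E.t (op (C.qp b p₁)) * (v * E.eta (C.qp q₀ p₃, C.qp q₃ d))) fun q p => ?_).trans ?_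
    · rw [LinearMap.comp_apply, LinearMap.flip_apply, TensorProduct.mk_apply, compressₗ_tl,
        pairU_tmul, EnvRing.lS_apply]
      simp only [EnvRing.eta, mul_assoc]
    · rw [pairU_tmul, mul_assoc]
  | zero => simp
  | add X Y hX hY => simp only [map_add, LinearMap.add_apply, hX, hY]

/-- For fixed `α, u, c, d, v, γ` the expression `(α ⊗ u ⊗ (c ⊗ pᵒ)) ⊗ ((d ⊗ qᵒ) ⊗ v ⊗ γ)` as a
bilinear map in `q` and `p`. -/
def legsOp (α : P ⊗[k] Q) (u : U) (c : Q) (d : P) (v : U) (γ : Q ⊗[k] P) :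
    Q →ₗ[k] P →ₗ[k] (C.tildeEnv E).TensOp :=
  ((C.tildeEnv E).tmulOp.compl₁₂ (C.tl E α u ∘ₗ TensorProduct.mk k Q P c)
    (((C.tl E).flip v).flip γ ∘ₗ TensorProduct.mk k P Q d)).flip

theorem legsOp_apply (α : P ⊗[k] Q) (u : U) (c : Q) (d : P) (v : U) (γ : Q ⊗[k] P) (q : Q) (p : P) :
    C.legsOp E α u c d v γ q p =
      (C.tildeEnv E).tmulOp (C.tl E α u (c ⊗ₜ p)) (C.tl E (d ⊗ₜ q) v γ) := rfl

theorem legsOp_bal (α : P ⊗[k] Q) (u : U) (c : Q) (d : P) (v : U) (γ : Q ⊗[k] P) (x : S) (q : Q)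
    (p : P) : C.legsOp E α u c d v γ (op x • q) p = C.legsOp E α u c d v γ q (x • p) := by
  rw [legsOp_apply, legsOp_apply, ← tl_mul_tildeEnv_t, ← t_mul_tl, EnvRing.tmulOp_bal]

/-- The map `u ⊗ v ↦ ∑ᵢ ((a ⊗ bᵒ) ⊗ u ⊗ (c ⊗ pᵢᵒ)) ⊗ ((d ⊗ qᵢᵒ) ⊗ v ⊗ γ)` from `U ⊗_{Rᵒ} U` to
`Ũ ⊗_{Sᵒ} Ũ`. -/
def thickenOp (α : P ⊗[k] Q) (c : Q) (d : P) (γ : Q ⊗[k] P) :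
    E.TensOp →ₗ[k] (C.tildeEnv E).TensOp :=
  BalTensor.lift (∑ i, (C.tildeEnv E).tmulOp.compl₁₂ ((C.tl E α).flip (c ⊗ₜ C.p i))
      ((C.tl E (d ⊗ₜ C.q i)).flip γ))
    (fun r u v => by
      simp only [LinearMap.sum_apply, LinearMap.compl₁₂_apply, LinearMap.flip_apply,
        EnvRing.rT_apply, EnvRing.lT_apply, tl_mul_t, tl_t]
      exact (C.sum_q_p_comm (C.legsOp E α u c d v γ) (C.legsOp_bal E α u c d v γ) r).symm)

theorem thickenOp_tmul (α : P ⊗[k] Q) (c : Q) (d : P) (γ : Q ⊗[k] P) (u v : U) :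
    C.thickenOp E α c d γ (E.tmulOp u v) = ∑ i, (C.tildeEnv E).tmulOp
      (C.tl E α u (c ⊗ₜ C.p i)) (C.tl E (d ⊗ₜ C.q i) v γ) := by
  refine (BalTensor.lift_mk _ _ _ _).trans ?_
  simp only [LinearMap.sum_apply, LinearMap.compl₁₂_apply, LinearMap.flip_apply]

/-- Every pure tensor of `Ũ ⊗_{Sᵒ} Ũ` is a thickening, by `b' ⊗_S d = ∑ᵢ (b'd)qᵢ ⊗ pᵢ`; the Galois
map of `Ũ` thus needs to be known on thickenings only. -/
theorem tmulOp_tl_eq_thickenOp (α : P ⊗[k] Q) (u : U) (c : Q) (d a' : P) (b' : Q) (v : U)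
    (γ : Q ⊗[k] P) :
    (C.tildeEnv E).tmulOp (C.tl E α u (c ⊗ₜ d)) (C.tl E (a' ⊗ₜ b') v γ) =
      C.thickenOp E α c a' γ (E.tmulOp u (E.t (op (C.qp b' d)) * v)) := by
  rw [thickenOp_tmul]
  refine (C.eq_sum_q_p (C.legsOp E α u c a' v γ) (C.legsOp_bal E α u c a' v γ) b' d).trans ?_
  simp only [legsOp_apply, tl_t]

theorem rmul_one_tlOpen (a : P) (b c : Q) (d : P) (X : E.Tens₂) (p₀ : P) (q₀ : Q) (a' : P) (b' : Q)
    (w : U) (c' : Q) (d' : P) :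
    (C.tildeEnv E).rmul 1 (C.tl E (a' ⊗ₜ b') w (c' ⊗ₜ d')) (C.tlOpen E a b c d X p₀ q₀) =
      C.tlOpen E a b c d' (E.rmul 1 (E.eta (C.qp q₀ a', C.qp b' d) * w) X) p₀ c' := by
  induction X using BalTensor.induction with
  | mk x y =>
    rw [tlOpen_tmul, EnvRing.rmul_tmul, tlOpen_tmul, map_sum]
    simp only [EnvRing.rmul_tmul, tl_mul_tl, pairU_tmul, mul_assoc, mul_one]
  | zero => simp
  | add X Y hX hY => simp only [map_add, LinearMap.add_apply, hX, hY]

end MoritaContext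

namespace EnvRing

variable {k R U : Type*} [CommRing k] [Ring R] [Algebra k R] [Ring U] [Algebra k U]
  (E : EnvRing k R U)

theorem lTens_lmulT_rmul (r r' : R) (x y : U) (X : E.Tens₂) :
    E.lTens E.lS r (E.lmulT r' (E.rmul x y X)) = E.rmul x y (E.lTens E.lS r (E.lmulT r' X)) := by
  induction X using BalTensor.induction with
  | mk u v => simp only [rmul_tmul, lmulT_tmul, lTens_tmul, mul_assoc]
  | zero => simp
  | add X Y hX hY => simp only [map_add, hX, hY]

end EnvRing

namespace LeftBialgebroidData

variable {k R U : Type*} [CommRing k] [Ring R] [Algebra k R] [Ring U] [Algebra k U]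
  {H : LeftBialgebroidData k R U}

/-- Equivariance of the Galois map. -/
theorem IsLeftBialgebroid.galoisMap_equivariant (hH : H.IsLeftBialgebroid) (r r' x y : R) (z u w : U) :
    H.lTens H.lS r (H.lmulT r' (H.rmul (H.eta (x, y)) z
        (H.galoisMap H.comul hH.comul_mul_t (H.tmulOp u w)))) =
      H.galoisMap H.comul hH.comul_mul_t
        (H.tmulOp (H.eta (r, r') * u * H.s x) (H.s y * w * z)) := by
  have h := congrArg (H.rmul (H.s x) (w * z)) (hH.comul_takeuchi u y)
  simp only [EnvRing.rmul_rmul, one_mul] at h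
  rw [EnvRing.galoisMap_tmul, EnvRing.galoisMap_tmul, EnvRing.lTens_lmulT_rmul,
    EnvRing.lTens_lmulT_rmul, ← hH.comul_t_mul, ← hH.comul_s_mul, hH.comul_mul_s, EnvRing.rmul_rmul,
    EnvRing.rmul_rmul]
  simp only [EnvRing.eta, mul_assoc, one_mul, mul_one]
  rw [hH.comul_s_mul, hH.comul_t_mul, ← EnvRing.lTens_lmulT_rmul, ← EnvRing.lTens_lmulT_rmul, ← h,
    H.comm]

end LeftBialgebroidData

namespace MoritaContext

variable {k R S P Q U M : Type*} [CommRing k] [Ring R] [Algebra k R] [Ring S]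
  [Algebra k S] [AddCommGroup P] [Module k P] [Module S P] [Module Rᵐᵒᵖ P] [SMulCommClass S Rᵐᵒᵖ P]
  [IsScalarTower k S P] [IsScalarTower k Rᵐᵒᵖ P] [AddCommGroup Q] [Module k Q] [Module R Q]
  [Module Sᵐᵒᵖ Q] [SMulCommClass R Sᵐᵒᵖ Q] [IsScalarTower k R Q] [IsScalarTower k Sᵐᵒᵖ Q]
  [Ring U] [Algebra k U] [AddCommGroup M] [Module k M]
  (C : MoritaContext k R S P Q) (E : EnvRing k R U)

theorem thickenOp_absorb (a : P) (b c : Q) (d : P) (c' : Q) (d' : P) (r r' x y z z' : R) (u w : U) :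
    C.thickenOp E (a ⊗ₜ b) c d (c' ⊗ₜ d')
        (E.tmulOp (E.eta (r, r') * u * E.s x) (E.s y * w * E.eta (z, z'))) =
      C.thickenOp E ((op r • a) ⊗ₜ (r' • b)) (x • c) (op y • d) ((z • c') ⊗ₜ (op z' • d'))
        (E.tmulOp u w) := by
  rw [thickenOp_tmul, thickenOp_tmul]
  simp only [tl_mul_s, tl_right, lQe_tmul, tl_s, ← tl_left, rPe_tmul]

/-- Every argument of `thickenOp` can be expanded along `φ⁻¹(1) = ∑ⱼ p'ⱼ ⊗ q'ⱼ`. -/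
theorem sum_thickenOp (a : P) (b c : Q) (d : P) (c' : Q) (d' : P) (u w : U) :
    ∑ i₁, ∑ i₂, ∑ i₃, ∑ i₄, ∑ i₅, ∑ i₆,
      C.thickenOp E ((op (C.qp (C.q' i₁) a) • C.p' i₁) ⊗ₜ (C.qp b (C.p' i₂) • C.q' i₂))
        (C.qp c (C.p' i₃) • C.q' i₃) (op (C.qp (C.q' i₄) d) • C.p' i₄)
        ((C.qp c' (C.p' i₅) • C.q' i₅) ⊗ₜ (op (C.qp (C.q' i₆) d') • C.p' i₆)) (E.tmulOp u w) =
      C.thickenOp E (a ⊗ₜ b) c d (c' ⊗ₜ d') (E.tmulOp u w) := by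
  simp only [thickenOp_tmul]
  simp only [Finset.sum_comm (s := (Finset.univ : Finset (Fin C.nS)))
    (t := (Finset.univ : Finset (Fin C.nR)))]
  refine Finset.sum_congr rfl fun i _ => ?_
  simp only [← map_sum, ← LinearMap.sum_apply, ← TensorProduct.tmul_sum, ← TensorProduct.sum_tmul,
    C.sum_p'_qp, C.sum_qp_q']

variable {H : LeftBialgebroidData k R U} (hH : H.IsLeftBialgebroid)

theorem tildeComul_mul_t (x : C.Tilde H.toEnvRing) (y : S) :
    C.tildeComul hH (x * (C.tildeEnv H.toEnvRing).t (op y)) =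
      (C.tildeEnv H.toEnvRing).rmul 1 ((C.tildeEnv H.toEnvRing).t (op y)) (C.tildeComul hH x) :=
  (C.tilde_isLeftBialgebroid hH).comul_mul_t x y

/-- The Galois map of `Ũ`. -/
abbrev tildeGalois : (C.tildeEnv H.toEnvRing).TensOp →ₗ[k] (C.tildeEnv H.toEnvRing).Tens₂ :=
  (C.tildeEnv H.toEnvRing).galoisMap (C.tildeComul hH) (C.tildeComul_mul_t hH)

/-- The Galois map of `Ũ` is conjugate to that of `U`. In the product, `t(qᵢpᵢ)` sums to `1`. The
scalar `s(q'ⱼd)` on the second leg moves by the Takeuchi condition to `t` on the first, hence onto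
`p'ⱼ`, and `∑ⱼ p'ⱼ(q'ⱼd) = d`. -/
theorem tildeGalois_thickenOp (a : P) (b c : Q) (d : P) (c' : Q) (d' : P) (ξ : H.TensOp) :
    C.tildeGalois hH (C.thickenOp H.toEnvRing (a ⊗ₜ b) c d (c' ⊗ₜ d') ξ) =
      C.tlOpen H.toEnvRing a b c d' (H.galoisMap H.comul hH.comul_mul_t ξ) d c' := by
  induction ξ using BalTensor.induction with
  | mk u v =>
    have h : ∀ r j, C.tlOpen H.toEnvRing a b c d' (H.rmul 1 (H.eta (C.qp (C.q' j) d, r) * v)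
        (H.comul u)) (C.p' j) c' = C.tlOpen H.toEnvRing a b c d'
          (H.rmulₗ (H.comul u) 1 (H.t (op r) * v)) (op (C.qp (C.q' j) d) • C.p' j) c' := by
      intro r j
      have h := congrArg (H.rmul 1 (H.t (op r) * v)) (hH.comul_takeuchi u (C.qp (C.q' j) d))
      simp only [EnvRing.rmul_rmul, one_mul, mul_one] at h
      rw [← tlOpen_rmul_t, EnvRing.rmulₗ_apply, EnvRing.rmul_rmul, one_mul, mul_one, h, EnvRing.eta,
        mul_assoc]
    rw [thickenOp_tmul, EnvRing.galoisMap_tmul]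
    simp only [map_sum, EnvRing.galoisMap_tmul, tildeComul_tl_open, rmul_one_tlOpen, h]
    simp only [← LinearMap.sum_apply, ← map_sum, C.sum_p'_qp, ← Finset.sum_mul, ← Finset.op_sum,
      C.sum_qp, op_one, map_one H.t, one_mul]
    rw [EnvRing.rmulₗ_apply]
  | zero => simp
  | add X Y hX hY => simp only [map_add, LinearMap.add_apply, hX, hY]

theorem tildeGalois_surjective
    (hβ : Function.Surjective (H.galoisMap H.comul hH.comul_mul_t)) :
    Function.Surjective (C.tildeGalois hH) := by
  rw [← LinearMap.range_eq_top, eq_top_iff]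
  rintro Z -
  induction Z using BalTensor.induction with
  | zero => exact zero_mem _
  | add X Y hX hY => exact add_mem hX hY
  | mk x y =>
    induction x using C.tilde_induction H.toEnvRing with
    | zero => simp
    | add x x' hx hx' => simpa only [map_add, LinearMap.add_apply] using add_mem hx hx'
    | tl a b u c d =>
      induction y using C.tilde_induction H.toEnvRing with
      | zero => simp
      | add x x' hx hx' => simpa only [map_add] using add_mem hx hx'
      | tl a' b' v c' d' =>
        -- The pure tensor to be hit is the opening of `t(ba')u ⊗ v`; a preimage of the latter under
        -- `β`, thickened, is a preimage of the former.
        obtain ⟨ξ, hξ⟩ := hβ (H.tmul₂ (H.t (op (C.qp b a')) * u) v)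
        refine ⟨C.thickenOp H.toEnvRing (a ⊗ₜ b') c d (c' ⊗ₜ d') ξ, ?_⟩
        rw [tildeGalois_thickenOp, hξ, tlOpen_tmul]
        exact (C.tmul_tl_eq_sum H.toEnvRing (l := (C.tildeEnv H.toEnvRing).lS) a b u (c ⊗ₜ d)
          (((C.tlFrame H.toEnvRing b' d').flip v).flip c')
          (fun x p => (C.isFramed_tlFrame H.toEnvRing b' d').smul x p v c') a').symm

theorem tildeGalois_injective (hβ : Function.Bijective (H.galoisMap H.comul hH.comul_mul_t)) :
    Function.Injective (C.tildeGalois hH) := by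
  let e := LinearEquiv.ofBijective _ hβ
  -- Left inverse: compress to `U ⊗_R U`, apply `β⁻¹`, thicken back. Each of the six outer slots
  -- carries half of a dual basis pair in the compression and the other half in the thickening.
  let L : (C.tildeEnv H.toEnvRing).Tens₂ →ₗ[k] (C.tildeEnv H.toEnvRing).TensOp :=
    ∑ i₁, ∑ i₂, ∑ i₃, ∑ i₄, ∑ i₅, ∑ i₆, C.thickenOp H.toEnvRing (C.p' i₁ ⊗ₜ C.q' i₂) (C.q' i₃)
      (C.p' i₄) (C.q' i₅ ⊗ₜ C.p' i₆) ∘ₗ e.symm.toLinearMap ∘ₗ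
      C.compressTens₂ H.toEnvRing (C.q' i₁) (C.p' i₂) (C.p' i₃ ⊗ₜ C.q' i₄) (C.p' i₅ ⊗ₜ C.q' i₆)
  have key : L ∘ₗ C.tildeGalois hH = LinearMap.id := by
    refine BalTensor.hom_ext fun x y => ?_
    induction x using C.tilde_induction H.toEnvRing with
    | zero => simp
    | add x x' hx hx' => simp only [map_add, LinearMap.add_apply, hx, hx']
    | tl a b u c d =>
      induction y using C.tilde_induction H.toEnvRing with
      | zero => simp
      | add x x' hx hx' => simp only [map_add, hx, hx']
      | tl a' b' v c' d' =>
        rw [C.tmulOp_tl_eq_thickenOp, LinearMap.comp_apply, LinearMap.id_apply,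
          tildeGalois_thickenOp, ← C.sum_thickenOp]
        -- By equivariance the scalars left by compression can be pulled inside `β`, where `β⁻¹`
        -- cancels it; `thickenOp_absorb` identifies them with those in the dual basis expansion of
        -- the six slots.
        simp only [L, LinearMap.sum_apply, LinearMap.comp_apply, compressTens₂_tlOpen,
          hH.galoisMap_equivariant]
        simp only [← thickenOp_absorb]
        have he : ∀ ξ, e.symm.toLinearMap (H.galoisMap H.comul hH.comul_mul_t ξ) = ξ :=
          fun ξ => e.symm_apply_apply ξ
        simp only [he]
  exact fun x y h => by simpa only [← LinearMap.comp_apply, key, LinearMap.id_apply] using congrArg L h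

theorem tilde_isLeftHopfAlgebroid (hH : H.IsLeftHopfAlgebroid) :
    (C.tilde hH.toIsLeftBialgebroid).IsLeftHopfAlgebroid where
  toIsLeftBialgebroid := C.tilde_isLeftBialgebroid _
  hopf := ⟨C.tildeGalois hH.toIsLeftBialgebroid,
    fun u v => (C.tildeEnv H.toEnvRing).galoisMap_tmul _ _ u v,
    C.tildeGalois_injective _ hH.galoisMap_bijective,
    C.tildeGalois_surjective _ hH.galoisMap_bijective.2⟩

end MoritaContext

/-! ### Translation maps and the twisted coaction -/

namespace EnvRing

variable {k R U M : Type*} [CommRing k] [Ring R] [Algebra k R] [Ring U] [Algebra k U]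
  [AddCommGroup M] [Module k M] (E : EnvRing k R U)

/-- The map `y ⊗ z ↦ a y ⊗ z b` on `U ⊗_{Rᵒ} U`. -/
def biMul (a b : U) : Module.End k E.TensOp :=
  BalTensor.map (LinearMap.mulLeft k a) (LinearMap.mulRight k b)
    (fun r u => by simp [mul_assoc]) (fun r u => by simp [mul_assoc])

theorem biMul_tmul (a b y z : U) : E.biMul a b (E.tmulOp y z) = E.tmulOp (a * y) (z * b) :=
  BalTensor.map_mk _ _ _ _ _ _

/-- The map `y ⊗ z ↦ y s(r) ⊗ z` on `U ⊗_{Rᵒ} U`. -/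
def mulSOp (r : R) : Module.End k E.TensOp :=
  BalTensor.map (E.rS r) LinearMap.id
    (fun i u => by simp only [rS_apply, rT_apply, mul_assoc, E.comm]) (fun _ _ => rfl)

theorem mulSOp_tmul (r : R) (y z : U) : E.mulSOp r (E.tmulOp y z) = E.tmulOp (y * E.s r) z :=
  BalTensor.map_mk _ _ _ _ _ _

/-- The equivariance properties of a translation map `τ(u) = u₊ ⊗ u₋`. -/
structure IsTranslationMap (τ : U →ₗ[k] E.TensOp) : Prop where
  s_mul : ∀ r u, τ (E.s r * u) = E.biMul (E.s r) 1 (τ u)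
  t_mul : ∀ r u, τ (E.t (op r) * u) = E.biMul 1 (E.s r) (τ u)
  mul_s : ∀ r u, τ (u * E.s r) = E.mulSOp r (τ u)
  comm_t : ∀ r u, E.biMul (E.t (op r)) 1 (τ u) = E.biMul 1 (E.t (op r)) (τ u)

variable (act : Uᵐᵒᵖ →ₐ[k] Module.End k M) {l : R → Module.End k M}

/-- The map `y ⊗ z ↦ (n, e) ↦ z n ⊗ e y`. -/
def twistAux (hl : ∀ r m, l r m = act (op (E.t (op r))) m) :
    E.TensOp →ₗ[k] U →ₗ[k] M →ₗ[k] E.Tens l :=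
  BalTensor.lift (LinearMap.mk₂ k
    (fun y z => (E.tmul l).compl₁₂ (LinearMap.mulLeft k z) (act (op y)))
    (fun _ _ _ => by ext; simp) (fun _ _ _ => by ext; simp)
    (fun _ _ _ => by ext; simp [add_mul]) (fun _ _ _ => by ext; simp))
    (fun r y z => LinearMap.ext fun n => LinearMap.ext fun e => by
      simp only [LinearMap.mk₂_apply, LinearMap.compl₁₂_apply, LinearMap.mulLeft_apply, rT_apply,
        lT_apply, mul_assoc, E.tmul_bal, hl, op_mul, map_mul, Module.End.mul_apply])

theorem twistAux_tmul (hl : ∀ r m, l r m = act (op (E.t (op r))) m) (y z n : U) (e : M) :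
    E.twistAux act hl (E.tmulOp y z) n e = E.tmul l (z * n) (act (op y) e) :=
  LinearMap.congr_fun₂ (BalTensor.lift_mk _ _ _ _) n e

theorem twistAux_biMul (hl : ∀ r m, l r m = act (op (E.t (op r))) m) (a b : U) (ξ : E.TensOp)
    (n : U) (e : M) :
    E.twistAux act hl (E.biMul a b ξ) n e = E.twistAux act hl ξ (b * n) (act (op a) e) := by
  induction ξ using BalTensor.induction with
  | mk y z =>
    rw [biMul_tmul, twistAux_tmul, twistAux_tmul, op_mul, map_mul act, Module.End.mul_apply, mul_assoc]
  | zero => simp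
  | add X Y hX hY => simp only [map_add, LinearMap.add_apply, hX, hY]

/-- The map `u ⊗ m ↦ u ⊗ m s(r)` on `U_◃ ⊗_R M`, for a right `U`-module `M`. -/
def idActS (hl : ∀ r m, l r m = act (op (E.t (op r))) m) (r : R) : Module.End k (E.Tens l) :=
  BalTensor.map LinearMap.id (act (op (E.s r))) (fun _ _ => rfl) (fun i m => by
    simp only [hl, ← Module.End.mul_apply, ← map_mul, ← op_mul, E.comm])

theorem idActS_tmul (hl : ∀ r m, l r m = act (op (E.t (op r))) m) (r : R) (u : U) (m : M) :
    E.idActS act hl r (E.tmul l u m) = E.tmul l u (act (op (E.s r)) m) :=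
  BalTensor.map_mk _ _ _ _ _ _

variable {E} {τ : U →ₗ[k] E.TensOp} (hτ : E.IsTranslationMap τ)
  (hl : ∀ r m, l r m = act (op (E.t (op r))) m)

/-- The map `n ⊗ e ↦ v₋ n ⊗ e v₊` on `U_◃ ⊗_R M`. -/
def twist (v : U) : E.Tens l →ₗ[k] E.Tens l :=
  BalTensor.lift (E.twistAux act hl (τ v)) (fun r n e => by
    -- `t(r)v₊ ⊗ v₋ = v₊ ⊗ v₋t(r)` is exactly compatibility with the balancing of `n ⊗ e` over `R`.
    have h := congrArg (fun ξ => E.twistAux act hl ξ n e) (hτ.comm_t r v)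
    simp only [twistAux_biMul, one_mul, op_one, map_one, Module.End.one_apply, ← hl] at h
    exact h.symm)

theorem twist_tmul (v n : U) (e : M) :
    twist act hτ hl v (E.tmul l n e) = E.twistAux act hl (τ v) n e :=
  BalTensor.lift_mk _ _ _ _

theorem twist_add (v v' : U) (X : E.Tens l) :
    twist act hτ hl (v + v') X = twist act hτ hl v X + twist act hτ hl v' X := by
  induction X using BalTensor.induction with
  | mk n e => simp only [twist_tmul, map_add, LinearMap.add_apply]
  | zero => simp
  | add X Y hX hY => simp only [map_add, hX, hY]; abel

theorem twist_smul (c : k) (v : U) (X : E.Tens l) :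
    twist act hτ hl (c • v) X = c • twist act hτ hl v X := by
  induction X using BalTensor.induction with
  | mk n e => simp only [twist_tmul, map_smul, LinearMap.smul_apply]
  | zero => simp
  | add X Y hX hY => simp only [map_add, hX, hY, smul_add]

/-- Since `(s(r)v)₊ ⊗ (s(r)v)₋ = s(r)v₊ ⊗ v₋`, the source acts on `e` before `v₊` does. -/
theorem twist_s_mul (r : R) (v : U) (X : E.Tens l) :
    twist act hτ hl (E.s r * v) X = twist act hτ hl v (E.idActS act hl r X) := by
  induction X using BalTensor.induction with
  | mk n e => rw [idActS_tmul, twist_tmul, twist_tmul, hτ.s_mul, twistAux_biMul, one_mul]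
  | zero => simp
  | add X Y hX hY => simp only [map_add, hX, hY]

/-- Since `(t(r)v)₊ ⊗ (t(r)v)₋ = v₊ ⊗ v₋s(r)`, the target of `v` becomes a source in front of `n`.
-/
theorem twist_t_mul (r : R) (v : U) (X : E.Tens l) :
    twist act hτ hl (E.t (op r) * v) X = twist act hτ hl v (E.lTens l r X) := by
  induction X using BalTensor.induction with
  | mk n e =>
    rw [lTens_tmul, twist_tmul, twist_tmul, hτ.t_mul, twistAux_biMul, op_one, map_one,
      Module.End.one_apply]
  | zero => simp
  | add X Y hX hY => simp only [map_add, hX, hY]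

theorem twist_mul_s (r : R) (v : U) (X : E.Tens l) :
    twist act hτ hl (v * E.s r) X = E.idActS act hl r (twist act hτ hl v X) := by
  induction X using BalTensor.induction with
  | mk n e =>
    rw [twist_tmul, twist_tmul, hτ.mul_s]
    generalize τ v = ξ
    induction ξ using BalTensor.induction with
    | mk y z =>
      rw [mulSOp_tmul, twistAux_tmul, twistAux_tmul, idActS_tmul, op_mul, map_mul act,
        Module.End.mul_apply]
    | zero => simp
    | add X Y hX hY => simp only [map_add, LinearMap.add_apply, hX, hY]
  | zero => simp
  | add X Y hX hY => simp only [map_add, hX, hY]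

theorem twist_rmulLeft (v x : U) (X : E.Tens l) :
    twist act hτ hl v (E.rmulLeft l x X) = E.rmulLeft l x (twist act hτ hl v X) := by
  induction X using BalTensor.induction with
  | mk n e =>
    rw [rmulLeft_tmul, twist_tmul, twist_tmul]
    generalize τ v = ξ
    induction ξ using BalTensor.induction with
    | mk y z => rw [twistAux_tmul, twistAux_tmul, rmulLeft_tmul, mul_assoc]
    | zero => simp
    | add X Y hX hY => simp only [map_add, LinearMap.add_apply, hX, hY]
  | zero => simp
  | add X Y hX hY => simp only [map_add, hX, hY]

theorem rmulLeft_rmulLeft (x y : U) (X : E.Tens l) :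
    E.rmulLeft l y (E.rmulLeft l x X) = E.rmulLeft l (x * y) X := by
  induction X using BalTensor.induction with
  | mk n e => rw [rmulLeft_tmul, rmulLeft_tmul, rmulLeft_tmul, mul_assoc]
  | zero => simp
  | add X Y hX hY => simp only [map_add, hX, hY]

/-- The map `x ⊗ v ↦ v₋ n x ⊗ e v₊` on `U_◃ ⊗_R ▹U`, for an element `X = n ⊗ e` of the Takeuchi
product. -/
def twistTens (X : E.Tens l)
    (hX : ∀ r, E.rmulLeft l (E.t (op r)) X = E.idActS act hl r X) : E.Tens₂ →ₗ[k] E.Tens l :=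
  BalTensor.lift (LinearMap.mk₂ k (fun x v => E.rmulLeft l x (twist act hτ hl v X))
    (fun x x' v => by
      generalize twist act hτ hl v X = Y
      induction Y using BalTensor.induction with
      | mk n e => simp only [rmulLeft_tmul, mul_add, map_add, LinearMap.add_apply]
      | zero => simp
      | add X Y hX hY => simp only [map_add, hX, hY]; abel)
    (fun c x v => by
      generalize twist act hτ hl v X = Y
      induction Y using BalTensor.induction with
      | mk n e => simp only [rmulLeft_tmul, mul_smul_comm, map_smul, LinearMap.smul_apply]
      | zero => simp
      | add X Y hX hY => simp only [map_add, hX, hY, smul_add])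
    (fun x v v' => by rw [twist_add, map_add])
    (fun c x v => by rw [twist_smul, map_smul]))
    (fun r x v => by
      simp only [LinearMap.mk₂_apply, lT_apply, lS_apply]
      -- Replacing `v` by `s(r)v` acts on `e`; replacing `x` by `t(r)x` multiplies `n` on the right
      -- by `t(r)`. The two agree precisely on the Takeuchi product.
      rw [twist_s_mul, ← hX, twist_rmulLeft, rmulLeft_rmulLeft])

theorem twistTens_tmul (X : E.Tens l)
    (hX : ∀ r, E.rmulLeft l (E.t (op r)) X = E.idActS act hl r X) (x v : U) :
    twistTens act hτ hl X hX (E.tmul₂ x v) = E.rmulLeft l x (twist act hτ hl v X) :=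
  BalTensor.lift_mk _ _ _ _

end EnvRing

/-! ### The translation map, and the aYD and stability conditions as linear identities -/

namespace LeftBialgebroidData

variable {k R U M : Type*} [CommRing k] [Ring R] [Algebra k R] [Ring U] [Algebra k U]
  [AddCommGroup M] [Module k M] {H : LeftBialgebroidData k R U}

theorem IsLeftBialgebroid.galoisMap_biMul_s (hH : H.IsLeftBialgebroid) (r : R) (b : U) (ξ : H.TensOp) :
    H.galoisMap H.comul hH.comul_mul_t (H.biMul (H.s r) b ξ) =
      H.rmul 1 b (H.lTens H.lS r (H.galoisMap H.comul hH.comul_mul_t ξ)) := by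
  induction ξ using BalTensor.induction with
  | mk y z =>
    rw [H.biMul_tmul, H.galoisMap_tmul, H.galoisMap_tmul, hH.comul_s_mul]
    generalize H.comul y = X
    induction X using BalTensor.induction with
    | mk u v => simp only [EnvRing.lTens_tmul, EnvRing.rmul_tmul, mul_one, mul_assoc]
    | zero => simp
    | add X Y hX hY => simp only [map_add, hX, hY]
  | zero => simp
  | add X Y hX hY => simp only [map_add, hX, hY]

theorem IsLeftBialgebroid.galoisMap_biMul_t (hH : H.IsLeftBialgebroid) (r : R) (b : U) (ξ : H.TensOp) :
    H.galoisMap H.comul hH.comul_mul_t (H.biMul (H.t (op r)) b ξ) =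
      H.rmul 1 b (H.lmulT r (H.galoisMap H.comul hH.comul_mul_t ξ)) := by
  induction ξ using BalTensor.induction with
  | mk y z =>
    rw [H.biMul_tmul, H.galoisMap_tmul, H.galoisMap_tmul, hH.comul_t_mul]
    generalize H.comul y = X
    induction X using BalTensor.induction with
    | mk u v => simp only [EnvRing.lmulT_tmul, EnvRing.rmul_tmul, mul_one, mul_assoc]
    | zero => simp
    | add X Y hX hY => simp only [map_add, hX, hY]
  | zero => simp
  | add X Y hX hY => simp only [map_add, hX, hY]

theorem IsLeftBialgebroid.galoisMap_mulSOp (hH : H.IsLeftBialgebroid) (r : R) (ξ : H.TensOp) :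
    H.galoisMap H.comul hH.comul_mul_t (H.mulSOp r ξ) =
      H.rmul (H.s r) 1 (H.galoisMap H.comul hH.comul_mul_t ξ) := by
  induction ξ using BalTensor.induction with
  | mk y z =>
    rw [H.mulSOp_tmul, H.galoisMap_tmul, H.galoisMap_tmul, hH.comul_mul_s, EnvRing.rmul_rmul,
      EnvRing.rmul_rmul, one_mul, mul_one, mul_one, one_mul]
  | zero => simp
  | add X Y hX hY => simp only [map_add, hX, hY]

/-- The translation map `u ↦ u₊ ⊗ u₋ = β⁻¹(u ⊗ 1)`. -/
def translation (hH : H.IsLeftHopfAlgebroid) : U →ₗ[k] H.TensOp :=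
  (LinearEquiv.ofBijective _ hH.galoisMap_bijective).symm.toLinearMap ∘ₗ H.tmul₂.flip 1

theorem galoisMap_translation (hH : H.IsLeftHopfAlgebroid) (u : U) :
    H.galoisMap H.comul hH.toIsLeftBialgebroid.comul_mul_t (translation hH u) = H.tmul₂ u 1 :=
  (LinearEquiv.ofBijective _ hH.galoisMap_bijective).apply_symm_apply _

theorem isTranslation_iff (hH : H.IsLeftHopfAlgebroid) (u : U) {n : ℕ} (y z : Fin n → U) :
    H.IsTranslation u y z ↔ translation hH u = ∑ j, H.tmulOp (y j) (z j) := by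
  rw [← hH.galoisMap_bijective.1.eq_iff, galoisMap_translation, map_sum]
  simp only [EnvRing.galoisMap_tmul]
  exact eq_comm

/-- Each property is tested after applying the injective map `β`, where it becomes an identity
between elements such as `u ⊗ 1`. -/
theorem isTranslationMap_translation (hH : H.IsLeftHopfAlgebroid) :
    H.IsTranslationMap (translation hH) where
  s_mul r u := hH.galoisMap_bijective.1 (by
    rw [hH.galoisMap_biMul_s, galoisMap_translation, galoisMap_translation]
    simp only [EnvRing.lTens_tmul, EnvRing.rmul_tmul, mul_one])
  t_mul r u := hH.galoisMap_bijective.1 (by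
    -- Writing `1 = s(1)` lets the rule for `biMul (s r) b` cover pure right multiplication; the
    -- claim becomes `t(r)u ⊗ 1 = u ⊗ s(r)`.
    rw [← map_one H.s, hH.galoisMap_biMul_s, galoisMap_translation, galoisMap_translation]
    simp only [EnvRing.lTens_tmul, EnvRing.rmul_tmul, mul_one, map_one H.s, one_mul, H.tmul₂_bal])
  mul_s r u := hH.galoisMap_bijective.1 (by
    rw [hH.galoisMap_mulSOp, galoisMap_translation, galoisMap_translation]
    simp only [EnvRing.rmul_tmul, mul_one])
  comm_t r u := hH.galoisMap_bijective.1 (by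
    rw [hH.galoisMap_biMul_t, ← map_one H.s, hH.galoisMap_biMul_s, galoisMap_translation]
    simp only [EnvRing.lTens_tmul, EnvRing.lmulT_tmul, EnvRing.rmul_tmul, mul_one, map_one H.s,
      one_mul])

variable {act : Uᵐᵒᵖ →ₐ[k] Module.End k M} {N : H.LeftComoduleData M}

/-- The Takeuchi property of the coaction, rewritten through the agreement of the two right actions;
it is the hypothesis under which the twisted coaction is defined. -/
theorem rmulLeft_coact_eq_idActS (hH : H.IsLeftBialgebroid) (hN : N.IsLeftComodule)
    (hl : ∀ r m, N.lact r m = act (op (H.t (op r))) m)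
    (hr : ∀ r m, coRight hH N r m = act (op (H.s r)) m) (m : M) (r : R) :
    H.rmulLeft (fun r => N.lact r) (H.t (op r)) (N.coact m) = H.idActS act hl r (N.coact m) := by
  rw [coact_takeuchi hH N hN]
  generalize N.coact m = X
  induction X using BalTensor.induction with
  | mk u m => rw [idCoRight_tmul, H.idActS_tmul, hr]
  | zero => simp
  | add X Y hX hY => simp only [map_add, hX, hY]

theorem right_eq_iff (hH : H.IsLeftBialgebroid) :
    (∀ (r : R) (m : M) (n : ℕ) (x : Fin n → U) (y : Fin n → M),
      N.coact m = ∑ i, H.tmul (fun r => N.lact r) (x i) (y i) →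
      ∑ i, N.lact (H.counit (x i * H.s r)) (y i) = act (op (H.s r)) m) ↔
    ∀ r m, coRight hH N r m = act (op (H.s r)) m := by
  refine ⟨fun h r m => ?_, fun h r m n x y hm => ?_⟩
  · obtain ⟨n, x, y, hm⟩ := BalTensor.exists_rep (N.coact m)
    rw [coRight_apply hH N r m n x y hm, h r m n x y hm]
  · rw [← h, coRight_apply hH N r m n x y hm]

/-- The Sweedler form holds for all representations as soon as it holds for one, because its right
side is the value of a well-defined linear map. -/
theorem compat_iff (hH : H.IsLeftHopfAlgebroid)
    (hl : ∀ r m, N.lact r m = act (op (H.t (op r))) m)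
    (hX : ∀ m r, H.rmulLeft (fun r => N.lact r) (H.t (op r)) (N.coact m) =
      H.idActS act hl r (N.coact m)) :
    (∀ (u : U) (m : M) (a : ℕ) (x v : Fin a → U) (b : Fin a → ℕ)
      (y z : (i : Fin a) → Fin (b i) → U) (c : ℕ) (n : Fin c → U) (e : Fin c → M),
      H.comul u = ∑ i, H.tmul₂ (x i) (v i) →
      (∀ i, H.IsTranslation (v i) (y i) (z i)) →
      N.coact m = ∑ l, H.tmul (fun r => N.lact r) (n l) (e l) →
      N.coact (act (op u) m) =
        ∑ i, ∑ j, ∑ l, H.tmul (fun r => N.lact r) (z i j * n l * x i) (act (op (y i j)) (e l))) ↔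
    ∀ u m, N.coact (act (op u) m) = EnvRing.twistTens act (isTranslationMap_translation hH) hl
      (N.coact m) (hX m) (H.comul u) := by
  have key : ∀ (u : U) (m : M) (a : ℕ) (x v : Fin a → U) (b : Fin a → ℕ)
      (y z : (i : Fin a) → Fin (b i) → U) (c : ℕ) (n : Fin c → U) (e : Fin c → M),
      H.comul u = ∑ i, H.tmul₂ (x i) (v i) →
      (∀ i, H.IsTranslation (v i) (y i) (z i)) →
      N.coact m = ∑ l, H.tmul (fun r => N.lact r) (n l) (e l) →
      EnvRing.twistTens act (isTranslationMap_translation hH) hl (N.coact m) (hX m) (H.comul u) =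
        ∑ i, ∑ j, ∑ l, H.tmul (fun r => N.lact r) (z i j * n l * x i)
          (act (op (y i j)) (e l)) := by
    intro u m a x v b y z c n e hu hv hm
    have hv' : ∀ i, translation hH (v i) = ∑ j, H.tmulOp (y i j) (z i j) :=
      fun i => (isTranslation_iff hH _ _ _).1 (hv i)
    rw [hu, map_sum]
    refine Finset.sum_congr rfl fun i _ => ?_
    rw [EnvRing.twistTens_tmul, hm]
    simp only [map_sum, EnvRing.twist_tmul, hv', LinearMap.sum_apply, EnvRing.twistAux_tmul,
      EnvRing.rmulLeft_tmul]
    exact Finset.sum_comm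
  refine ⟨fun h u m => ?_, fun h u m a x v b y z c n e hu hv hm => ?_⟩
  · obtain ⟨a, x, v, hu⟩ := BalTensor.exists_rep (H.comul u)
    obtain ⟨c, n, e, hm⟩ := BalTensor.exists_rep (N.coact m)
    choose b y z hv using fun i => BalTensor.exists_rep (translation hH (v i))
    have hv' := fun i => (isTranslation_iff hH _ _ _).2 (hv i)
    rw [h u m a x v b y z c n e hu hv' hm, key u m a x v b y z c n e hu hv' hm]
  · rw [h, key u m a x v b y z c n e hu hv hm]

/-- The map `n ⊗ e ↦ e n`. -/
def actTens (act : Uᵐᵒᵖ →ₐ[k] Module.End k M) {l : R → Module.End k M} (E : EnvRing k R U)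
    (hl : ∀ r m, l r m = act (op (E.t (op r))) m) : E.Tens l →ₗ[k] M :=
  BalTensor.lift (act.toLinearMap ∘ₗ (opLinearEquiv k).toLinearMap) (fun r u m => by
    change act (op (E.t (op r) * u)) m = act (op u) (l r m)
    rw [hl, op_mul, map_mul act, Module.End.mul_apply])

theorem actTens_tmul {l : R → Module.End k M} (E : EnvRing k R U)
    (hl : ∀ r m, l r m = act (op (E.t (op r))) m) (u : U) (m : M) :
    actTens act E hl (E.tmul l u m) = act (op u) m :=
  BalTensor.lift_mk _ _ _ _

theorem stable_iff (hl : ∀ r m, N.lact r m = act (op (H.t (op r))) m) :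
    (∀ (m : M) (n : ℕ) (x : Fin n → U) (y : Fin n → M),
      N.coact m = ∑ i, H.tmul (fun r => N.lact r) (x i) (y i) →
      ∑ i, act (op (x i)) (y i) = m) ↔
    ∀ m, actTens act H.toEnvRing hl (N.coact m) = m := by
  refine ⟨fun h m => ?_, fun h m n x y hm => ?_⟩
  · obtain ⟨n, x, y, hm⟩ := BalTensor.exists_rep (N.coact m)
    rw [hm, map_sum]
    simp only [actTens_tmul]
    exact h m n x y hm
  · conv_rhs => rw [← h m, hm, map_sum]
    simp only [actTens_tmul]

end LeftBialgebroidData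

/-! ### The twisted coaction commutes with thickening -/

namespace MoritaContext

variable {k R S P Q U M : Type*} [CommRing k] [Ring R] [Algebra k R] [Ring S]
  [Algebra k S] [AddCommGroup P] [Module k P] [Module S P] [Module Rᵐᵒᵖ P] [SMulCommClass S Rᵐᵒᵖ P]
  [IsScalarTower k S P] [IsScalarTower k Rᵐᵒᵖ P] [AddCommGroup Q] [Module k Q] [Module R Q]
  [Module Sᵐᵒᵖ Q] [SMulCommClass R Sᵐᵒᵖ Q] [IsScalarTower k R Q] [IsScalarTower k Sᵐᵒᵖ Q]
  [Ring U] [Algebra k U] [AddCommGroup M] [Module k M]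
  (C : MoritaContext k R S P Q) (E : EnvRing k R U)

section Twist

variable {Y : Type*} [AddCommGroup Y] [Module k Y] {lM : R → Module.End k M}
  {l : S → Module.End k Y} {F : P →ₗ[k] M →ₗ[k] Q →ₗ[k] Y}

variable {C} in
/-- The map `u ⊗ m ↦ ∑ᵢ ((p ⊗ qᵢᵒ) ⊗ u ⊗ (q ⊗ p₀ᵒ)) ⊗_S F pᵢ m q₀`. -/
def thickenOpen (hF : C.IsFramed lM l F) (p : P) (q : Q) (p₀ : P) (q₀ : Q) :
    E.Tens lM →ₗ[k] (C.tildeEnv E).Tens l :=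
  BalTensor.lift (∑ i, ((C.tildeEnv E).tmul l).compl₁₂
      ((C.tl E (p ⊗ₜ C.q i)).flip (q ⊗ₜ p₀)) ((F (C.p i)).flip q₀))
    (fun r u m => by
      simp only [LinearMap.sum_apply, LinearMap.compl₁₂_apply, LinearMap.flip_apply,
        EnvRing.lT_apply, ← hF.bal]
      exact C.sum_legs E p u (q ⊗ₜ p₀) ((F.flip m).flip q₀) (fun x p => hF.smul x p m q₀) r)

theorem thickenOpen_tmul (hF : C.IsFramed lM l F) (p : P) (q : Q) (p₀ : P) (q₀ : Q) (u : U) (m : M) :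
    thickenOpen E hF p q p₀ q₀ (E.tmul lM u m) = ∑ i, (C.tildeEnv E).tmul l
      (C.tl E (p ⊗ₜ C.q i) u (q ⊗ₜ p₀)) (F (C.p i) m q₀) := by
  refine (BalTensor.lift_mk _ _ _ _).trans ?_
  simp only [LinearMap.sum_apply, LinearMap.compl₁₂_apply, LinearMap.flip_apply]

theorem sum_thickenOpen (hF : C.IsFramed lM l F) (p : P) (q : Q) (X : E.Tens lM) :
    ∑ j, thickenOpen E hF p q (C.p' j) (C.q' j) X = thicken E hF p X q := by
  induction X using BalTensor.induction with
  | mk u m =>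
    rw [thicken_tmul, Finset.sum_comm]
    simp only [thickenOpen_tmul]
  | zero => simp
  | add X Y hX hY => simp only [map_add, LinearMap.add_apply, Finset.sum_add_distrib, hX, hY]

/-- The free slot `p₀` of the first factor pairs with `b`, and `d` becomes the new free slot; `q₀`
is untouched. -/
theorem rmulLeft_thickenOpen (hF : C.IsFramed lM l F) (p : P) (q : Q) (p₀ : P) (q₀ : Q) (a : P)
    (b : Q) (u : U) (c : Q) (d : P) (X : E.Tens lM) :
    (C.tildeEnv E).rmulLeft l (C.tl E (a ⊗ₜ b) u (c ⊗ₜ d)) (thickenOpen E hF p q p₀ q₀ X) =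
      thickenOpen E hF p c d q₀ (E.rmulLeft lM (E.eta (C.qp q a, C.qp b p₀) * u) X) := by
  induction X using BalTensor.induction with
  | mk n m =>
    rw [thickenOpen_tmul, EnvRing.rmulLeft_tmul, thickenOpen_tmul, map_sum]
    simp only [EnvRing.rmulLeft_tmul, tl_mul_tl, pairU_tmul, mul_assoc]
  | zero => simp
  | add X Y hX hY => simp only [map_add, hX, hY]

variable (act : Uᵐᵒᵖ →ₐ[k] Module.End k M) {actY : (C.Tilde E)ᵐᵒᵖ →ₐ[k] Module.End k Y}
  {τ : U →ₗ[k] E.TensOp} {τ' : C.Tilde E →ₗ[k] (C.tildeEnv E).TensOp}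
  (hτ : E.IsTranslationMap τ) (hτ' : (C.tildeEnv E).IsTranslationMap τ')
  (hl : ∀ r m, lM r m = act (op (E.t (op r))) m)
  (hl' : ∀ x y, l x y = actY (op ((C.tildeEnv E).t (op x))) y)

/-- With the thickened translation map, `v₋n` produces `t(q_g p'ⱼ)` and the action of `v₊` on `e`
produces the left scalar `q'ⱼp_g`; over `g, j` these collapse. The pair indexed by `h` survives,
with `q'ₕa` acting on `e` and `p'ₕ` left in a free slot, until the factor `u₍₁₎` is multiplied in.
-/
theorem twist_thicken (hF : C.IsFramed lM l F)
    (hact : ∀ a b u c d p m q, actY (op (C.tl E (a ⊗ₜ b) u (c ⊗ₜ d))) (F p m q) =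
      F d (act (op (E.eta (C.qp q a, C.qp b p) * u)) m) c)
    (hf : ∀ a b u c d, τ' (C.tl E (a ⊗ₜ b) u (c ⊗ₜ d)) =
      ∑ j, C.thickenOp E (a ⊗ₜ C.q' j) c d (b ⊗ₜ C.p' j) (τ u))
    (a : P) (b : Q) (v : U) (c : Q) (d : P) (p : P) (X : E.Tens lM) (q : Q) :
    EnvRing.twist actY hτ' hl' (C.tl E (a ⊗ₜ b) v (c ⊗ₜ d)) (thicken E hF p X q) =
      ∑ h, thickenOpen E hF d q (C.p' h) c (EnvRing.twist act hτ hl v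
        (E.lTens lM (C.qp b p) (E.idActS act hl (C.qp (C.q' h) a) X))) := by
  induction X using BalTensor.induction with
  | zero => simp
  | add X Y hX hY => simp only [map_add, LinearMap.add_apply, Finset.sum_add_distrib, hX, hY]
  | mk n e =>
    have key : ∀ (ξ : E.TensOp) g h j, (C.tildeEnv E).twistAux actY hl'
        (C.thickenOp E (a ⊗ₜ C.q' j) c d (b ⊗ₜ C.p' j) ξ)
        (C.tl E (p ⊗ₜ C.q g) n (q ⊗ₜ C.p' h)) (F (C.p g) e (C.q' h)) =
        thickenOpen E hF d q (C.p' h) c (E.twistAux act hl ξ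
          (E.t (op (C.qp (C.q g) (C.p' j))) * (E.s (C.qp b p) * n))
          (lM (C.qp (C.q' j) (C.p g)) (act (op (E.s (C.qp (C.q' h) a))) e))) := by
      intro ξ g h j
      induction ξ using BalTensor.induction with
      | zero => simp
      | add X Y hX hY => simp only [map_add, LinearMap.add_apply, hX, hY]
      | mk y z =>
        rw [thickenOp_tmul, map_sum, EnvRing.twistAux_tmul, thickenOpen_tmul]
        simp only [LinearMap.sum_apply, EnvRing.twistAux_tmul, tl_mul_tl, hact, pairU_tmul,
          hl, EnvRing.eta, op_mul, map_mul act, Module.End.mul_apply, mul_assoc]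
        refine Finset.sum_congr rfl fun i _ => ?_
        rw [← mul_assoc (E.s _) (E.t _), E.comm, mul_assoc]
    have key' : ∀ h, E.tmul lM (E.s (C.qp b p) * n) (act (op (E.s (C.qp (C.q' h) a))) e) =
        ∑ g, ∑ j, E.tmul lM (E.t (op (C.qp (C.q g) (C.p' j))) * (E.s (C.qp b p) * n))
          (lM (C.qp (C.q' j) (C.p g)) (act (op (E.s (C.qp (C.q' h) a))) e)) :=
      fun h => (C.sum_tmul_collapse E lM _ _).symm
    simp only [thicken_tmul, map_sum, EnvRing.idActS_tmul, EnvRing.lTens_tmul, key',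
      EnvRing.twist_tmul, hf, LinearMap.sum_apply, key]
    rw [Finset.sum_comm]

/-- The central compatibility. For `W = Δ(u)` the factors `s(qa)` and `t(bp)` turn the argument into
`Δ(η(qa, bp)u)`, the coproduct of the element through which `Ũ` acts on `M̃`. -/
theorem twistTens_thicken (hF : C.IsFramed lM l F)
    (hact : ∀ a b u c d p m q, actY (op (C.tl E (a ⊗ₜ b) u (c ⊗ₜ d))) (F p m q) =
      F d (act (op (E.eta (C.qp q a, C.qp b p) * u)) m) c)
    (hf : ∀ a b u c d, τ' (C.tl E (a ⊗ₜ b) u (c ⊗ₜ d)) =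
      ∑ j, C.thickenOp E (a ⊗ₜ C.q' j) c d (b ⊗ₜ C.p' j) (τ u))
    (a : P) (b : Q) (c : Q) (d : P) (p : P) (X : E.Tens lM) (q : Q)
    (hX : ∀ r, E.rmulLeft lM (E.t (op r)) X = E.idActS act hl r X)
    (hX' : ∀ x, (C.tildeEnv E).rmulLeft l ((C.tildeEnv E).t (op x)) (thicken E hF p X q) =
      (C.tildeEnv E).idActS actY hl' x (thicken E hF p X q)) (W : E.Tens₂) :
    EnvRing.twistTens actY hτ' hl' (thicken E hF p X q) hX'
        (C.tildeComulAux E (a ⊗ₜ b) (c ⊗ₜ d) W) =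
      thicken E hF d (EnvRing.twistTens act hτ hl X hX
        (E.lTens E.lS (C.qp q a) (E.lmulT (C.qp b p) W))) c := by
  induction W using BalTensor.induction with
  | zero => simp
  | add X Y hX hY => simp only [map_add, LinearMap.add_apply, hX, hY]
  | mk u v =>
    -- The Takeuchi condition on `X` turns the action of the surviving scalar `q'ₕpᵢ` on the module
    -- factor into right multiplication by `t(q'ₕpᵢ)` on the other.
    have hcomm : ∀ r r', E.lTens lM r (E.idActS act hl r' X) =
        E.rmulLeft lM (E.t (op r')) (E.lTens lM r X) := by
      intro r r'
      rw [← hX]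
      generalize X = Z
      induction Z using BalTensor.induction with
      | zero => simp
      | add X Y hX hY => simp only [map_add, hX, hY]
      | mk n e => simp only [EnvRing.lTens_tmul, EnvRing.rmulLeft_tmul, mul_assoc]
    -- It then meets `t(qᵢp'ₕ)` coming from the product in `Ũ`, and the sum over `i, h` is `t(1) =
    -- 1`.
    have hsum : ∀ Z : E.Tens lM, ∑ i, ∑ h, E.rmulLeft lM
        (E.t (op (C.qp (C.q' h) (C.p i))) * (E.eta (C.qp q a, C.qp (C.q i) (C.p' h)) * u)) Z =
        E.rmulLeft lM (E.s (C.qp q a) * u) Z := by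
      intro Z
      induction Z using BalTensor.induction with
      | zero => simp
      | add X Y hX hY => simp only [map_add, Finset.sum_add_distrib, hX, hY]
      | mk n e =>
        have h : ∀ i h, E.t (op (C.qp (C.q' h) (C.p i))) *
            (E.eta (C.qp q a, C.qp (C.q i) (C.p' h)) * u) =
            E.t (op (C.qp (C.q i) (C.p' h) * C.qp (C.q' h) (C.p i))) * (E.s (C.qp q a) * u) := by
          intro i h
          rw [EnvRing.eta, E.comm, op_mul, map_mul E.t]
          simp only [mul_assoc]
        simp only [EnvRing.rmulLeft_tmul, h]
        simp only [← LinearMap.sum_apply, ← map_sum, ← Finset.mul_sum, ← Finset.sum_mul,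
          ← Finset.op_sum, C.sum_sum_qp_mul_qp, op_one, map_one E.t, one_mul]
    rw [tildeComulAux_tmul, tildeComulBil_tmul, EnvRing.lmulT_tmul, EnvRing.lTens_tmul,
      EnvRing.twistTens_tmul, EnvRing.twist_t_mul, ← C.sum_thickenOpen E hF d c, ← hsum]
    simp only [map_sum, EnvRing.twistTens_tmul]
    simp only [C.twist_thicken E act hτ hτ' hl hl' hF hact hf, map_sum, rmulLeft_thickenOpen,
      hcomm, EnvRing.twist_rmulLeft, EnvRing.rmulLeft_rmulLeft]
    rw [Finset.sum_comm]

end Twist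

end MoritaContext

namespace LeftBialgebroidData

variable {k R U M : Type*} [CommRing k] [Ring R] [Algebra k R] [Ring U] [Algebra k U]
  [AddCommGroup M] [Module k M] {H : LeftBialgebroidData k R U}
  (hH : H.IsLeftBialgebroid) (N : H.LeftComoduleData M)

/-- The right `R`-action of a left comodule, as a linear map. -/
def coRightₗ : R →ₗ[k] M →ₗ[k] M :=
  LinearMap.mk₂ k (fun r m => coRight hH N r m)
    (fun r r' m => by
      simp only [coRight_eq]
      generalize N.coact m = X
      induction X using BalTensor.induction with
      | mk u m =>
        simp only [EnvRing.counitTens_tmul, map_add, mul_add, LinearMap.add_apply]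
      | zero => simp
      | add X Y hX hY => simp only [map_add, hX, hY]; abel)
    (fun c r m => by
      simp only [coRight_eq]
      generalize N.coact m = X
      induction X using BalTensor.induction with
      | mk u m =>
        simp only [EnvRing.counitTens_tmul, map_smul, mul_smul_comm, LinearMap.smul_apply]
      | zero => simp
      | add X Y hX hY => simp only [map_add, hX, hY, smul_add])
    (fun r m m' => map_add _ _ _) (fun c r m => map_smul _ _ _)

theorem coRightₗ_apply (r : R) (m : M) : coRightₗ hH N r m = coRight hH N r m := rfl

end LeftBialgebroidData

/-! ### The translation map of `Ũ`, and recovering `M` from `M̃` -/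

namespace MoritaContext

variable {k R S P Q U M : Type*} [CommRing k] [Ring R] [Algebra k R] [Ring S]
  [Algebra k S] [AddCommGroup P] [Module k P] [Module S P] [Module Rᵐᵒᵖ P] [SMulCommClass S Rᵐᵒᵖ P]
  [IsScalarTower k S P] [IsScalarTower k Rᵐᵒᵖ P] [AddCommGroup Q] [Module k Q] [Module R Q]
  [Module Sᵐᵒᵖ Q] [SMulCommClass R Sᵐᵒᵖ Q] [IsScalarTower k R Q] [IsScalarTower k Sᵐᵒᵖ Q]
  [Ring U] [Algebra k U] [AddCommGroup M] [Module k M]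
  (C : MoritaContext k R S P Q) (E : EnvRing k R U)

section Translation

variable {H : LeftBialgebroidData k R U} (hH : H.IsLeftHopfAlgebroid)

/-- Checked after applying the injective Galois map. Writing the second factor `1` of `Ũ` by dual
bases, the scalar `bp'ⱼ` passes over `u ⊗ 1` to give `∑ⱼ (bp'ⱼ)q'ⱼ = b`. -/
theorem translation_tl (a : P) (b : Q) (u : U) (c : Q) (d : P) :
    LeftBialgebroidData.translation (C.tilde_isLeftHopfAlgebroid hH)
        (C.tl H.toEnvRing (a ⊗ₜ b) u (c ⊗ₜ d)) =
      ∑ j, C.thickenOp H.toEnvRing (a ⊗ₜ C.q' j) c d (b ⊗ₜ C.p' j)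
        (LeftBialgebroidData.translation hH u) := by
  refine C.tildeGalois_injective hH.toIsLeftBialgebroid hH.galoisMap_bijective ?_
  refine (LeftBialgebroidData.galoisMap_translation (C.tilde_isLeftHopfAlgebroid hH) _).trans ?_
  change (C.tildeEnv H.toEnvRing).tmul₂ _ 1 = _
  have h : ∀ i j, (C.tildeEnv H.toEnvRing).tmul₂ (C.tl H.toEnvRing (a ⊗ₜ b) u (c ⊗ₜ d))
      (C.tl H.toEnvRing (C.p' j ⊗ₜ C.q' i) 1 (C.q' j ⊗ₜ C.p' i)) =
      C.tlOpen H.toEnvRing a (C.q' i) c (C.p' i) (H.tmul₂ u 1) d (C.qp b (C.p' j) • C.q' j) := by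
    intro i j
    rw [← tlOpen_rmul_s, EnvRing.rmul_tmul, mul_one, one_mul]
    have h := H.tmul₂_bal (C.qp b (C.p' j)) u 1
    rw [mul_one] at h
    rw [← h, tlOpen_tmul]
    exact C.tmul_tl_eq_sum H.toEnvRing (l := (C.tildeEnv H.toEnvRing).lS) a b u (c ⊗ₜ d)
      (((C.tlFrame H.toEnvRing (C.q' i) (C.p' i)).flip 1).flip (C.q' j))
      (fun x p => (C.isFramed_tlFrame H.toEnvRing (C.q' i) (C.p' i)).smul x p 1 (C.q' j)) (C.p' j)
  rw [tilde_one_def]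
  simp only [map_sum, h, tildeGalois_thickenOp, LeftBialgebroidData.galoisMap_translation]
  simp only [← map_sum, C.sum_qp_q']

end Translation

section Recover

variable {H : LeftBialgebroidData k R U} (hH : H.IsLeftBialgebroid) (N : H.LeftComoduleData M)
  (hN : N.IsLeftComodule)

/-- The map `p ⊗ m ⊗ q ↦ (q₀ p) m (q p₀)` from `M̃` to `M`. -/
def compressMod (p₀ : P) : Q →ₗ[k] C.ComTilde hH N →ₗ[k] M :=
  LinearMap.flip (TriTensor.lift (LinearMap.mk₂ k
    (fun p m => (LinearMap.lcomp k M ((LeftBialgebroidData.coRightₗ hH N).flip m ∘ₗ C.qp.flip p₀) ∘ₗ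
      N.lact.toLinearMap ∘ₗ C.qp.flip p).flip)
    (fun _ _ _ => by ext; simp)
    (fun _ _ _ => by ext; simp)
    (fun _ _ _ => by ext; simp)
    (fun _ _ _ => by ext; simp))
    (fun r p m q => by
      ext q₀
      change N.lact (C.qp q₀ (op r • p)) (LeftBialgebroidData.coRight hH N (C.qp q p₀) m) =
        N.lact (C.qp q₀ p) (LeftBialgebroidData.coRight hH N (C.qp q p₀) (N.lact r m))
      rw [LeftBialgebroidData.coRight_lact hH N hN, C.qp_right, map_mul, Module.End.mul_apply])
    (fun r p m q => by
      ext q₀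
      change N.lact (C.qp q₀ p) (LeftBialgebroidData.coRight hH N (C.qp q p₀)
          (LeftBialgebroidData.coRight hH N r m)) =
        N.lact (C.qp q₀ p) (LeftBialgebroidData.coRight hH N (C.qp (r • q) p₀) m)
      rw [LeftBialgebroidData.coRight_mul hH N hN, C.qp_left]))

theorem compressMod_cd (p₀ : P) (q₀ : Q) (p : P) (m : M) (q : Q) :
    C.compressMod hH N hN p₀ q₀ (C.cd hH N p m q) =
      N.lact (C.qp q₀ p) (LeftBialgebroidData.coRight hH N (C.qp q p₀) m) := by
  rw [compressMod, LinearMap.flip_apply]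
  exact LinearMap.congr_fun (TriTensor.lift_mk _ _ _ _ _ _) q₀

/-- Faithfulness of `P ⊗_R - ⊗_R Q`: the element `m = ∑ᵢⱼ (qᵢpᵢ) m (qⱼpⱼ)` is a combination of
compressions of elements `p ⊗ m ⊗ q`. -/
theorem eq_of_cd_eq (hN : N.IsLeftComodule) {m m' : M}
    (h : ∀ p q, C.cd hH N p m q = C.cd hH N p m' q) : m = m' := by
  have key : ∀ m, m = ∑ i, ∑ j, C.compressMod hH N hN (C.p j) (C.q i)
      (C.cd hH N (C.p i) m (C.q j)) := by
    intro m
    simp only [compressMod_cd, ← map_sum, ← LeftBialgebroidData.coRightₗ_apply hH N]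
    simp only [← LinearMap.sum_apply, ← map_sum, C.sum_qp]
    rw [LeftBialgebroidData.coRightₗ_apply, LeftBialgebroidData.coRight_one hH N hN, map_one N.lact,
      Module.End.one_apply]
  rw [key m, key m']
  simp only [h]

theorem compressMod_tildeLact (p₀ : P) (x : S) (q₀ : Q) (y : C.ComTilde hH N) :
    C.compressMod hH N hN p₀ (op x • q₀) y =
      C.compressMod hH N hN p₀ q₀ (C.tildeLact hH N x y) := by
  induction y using TriTensor.induction with
  | zero => simp
  | add y y' h h' => simp only [map_add, h, h']
  | mk p m q => rw [tildeLact_cd, compressMod_cd, compressMod_cd, C.qp_bal]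

theorem compressMod_smul (p₀ : P) (r : R) (q₀ : Q) (y : C.ComTilde hH N) :
    C.compressMod hH N hN p₀ (r • q₀) y = N.lact r (C.compressMod hH N hN p₀ q₀ y) := by
  induction y using TriTensor.induction with
  | zero => simp
  | add y y' h h' => simp only [map_add, h, h']
  | mk p m q => rw [compressMod_cd, compressMod_cd, C.qp_left, map_mul, Module.End.mul_apply]

theorem compressTens_thicken (q₁ : Q) (p₂ : P) (q₃ : Q) (p₃ : P) (p : P)
    (X : H.Tens (fun r => N.lact r)) (q : Q) :
    C.compressTens H.toEnvRing (lM := fun r => N.lact r) (l := fun x => C.tildeLact hH N x)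
        (C.compressMod hH N hN p₃) (C.compressMod_tildeLact hH N hN p₃)
        (C.compressMod_smul hH N hN p₃) q₁ (p₂ ⊗ₜ q₃)
        (thicken H.toEnvRing (C.isFramed_cd hH N) p X q) =
      ∑ j, H.rmulLeft (fun r => N.lact r) (H.eta (C.qp q p₂, C.qp q₃ (C.p' j)))
        (H.lTens (fun r => N.lact r) (C.qp q₁ p)
          (LeftBialgebroidData.idCoRight hH N hN (C.qp (C.q' j) p₃) X)) := by
  induction X using BalTensor.induction with
  | zero => simp
  | add X Y hX hY => simp only [map_add, LinearMap.add_apply, Finset.sum_add_distrib, hX, hY]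
  | mk u m =>
    rw [thicken_tmul, Finset.sum_comm, map_sum]
    refine Finset.sum_congr rfl fun j _ => ?_
    rw [LeftBialgebroidData.idCoRight_tmul, H.lTens_tmul, H.rmulLeft_tmul, ← pairU_tmul]
    exact C.compressTens_sum H.toEnvRing (lM := fun r => N.lact r) _ _ _ q₁ (p₂ ⊗ₜ q₃) p u
      (q ⊗ₜ C.p' j) (fun p => C.cd hH N p m (C.q' j)) _
      (fun q₀ p => C.compressMod_cd hH N hN p₃ q₀ p m (C.q' j))

/-- On the Takeuchi product the scalar `q'ⱼp₃` acting on the comodule factor can be moved to `t` on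
the first, where `∑ⱼ (q₃p'ⱼ)(q'ⱼp₃) = q₃p₃`. Without that condition the sum over `j` would not
collapse. -/
theorem compressTens_thicken_of_takeuchi (q₁ : Q) (p₂ : P) (q₃ : Q) (p₃ : P) (p : P)
    (X : H.Tens (fun r => N.lact r)) (q : Q)
    (hX : ∀ r, H.rmulLeft (fun r => N.lact r) (H.t (op r)) X =
      LeftBialgebroidData.idCoRight hH N hN r X) :
    C.compressTens H.toEnvRing (lM := fun r => N.lact r) (l := fun x => C.tildeLact hH N x)
        (C.compressMod hH N hN p₃) (C.compressMod_tildeLact hH N hN p₃)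
        (C.compressMod_smul hH N hN p₃) q₁ (p₂ ⊗ₜ q₃)
        (thicken H.toEnvRing (C.isFramed_cd hH N) p X q) =
      H.rmulLeft (fun r => N.lact r) (H.eta (C.qp q p₂, C.qp q₃ p₃))
        (H.lTens (fun r => N.lact r) (C.qp q₁ p) X) := by
  rw [compressTens_thicken]
  simp only [← hX]
  clear hX
  induction X using BalTensor.induction with
  | zero => simp
  | add X Y hX hY => simp only [map_add, Finset.sum_add_distrib, hX, hY]
  | mk u m =>
    have h : ∀ j, H.s (C.qp q₁ p) * (u * H.t (op (C.qp (C.q' j) p₃))) *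
        H.eta (C.qp q p₂, C.qp q₃ (C.p' j)) = H.s (C.qp q₁ p) * u * H.s (C.qp q p₂) *
          H.t (op (C.qp q₃ (C.p' j) * C.qp (C.q' j) p₃)) := by
      intro j
      rw [EnvRing.eta, op_mul, map_mul H.t]
      simp only [mul_assoc]
      rw [← mul_assoc (H.t _) (H.s _), ← H.comm, mul_assoc]
    simp only [EnvRing.rmulLeft_tmul, EnvRing.lTens_tmul, h]
    simp only [← LinearMap.sum_apply, ← map_sum, ← Finset.mul_sum, ← Finset.op_sum, C.sum_qp_mul_qp]
    rw [EnvRing.eta, ← mul_assoc]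

/-- Elements of the Takeuchi product are determined by their images in `Ũ ⊗_S M̃`. -/
theorem eq_of_thicken_eq {X X' : H.Tens (fun r => N.lact r)}
    (hX : ∀ r, H.rmulLeft (fun r => N.lact r) (H.t (op r)) X =
      LeftBialgebroidData.idCoRight hH N hN r X)
    (hX' : ∀ r, H.rmulLeft (fun r => N.lact r) (H.t (op r)) X' =
      LeftBialgebroidData.idCoRight hH N hN r X')
    (h : ∀ p q, thicken H.toEnvRing (C.isFramed_cd hH N) p X q =
      thicken H.toEnvRing (C.isFramed_cd hH N) p X' q) : X = X' := by
  -- All three scalars sum to `1`, which exhibits `X` as a sum of compressed thickenings of `X`.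
  have key : ∀ X : H.Tens (fun r => N.lact r), X = ∑ i, ∑ j, ∑ g, H.rmulLeft (fun r => N.lact r)
      (H.eta (C.qp (C.q j) (C.p j), C.qp (C.q g) (C.p g)))
      (H.lTens (fun r => N.lact r) (C.qp (C.q i) (C.p i)) X) := by
    intro X
    induction X using BalTensor.induction with
    | zero => simp
    | add X Y hX hY =>
      simp only [map_add, Finset.sum_add_distrib]
      rw [← hX, ← hY]
    | mk u m =>
      simp only [EnvRing.rmulLeft_tmul, EnvRing.lTens_tmul, EnvRing.eta]
      simp only [← LinearMap.sum_apply, ← map_sum, ← Finset.mul_sum, ← Finset.sum_mul,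
        ← Finset.op_sum, C.sum_qp, op_one, map_one, mul_one, one_mul]
  rw [key X, key X']
  simp only [← C.compressTens_thicken_of_takeuchi hH N hN _ _ _ _ _ X _ hX,
    ← C.compressTens_thicken_of_takeuchi hH N hN _ _ _ _ _ X' _ hX', h]

end Recover

end MoritaContext

/-! ### The twisted coaction as a function of the coaction -/

namespace EnvRing

variable {k R U M : Type*} [CommRing k] [Ring R] [Algebra k R] [Ring U] [Algebra k U]
  [AddCommGroup M] [Module k M] {E : EnvRing k R U} {act : Uᵐᵒᵖ →ₐ[k] Module.End k M}
  {l : R → Module.End k M} {τ : U →ₗ[k] E.TensOp} (hτ : E.IsTranslationMap τ)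
  (hl : ∀ r m, l r m = act (op (E.t (op r))) m)

/-- The Takeuchi hypothesis depends on `X`, so replacing `X` by an equal element needs its own
statement. -/
theorem twistTens_congr {X Y : E.Tens l} (h : X = Y)
    (hX : ∀ r, E.rmulLeft l (E.t (op r)) X = E.idActS act hl r X)
    (hY : ∀ r, E.rmulLeft l (E.t (op r)) Y = E.idActS act hl r Y) (W : E.Tens₂) :
    twistTens act hτ hl X hX W = twistTens act hτ hl Y hY W := by
  subst h
  rfl

theorem twistTens_zero (hX : ∀ r, E.rmulLeft l (E.t (op r)) 0 = E.idActS act hl r 0) (W : E.Tens₂) :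
    twistTens act hτ hl 0 hX W = 0 := by
  induction W using BalTensor.induction with
  | mk x v => rw [twistTens_tmul, map_zero, map_zero]
  | zero => simp
  | add X Y hX hY => simp only [map_add, hX, hY, add_zero]

theorem twistTens_add {X Y : E.Tens l}
    (hX : ∀ r, E.rmulLeft l (E.t (op r)) X = E.idActS act hl r X)
    (hY : ∀ r, E.rmulLeft l (E.t (op r)) Y = E.idActS act hl r Y)
    (hXY : ∀ r, E.rmulLeft l (E.t (op r)) (X + Y) = E.idActS act hl r (X + Y)) (W : E.Tens₂) :
    twistTens act hτ hl (X + Y) hXY W = twistTens act hτ hl X hX W + twistTens act hτ hl Y hY W := by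
  induction W using BalTensor.induction with
  | mk x v => simp only [twistTens_tmul, map_add]
  | zero => simp
  | add W W' h h' => simp only [map_add, h, h']; abel

theorem rmulLeft_twistTens {X : E.Tens l}
    (hX : ∀ r, E.rmulLeft l (E.t (op r)) X = E.idActS act hl r X) (x : U) (W : E.Tens₂) :
    E.rmulLeft l x (twistTens act hτ hl X hX W) = twistTens act hτ hl X hX (E.rmul x 1 W) := by
  induction W using BalTensor.induction with
  | mk u v => rw [rmul_tmul, twistTens_tmul, twistTens_tmul, rmulLeft_rmulLeft, mul_one]
  | zero => simp
  | add W W' h h' => simp only [map_add, h, h']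

/-- Together with `rmulLeft_twistTens` and the Takeuchi condition for `Δ(u)`, this shows that the
twisted coaction itself takes values in the Takeuchi product. -/
theorem idActS_twistTens {X : E.Tens l}
    (hX : ∀ r, E.rmulLeft l (E.t (op r)) X = E.idActS act hl r X) (r : R) (W : E.Tens₂) :
    E.idActS act hl r (twistTens act hτ hl X hX W) =
      twistTens act hτ hl X hX (E.rmul 1 (E.s r) W) := by
  induction W using BalTensor.induction with
  | mk u v =>
    rw [rmul_tmul, twistTens_tmul, twistTens_tmul, mul_one, twist_mul_s]
    generalize twist act hτ hl v X = Y
    induction Y using BalTensor.induction with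
    | mk n e => simp only [rmulLeft_tmul, idActS_tmul]
    | zero => simp
    | add W W' h h' => simp only [map_add, h, h']
  | zero => simp
  | add W W' h h' => simp only [map_add, h, h']

end EnvRing

/-! ### The contraction `n ⊗ e ↦ e n` and the criteria for aYD and SaYD -/

namespace LeftBialgebroidData

variable {k R U M : Type*} [CommRing k] [Ring R] [Algebra k R] [Ring U] [Algebra k U]
  [AddCommGroup M] [Module k M] {H : LeftBialgebroidData k R U}
  {act : Uᵐᵒᵖ →ₐ[k] Module.End k M} {N : H.LeftComoduleData M}

theorem actTens_lTens {l : R → Module.End k M} (E : EnvRing k R U)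
    (hl : ∀ r m, l r m = act (op (E.t (op r))) m) (r : R) (X : E.Tens l) :
    actTens act E hl (E.lTens l r X) = actTens act E hl (E.idActS act hl r X) := by
  induction X using BalTensor.induction with
  | mk u m =>
    rw [E.lTens_tmul, E.idActS_tmul, actTens_tmul, actTens_tmul, op_mul, map_mul act,
      Module.End.mul_apply]
  | zero => simp
  | add X Y hX hY => simp only [map_add, hX, hY]

theorem actTens_rmulLeft {l : R → Module.End k M} (E : EnvRing k R U)
    (hl : ∀ r m, l r m = act (op (E.t (op r))) m) (r : R) (X : E.Tens l) :
    actTens act E hl (E.rmulLeft l (E.t (op r)) X) = l r (actTens act E hl X) := by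
  induction X using BalTensor.induction with
  | mk u m =>
    rw [E.rmulLeft_tmul, actTens_tmul, actTens_tmul, op_mul, map_mul act, Module.End.mul_apply, hl]
  | zero => simp
  | add X Y hX hY => simp only [map_add, hX, hY]

theorem isAYD_iff (hH : H.IsLeftHopfAlgebroid) (hN : N.IsLeftComodule)
    (hl : ∀ r m, N.lact r m = act (op (H.t (op r))) m)
    (hr : ∀ r m, coRight hH.toIsLeftBialgebroid N r m = act (op (H.s r)) m) :
    IsAYD act N ↔ ∀ u m, N.coact (act (op u) m) =
      EnvRing.twistTens act (isTranslationMap_translation hH) hl (N.coact m)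
        (rmulLeft_coact_eq_idActS hH.toIsLeftBialgebroid hN hl hr m) (H.comul u) :=
  ⟨fun h => (compat_iff hH hl _).1 h.compat,
    fun h => ⟨hl, (right_eq_iff hH.toIsLeftBialgebroid).2 hr, (compat_iff hH hl _).2 h⟩⟩

theorem isSAYD_iff (hl : ∀ r m, N.lact r m = act (op (H.t (op r))) m) :
    IsSAYD act N ↔ IsAYD act N ∧ ∀ m, actTens act H.toEnvRing hl (N.coact m) = m :=
  ⟨fun h => ⟨h.toIsAYD, (stable_iff hl).1 h.stable⟩, fun h => ⟨h.1, (stable_iff hl).2 h.2⟩⟩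

end LeftBialgebroidData

/-! ### The actions on `M̃`, agreement of bimodule structures, and stability -/

namespace MoritaContext

variable {k R S P Q U M : Type*} [CommRing k] [Ring R] [Algebra k R] [Ring S]
  [Algebra k S] [AddCommGroup P] [Module k P] [Module S P] [Module Rᵐᵒᵖ P] [SMulCommClass S Rᵐᵒᵖ P]
  [IsScalarTower k S P] [IsScalarTower k Rᵐᵒᵖ P] [AddCommGroup Q] [Module k Q] [Module R Q]
  [Module Sᵐᵒᵖ Q] [SMulCommClass R Sᵐᵒᵖ Q] [IsScalarTower k R Q] [IsScalarTower k Sᵐᵒᵖ Q]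
  [Ring U] [Algebra k U] [AddCommGroup M] [Module k M]
  (C : MoritaContext k R S P Q) (E : EnvRing k R U)

section AYD

variable {H : LeftBialgebroidData k R U} (act : Uᵐᵒᵖ →ₐ[k] Module.End k M)
  (N : H.LeftComoduleData M) (hN : N.IsLeftComodule)

section Bialgebroid

variable (hH : H.IsLeftBialgebroid)

/-- If the two bimodule structures of `M` agree, the actions are equal as functions, the two
quotients are the same, and the identity serves as `e`. -/
theorem exists_modTilde_equiv (hl : ∀ r m, N.lact r m = act (op (H.t (op r))) m)
    (hr : ∀ r m, LeftBialgebroidData.coRight hH N r m = act (op (H.s r)) m) :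
    ∃ e : C.ModTilde H.toEnvRing act ≃ₗ[k] C.ComTilde hH N,
      ∀ p m q, e (C.sd _ _ p m q) = C.cd hH N p m q := by
  have hl' : modLeft H.toEnvRing act = fun r => N.lact r :=
    funext fun r => LinearMap.ext fun m => (hl r m).symm
  have hr' : modRight H.toEnvRing act = LeftBialgebroidData.coRight hH N :=
    funext fun r => LinearMap.ext fun m => (hr r m).symm
  change ∃ e : C.Sand (modLeft H.toEnvRing act) (modRight H.toEnvRing act) ≃ₗ[k] C.ComTilde hH N,
    ∀ p m q, e (C.sd (modLeft H.toEnvRing act) (modRight H.toEnvRing act) p m q) = C.cd hH N p m q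
  rw [hl', hr']
  exact ⟨LinearEquiv.refl _ _, fun _ _ _ => rfl⟩

variable {hH}
variable (e : C.ModTilde H.toEnvRing act ≃ₗ[k] C.ComTilde hH N)
  (he : ∀ p m q, e (C.sd _ _ p m q) = C.cd hH N p m q)

/-- The right `Ũ`-module structure of `M̃`, transported to the comodule version of `M̃`. -/
abbrev comTildeAct : (C.Tilde H.toEnvRing)ᵐᵒᵖ →ₐ[k] Module.End k (C.ComTilde hH N) :=
  ((e.conjAlgEquiv k).toAlgHom).comp (C.tildeAct H.toEnvRing act)

variable {act N e}

/-- In the module version `r` passes from `p` to `m` as `t(r)`, in the comodule version as `N.lact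
r`; since `e` matches pure tensors, `eq_of_cd_eq` forces the two to agree on `M`. -/
theorem lact_eq_of_equiv (hN : N.IsLeftComodule)
    (he : ∀ p m q, e (C.sd _ _ p m q) = C.cd hH N p m q) (r : R) (m : M) :
    N.lact r m = act (op (H.t (op r))) m :=
  C.eq_of_cd_eq hH N hN fun p q => by
    rw [cd_lact, ← he, ← he]
    exact congrArg e (TriTensor.mk_left C.rP (modLeft H.toEnvRing act) _ _ r p m q)

theorem coRight_eq_of_equiv (hN : N.IsLeftComodule)
    (he : ∀ p m q, e (C.sd _ _ p m q) = C.cd hH N p m q) (r : R) (m : M) :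
    LeftBialgebroidData.coRight hH N r m = act (op (H.s r)) m :=
  C.eq_of_cd_eq hH N hN fun p q => by
    rw [cd_coRight, ← he, ← he]
    exact congrArg e (TriTensor.mk_right C.rP _ (modRight H.toEnvRing act) C.lQ r p m q).symm

theorem comTildeAct_tl (he : ∀ p m q, e (C.sd _ _ p m q) = C.cd hH N p m q) (a : P) (b : Q) (u : U)
    (c : Q) (d : P) (p : P) (m : M) (q : Q) :
    C.comTildeAct act N e (op (C.tl H.toEnvRing (a ⊗ₜ b) u (c ⊗ₜ d))) (C.cd hH N p m q) =
      C.cd hH N d (act (op (H.eta (C.qp q a, C.qp b p) * u)) m) c := by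
  change e (C.tildeActₗ H.toEnvRing act (C.tl H.toEnvRing (a ⊗ₜ b) u (c ⊗ₜ d))
    (e.symm (C.cd hH N p m q))) = _
  rw [← he, LinearEquiv.symm_apply_apply, tildeActₗ_tl, he, EnvRing.eta, H.comm]
  simp only [modLeft, modRight, op_mul, map_mul act, Module.End.mul_apply]

/-- The scalars from both dual bases act on `m` through `t` and `s`, hence, by the agreement on `M`,
pass to `P` and `Q` and reassemble `y p` and `q x`. This yields the agreement of both `S`-actions on
`M̃`. -/
theorem comTildeAct_tildeEta (hN : N.IsLeftComodule)
    (he : ∀ p m q, e (C.sd _ _ p m q) = C.cd hH N p m q) (x y : S) (p : P) (m : M) (q : Q) :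
    C.comTildeAct act N e (op (C.tildeEta H.toEnvRing x y)) (C.cd hH N p m q) =
      C.cd hH N (y • p) m (op x • q) := by
  have h : ∀ i j, C.comTildeAct act N e (op (C.tl H.toEnvRing ((x • C.p' j) ⊗ₜ C.q' i) 1
      (C.q' j ⊗ₜ (y • C.p' i)))) (C.cd hH N p m q) =
      C.cd hH N (op (C.qp (C.q' i) p) • (y • C.p' i)) m (C.qp q (x • C.p' j) • C.q' j) := by
    intro i j
    rw [C.comTildeAct_tl he, mul_one, EnvRing.eta, H.comm, op_mul, map_mul act, Module.End.mul_apply,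
      ← C.lact_eq_of_equiv hN he, ← C.coRight_eq_of_equiv hN he, cd_coRight, cd_lact]
  simp only [tildeEta, Finset.op_sum, map_sum, LinearMap.sum_apply, h]
  simp only [← map_sum, ← LinearMap.sum_apply, ← C.qp_bal, C.sum_qp_q', ← smul_comm y,
    ← Finset.smul_sum, C.sum_p'_qp]

theorem tildeLact_eq (hN : N.IsLeftComodule)
    (he : ∀ p m q, e (C.sd _ _ p m q) = C.cd hH N p m q) (x : S) (y : C.ComTilde hH N) :
    C.tildeLact hH N x y =
      C.comTildeAct act N e (op ((C.tildeEnv H.toEnvRing).t (op x))) y := by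
  induction y using TriTensor.induction with
  | zero => simp
  | add y y' h h' => simp only [map_add, h, h']
  | mk p m q =>
    refine (C.tildeLact_cd hH N x p m q).trans ?_
    refine Eq.trans ?_ (C.comTildeAct_tildeEta hN he 1 x p m q).symm
    rw [op_one, one_smul]

theorem coRight_tilde_eq (hN : N.IsLeftComodule) (hU : (C.tilde hH).IsLeftBialgebroid)
    (he : ∀ p m q, e (C.sd _ _ p m q) = C.cd hH N p m q) (x : S) (y : C.ComTilde hH N) :
    LeftBialgebroidData.coRight hU (C.tildeComodule hH N hN) x y =
      C.comTildeAct act N e (op ((C.tildeEnv H.toEnvRing).s x)) y := by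
  induction y using TriTensor.induction with
  | zero => simp
  | add y y' h h' => simp only [map_add, h, h']
  | mk p m q =>
    refine (C.coRight_tildeComodule hH N hN hU x p m q).trans ?_
    refine Eq.trans ?_ (C.comTildeAct_tildeEta hN he x 1 p m q).symm
    rw [one_smul]

theorem actTens_thicken (hN : N.IsLeftComodule)
    (he : ∀ p m q, e (C.sd _ _ p m q) = C.cd hH N p m q) (p : P)
    (X : H.Tens (fun r => N.lact r)) (q : Q) :
    LeftBialgebroidData.actTens (C.comTildeAct act N e) (C.tildeEnv H.toEnvRing)
        (C.tildeLact_eq hN he) (thicken H.toEnvRing (C.isFramed_cd hH N) p X q) =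
      ∑ j, C.cd hH N (C.p' j) (LeftBialgebroidData.actTens act H.toEnvRing
        (C.lact_eq_of_equiv hN he)
        (H.lTens (fun r => N.lact r) (C.qp (C.q' j) p) X)) q := by
  induction X using BalTensor.induction with
  | zero => simp
  | add X Y hX hY => simp only [map_add, LinearMap.add_apply, Finset.sum_add_distrib, hX, hY]
  | mk u m =>
    rw [thicken_tmul, Finset.sum_comm, map_sum]
    refine Finset.sum_congr rfl fun j _ => ?_
    rw [H.lTens_tmul, LeftBialgebroidData.actTens_tmul, map_sum]
    have h : ∀ i, LeftBialgebroidData.actTens (C.comTildeAct act N e) (C.tildeEnv H.toEnvRing)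
        (C.tildeLact_eq hN he) ((C.tildeEnv H.toEnvRing).tmul (fun x => C.tildeLact hH N x)
          (C.tl H.toEnvRing (p ⊗ₜ C.q i) u (q ⊗ₜ C.p' j)) (C.cd hH N (C.p i) m (C.q' j))) =
        C.cd hH N (C.p' j) (act (op (H.s (C.qp (C.q' j) p) *
          H.t (op (C.qp (C.q i) (C.p i))) * u)) m) q := fun i =>
      (LeftBialgebroidData.actTens_tmul _ _ _ _).trans (C.comTildeAct_tl he _ _ _ _ _ _ _ _)
    simp only [h]
    simp only [← LinearMap.sum_apply, ← map_sum, ← Finset.op_sum, ← Finset.mul_sum,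
      ← Finset.sum_mul, C.sum_qp, op_one, map_one, mul_one]

/-- Contraction leaves `s(q'ⱼp)` in front of `m₍₋₁₎`. This acts on `m₍₀₎`, so by the Takeuchi
property it equals `t(q'ⱼp)` behind `m₍₋₁₎`, that is, a left scalar on `m₍₀₎m₍₋₁₎`, and `∑ⱼ
p'ⱼ(q'ⱼp) = p`. -/
theorem actTens_tildeCoact_cd (hN : N.IsLeftComodule)
    (he : ∀ p m q, e (C.sd _ _ p m q) = C.cd hH N p m q) (p : P) (m : M) (q : Q) :
    LeftBialgebroidData.actTens (C.comTildeAct act N e) (C.tildeEnv H.toEnvRing)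
        (C.tildeLact_eq hN he) (C.tildeCoact hH N hN (C.cd hH N p m q)) =
      C.cd hH N p (LeftBialgebroidData.actTens act H.toEnvRing (C.lact_eq_of_equiv hN he)
        (N.coact m)) q := by
  rw [tildeCoact_cd, C.actTens_thicken hN he]
  have h := LeftBialgebroidData.rmulLeft_coact_eq_idActS hH hN (C.lact_eq_of_equiv hN he)
    (C.coRight_eq_of_equiv hN he) m
  simp only [LeftBialgebroidData.actTens_lTens, ← h, LeftBialgebroidData.actTens_rmulLeft, cd_lact]
  simp only [← LinearMap.sum_apply, ← map_sum, C.sum_p'_qp]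

theorem actTens_tildeCoact_iff (hN : N.IsLeftComodule)
    (he : ∀ p m q, e (C.sd _ _ p m q) = C.cd hH N p m q) :
    (∀ m, LeftBialgebroidData.actTens act H.toEnvRing (C.lact_eq_of_equiv hN he) (N.coact m) = m) ↔
    ∀ y, LeftBialgebroidData.actTens (C.comTildeAct act N e) (C.tildeEnv H.toEnvRing)
        (C.tildeLact_eq hN he) (C.tildeCoact hH N hN y) = y := by
  refine ⟨fun h y => ?_, fun h m => C.eq_of_cd_eq hH N hN fun p q => ?_⟩
  · induction y using TriTensor.induction with
    | zero => simp
    | add y y' h h' => simp only [map_add, h, h']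
    | mk p m q => exact (C.actTens_tildeCoact_cd hN he p m q).trans (by rw [h])
  · rw [← C.actTens_tildeCoact_cd hN he, h]

end Bialgebroid

end AYD

end MoritaContext

/-! ### Equivalence of the aYD and SaYD conditions -/

namespace MoritaContext

variable {k R S P Q U M : Type*} [CommRing k] [Ring R] [Algebra k R] [Ring S]
  [Algebra k S] [AddCommGroup P] [Module k P] [Module S P] [Module Rᵐᵒᵖ P] [SMulCommClass S Rᵐᵒᵖ P]
  [IsScalarTower k S P] [IsScalarTower k Rᵐᵒᵖ P] [AddCommGroup Q] [Module k Q] [Module R Q]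
  [Module Sᵐᵒᵖ Q] [SMulCommClass R Sᵐᵒᵖ Q] [IsScalarTower k R Q] [IsScalarTower k Sᵐᵒᵖ Q]
  [Ring U] [Algebra k U] [AddCommGroup M] [Module k M]
  (C : MoritaContext k R S P Q) (E : EnvRing k R U)

section AYD

variable {H : LeftBialgebroidData k R U} (hH : H.IsLeftHopfAlgebroid)
  {act : Uᵐᵒᵖ →ₐ[k] Module.End k M} {N : H.LeftComoduleData M}
  {e : C.ModTilde H.toEnvRing act ≃ₗ[k] C.ComTilde hH.toIsLeftBialgebroid N}

variable (hN : N.IsLeftComodule)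
  (he : ∀ p m q, e (C.sd _ _ p m q) = C.cd hH.toIsLeftBialgebroid N p m q)
  (hX : ∀ m r, H.rmulLeft (fun r => N.lact r) (H.t (op r)) (N.coact m) =
    H.idActS act (C.lact_eq_of_equiv hN he) r (N.coact m))
  (hX' : ∀ y x, (C.tildeEnv H.toEnvRing).rmulLeft
    (fun x => C.tildeLact hH.toIsLeftBialgebroid N x) ((C.tildeEnv H.toEnvRing).t (op x))
      (C.tildeCoact hH.toIsLeftBialgebroid N hN y) =
    (C.tildeEnv H.toEnvRing).idActS (C.comTildeAct act N e) (C.tildeLact_eq hN he) x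
      (C.tildeCoact hH.toIsLeftBialgebroid N hN y))
  {τ : U →ₗ[k] H.TensOp} (hτ : H.IsTranslationMap τ)
  {τ' : C.Tilde H.toEnvRing →ₗ[k] (C.tildeEnv H.toEnvRing).TensOp}
  (hτ' : (C.tildeEnv H.toEnvRing).IsTranslationMap τ')

theorem twistTens_tildeComul
    (hf : ∀ a b u c d, τ' (C.tl H.toEnvRing (a ⊗ₜ b) u (c ⊗ₜ d)) =
      ∑ j, C.thickenOp H.toEnvRing (a ⊗ₜ C.q' j) c d (b ⊗ₜ C.p' j) (τ u))
    (a : P) (b : Q) (u : U) (c : Q) (d p : P) (m : M) (q : Q) :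
    EnvRing.twistTens (C.comTildeAct act N e) hτ' (C.tildeLact_eq hN he)
        (C.tildeCoact hH.toIsLeftBialgebroid N hN (C.cd hH.toIsLeftBialgebroid N p m q))
        (hX' (C.cd hH.toIsLeftBialgebroid N p m q))
        (C.tildeComul hH.toIsLeftBialgebroid (C.tl H.toEnvRing (a ⊗ₜ b) u (c ⊗ₜ d))) =
      thicken H.toEnvRing (C.isFramed_cd hH.toIsLeftBialgebroid N) d
        (EnvRing.twistTens act hτ (C.lact_eq_of_equiv hN he) (N.coact m) (hX m)
          (H.comul (H.eta (C.qp q a, C.qp b p) * u))) c := by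
  have h := hX' (C.cd hH.toIsLeftBialgebroid N p m q)
  have hcd := C.tildeCoact_cd hH.toIsLeftBialgebroid N hN p m q
  rw [hcd] at h
  have hcomul : C.tildeComul hH.toIsLeftBialgebroid (C.tl H.toEnvRing (a ⊗ₜ b) u (c ⊗ₜ d)) =
      C.tildeComulAux H.toEnvRing (a ⊗ₜ b) (c ⊗ₜ d) (H.comul u) := TriTensor.lift_mk _ _ _ _ _ _
  rw [EnvRing.eta, mul_assoc, hH.comul_s_mul, hH.comul_t_mul, hcomul]
  refine (EnvRing.twistTens_congr hτ' (C.tildeLact_eq hN he) hcd _ h _).trans ?_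
  exact C.twistTens_thicken H.toEnvRing act hτ hτ' (C.lact_eq_of_equiv hN he)
    (C.tildeLact_eq hN he) (C.isFramed_cd _ N) (C.comTildeAct_tl he) hf a b c d p (N.coact m) q
    (hX m) h (H.comul u)

theorem coact_tilde_of_coact
    (hf : ∀ a b u c d, τ' (C.tl H.toEnvRing (a ⊗ₜ b) u (c ⊗ₜ d)) =
      ∑ j, C.thickenOp H.toEnvRing (a ⊗ₜ C.q' j) c d (b ⊗ₜ C.p' j) (τ u))
    (h : ∀ u m, N.coact (act (op u) m) = EnvRing.twistTens act hτ (C.lact_eq_of_equiv hN he)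
      (N.coact m) (hX m) (H.comul u))
    (x : C.Tilde H.toEnvRing) (y : C.ComTilde hH.toIsLeftBialgebroid N) :
    C.tildeCoact hH.toIsLeftBialgebroid N hN (C.comTildeAct act N e (op x) y) =
      EnvRing.twistTens (C.comTildeAct act N e) hτ' (C.tildeLact_eq hN he)
        (C.tildeCoact hH.toIsLeftBialgebroid N hN y) (hX' y)
        (C.tildeComul hH.toIsLeftBialgebroid x) := by
  induction x using C.tilde_induction H.toEnvRing with
  | zero => rw [op_zero, map_zero, LinearMap.zero_apply, map_zero, map_zero, map_zero]
  | add x x' hx hx' =>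
    rw [op_add, map_add, LinearMap.add_apply, map_add, hx, hx', map_add, map_add]
  | tl a b u c d =>
    induction y using TriTensor.induction with
    | mk p m q =>
      refine Eq.trans ?_ (C.twistTens_tildeComul hH hN he hX hX' hτ hτ' hf a b u c d p m q).symm
      rw [← h, ← C.tildeCoact_cd hH.toIsLeftBialgebroid N hN]
      exact congrArg _ (C.comTildeAct_tl he a b u c d p m q)
    | zero =>
      -- The Takeuchi hypothesis for `M̃` is indexed by `y`, so it is restated for the image under
      -- the coaction before linearity of the twisted coaction can be used; likewise for `y + y'`.
      have h0 := hX' 0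
      rw [map_zero (C.tildeCoact hH.toIsLeftBialgebroid N hN)] at h0
      refine Eq.trans ?_ ((EnvRing.twistTens_congr hτ' _ (map_zero _) _ h0 _).trans
        (EnvRing.twistTens_zero hτ' _ h0 _)).symm
      rw [map_zero, map_zero]
    | add y y' hy hy' =>
      have h0 := hX' (y + y')
      rw [map_add (C.tildeCoact hH.toIsLeftBialgebroid N hN)] at h0
      refine Eq.trans ?_ ((EnvRing.twistTens_congr hτ' _ (map_add _ _ _) _ h0 _).trans
        (EnvRing.twistTens_add hτ' _ (hX' y) (hX' y') h0 _)).symm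
      rw [map_add, map_add, hy, hy']

theorem coact_of_coact_tilde
    (hf : ∀ a b u c d, τ' (C.tl H.toEnvRing (a ⊗ₜ b) u (c ⊗ₜ d)) =
      ∑ j, C.thickenOp H.toEnvRing (a ⊗ₜ C.q' j) c d (b ⊗ₜ C.p' j) (τ u))
    (h : ∀ (x : C.Tilde H.toEnvRing) (y : C.ComTilde hH.toIsLeftBialgebroid N),
      C.tildeCoact hH.toIsLeftBialgebroid N hN (C.comTildeAct act N e (op x) y) =
        EnvRing.twistTens (C.comTildeAct act N e) hτ' (C.tildeLact_eq hN he)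
          (C.tildeCoact hH.toIsLeftBialgebroid N hN y) (hX' y)
          (C.tildeComul hH.toIsLeftBialgebroid x)) (u : U) (m : M) :
    N.coact (act (op u) m) = EnvRing.twistTens act hτ (C.lact_eq_of_equiv hN he)
      (N.coact m) (hX m) (H.comul u) := by
  -- The right side of the condition lies in the Takeuchi product, because `Δ(u)` does; equality can
  -- therefore be tested after thickening.
  have hT : ∀ r, H.rmulLeft (fun r => N.lact r) (H.t (op r))
      (EnvRing.twistTens act hτ (C.lact_eq_of_equiv hN he) (N.coact m) (hX m) (H.comul u)) =
      LeftBialgebroidData.idCoRight hH.toIsLeftBialgebroid N hN r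
        (EnvRing.twistTens act hτ (C.lact_eq_of_equiv hN he) (N.coact m) (hX m) (H.comul u)) := by
    intro r
    rw [EnvRing.rmulLeft_twistTens, hH.comul_takeuchi, ← EnvRing.idActS_twistTens]
    generalize EnvRing.twistTens act hτ (C.lact_eq_of_equiv hN he) (N.coact m) (hX m) (H.comul u) = Y
    induction Y using BalTensor.induction with
    | zero => simp
    | add X Y hX hY => simp only [map_add, hX, hY]
    | mk n e =>
      rw [H.idActS_tmul, LeftBialgebroidData.idCoRight_tmul, C.coRight_eq_of_equiv hN he]
  refine C.eq_of_thicken_eq hH.toIsLeftBialgebroid N hN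
    (fun r => LeftBialgebroidData.coact_takeuchi hH.toIsLeftBialgebroid N hN r _) hT
    fun d c => ?_
  -- The elements of `Ũ` act on `M` only through products `η(qa, bp)u`; choosing `q ⊗ a` and `b ⊗ p`
  -- from `ψ⁻¹(1)` and summing recovers `u`.
  have hu : u = ∑ i, ∑ j, H.eta (C.qp (C.q i) (C.p i), C.qp (C.q j) (C.p j)) * u := by
    simp only [EnvRing.eta, ← Finset.sum_mul, ← Finset.mul_sum, ← map_sum, ← Finset.op_sum,
      C.sum_qp, op_one, map_one, one_mul]
  have hgen : ∀ i j, thicken H.toEnvRing (C.isFramed_cd hH.toIsLeftBialgebroid N) d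
      (N.coact (act (op (H.eta (C.qp (C.q i) (C.p i), C.qp (C.q j) (C.p j)) * u)) m)) c =
      thicken H.toEnvRing (C.isFramed_cd hH.toIsLeftBialgebroid N) d
        (EnvRing.twistTens act hτ (C.lact_eq_of_equiv hN he) (N.coact m) (hX m)
          (H.comul (H.eta (C.qp (C.q i) (C.p i), C.qp (C.q j) (C.p j)) * u))) c := by
    intro i j
    refine Eq.trans ?_ ((h _ _).trans
      (C.twistTens_tildeComul hH hN he hX hX' hτ hτ' hf (C.p i) (C.q j) u c d (C.p j) m (C.q i)))
    rw [C.comTildeAct_tl he, tildeCoact_cd]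
  rw [hu]
  simp only [Finset.op_sum, map_sum, LinearMap.sum_apply, hgen]

theorem isAYD_iff_isAYD_tilde (hN : N.IsLeftComodule)
    (he : ∀ p m q, e (C.sd _ _ p m q) = C.cd hH.toIsLeftBialgebroid N p m q) :
    LeftBialgebroidData.IsAYD act N ↔ LeftBialgebroidData.IsAYD (C.comTildeAct act N e)
      (C.tildeComodule hH.toIsLeftBialgebroid N hN) := by
  have hU := C.tilde_isLeftHopfAlgebroid hH
  have hX := LeftBialgebroidData.rmulLeft_coact_eq_idActS hH.toIsLeftBialgebroid hN
    (C.lact_eq_of_equiv hN he) (C.coRight_eq_of_equiv hN he)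
  have hX' := LeftBialgebroidData.rmulLeft_coact_eq_idActS hU.toIsLeftBialgebroid
    (C.tildeComodule_isLeftComodule hH.toIsLeftBialgebroid N hN)
    (C.tildeLact_eq hN he) (C.coRight_tilde_eq hN hU.toIsLeftBialgebroid he)
  have hτ := LeftBialgebroidData.isTranslationMap_translation hH
  have hτ' := LeftBialgebroidData.isTranslationMap_translation hU
  refine (LeftBialgebroidData.isAYD_iff hH hN (C.lact_eq_of_equiv hN he)
    (C.coRight_eq_of_equiv hN he)).trans (Iff.trans ⟨?_, ?_⟩
    (LeftBialgebroidData.isAYD_iff hU (C.tildeComodule_isLeftComodule hH.toIsLeftBialgebroid N hN)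
      (C.tildeLact_eq hN he) (C.coRight_tilde_eq hN hU.toIsLeftBialgebroid he)).symm)
  · exact C.coact_tilde_of_coact hH hN he hX hX' hτ hτ' (C.translation_tl hH)
  · exact C.coact_of_coact_tilde hH hN he hX hX' hτ hτ' (C.translation_tl hH)

theorem isSAYD_iff_isSAYD_tilde (hN : N.IsLeftComodule)
    (he : ∀ p m q, e (C.sd _ _ p m q) = C.cd hH.toIsLeftBialgebroid N p m q) :
    LeftBialgebroidData.IsSAYD act N ↔ LeftBialgebroidData.IsSAYD (C.comTildeAct act N e)
      (C.tildeComodule hH.toIsLeftBialgebroid N hN) :=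
  (LeftBialgebroidData.isSAYD_iff (C.lact_eq_of_equiv hN he)).trans
    ((and_congr (C.isAYD_iff_isAYD_tilde hH hN he) (C.actTens_tildeCoact_iff hN he)).trans
      (LeftBialgebroidData.isSAYD_iff (N := C.tildeComodule hH.toIsLeftBialgebroid N hN)
        (C.tildeLact_eq hN he)).symm)

end AYD

section Main

variable {H : LeftBialgebroidData k R U} (hH : H.IsLeftHopfAlgebroid)
  (act : Uᵐᵒᵖ →ₐ[k] Module.End k M) (N : H.LeftComoduleData M) (hN : N.IsLeftComodule)

theorem isAYD_iff_tildeIsAYD :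
    LeftBialgebroidData.IsAYD act N ↔ C.TildeIsAYD hH.toIsLeftBialgebroid N act hN := by
  constructor
  · intro h
    obtain ⟨e, he⟩ := C.exists_modTilde_equiv act N hH.toIsLeftBialgebroid h.left_eq
      ((LeftBialgebroidData.right_eq_iff _).1 h.right_eq)
    exact ⟨e, he, (C.isAYD_iff_isAYD_tilde hH hN he).1 h⟩
  · rintro ⟨e, he, h⟩
    exact (C.isAYD_iff_isAYD_tilde hH hN he).2 h

theorem isSAYD_iff_tildeIsSAYD :
    LeftBialgebroidData.IsSAYD act N ↔ C.TildeIsSAYD hH.toIsLeftBialgebroid N act hN := by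
  constructor
  · intro h
    obtain ⟨e, he⟩ := C.exists_modTilde_equiv act N hH.toIsLeftBialgebroid h.left_eq
      ((LeftBialgebroidData.right_eq_iff _).1 h.right_eq)
    exact ⟨e, he, (C.isSAYD_iff_isSAYD_tilde hH hN he).1 h⟩
  · rintro ⟨e, he, h⟩
    exact (C.isSAYD_iff_isSAYD_tilde hH hN he).2 h

end Main

end MoritaContext

end MoritaBaseChange

end

open MoritaBaseChange in
theorem lemma3p1 {k R S P Q U M : Type*} [CommRing k] [Ring R] [Algebra k R] [Ring S] [Algebra k S]
    [AddCommGroup P] [Module k P] [Module S P] [Module Rᵐᵒᵖ P] [SMulCommClass S Rᵐᵒᵖ P]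
    [IsScalarTower k S P] [IsScalarTower k Rᵐᵒᵖ P]
    [AddCommGroup Q] [Module k Q] [Module R Q] [Module Sᵐᵒᵖ Q] [SMulCommClass R Sᵐᵒᵖ Q]
    [IsScalarTower k R Q] [IsScalarTower k Sᵐᵒᵖ Q]
    [Ring U] [Algebra k U] [AddCommGroup M] [Module k M]
    (C : MoritaContext k R S P Q)
    (H : LeftBialgebroidData k R U) (hH : H.IsLeftHopfAlgebroid)
    (act : Uᵐᵒᵖ →ₐ[k] Module.End k M)
    (N : H.LeftComoduleData M) (hN : N.IsLeftComodule) :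
    (C.tilde hH.toIsLeftBialgebroid).IsLeftHopfAlgebroid ∧
    (C.tildeComodule hH.toIsLeftBialgebroid N hN).IsLeftComodule ∧
    (LeftBialgebroidData.IsAYD act N ↔ C.TildeIsAYD hH.toIsLeftBialgebroid N act hN) ∧
    (LeftBialgebroidData.IsSAYD act N ↔ C.TildeIsSAYD hH.toIsLeftBialgebroid N act hN) :=
  ⟨C.tilde_isLeftHopfAlgebroid hH, C.tildeComodule_isLeftComodule _ N hN,
    C.isAYD_iff_tildeIsAYD hH act N hN, C.isSAYD_iff_tildeIsSAYD hH act N hN⟩
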